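/- Let $L>0$, $\alpha,\beta\in\mathbb R$ and $s\ge 0$. Write $\langle a\rangle=1+|a|$. For an $L$-periodic distribution $f$ let $\hat f(n)=\frac1L\langle f,e^{-2\pi i n x/L}\rangle$, and let $H^s_{per}$ be the space of $L$-periodic distributions with $\|f\|_{H^s_{per}}=\|\langle n\rangle^s\hat f(n)\|_{\ell^2_n}<\infty$. Let $X^S_{s,b}$ and $X^B_{s,b}$ be the completions of the smooth functions on $\mathbb R\times\mathbb R$ that are $L$-periodic in $x$ and Schwartz in $t$ with respect to the norms $$\|F\|_{X^S_{s,b}}=\|\langle\tau+(2\pi n/L)^2\rangle^b\langle n\rangle^s\widetilde F(n,\tau)\|_{\ell^2_nL^2_\tau},\qquad \|F\|_{X^B_{s,b}}=\|\langle|\tau|-\gamma_L(n)\rangle^b\langle n\rangle^s\widetilde F(n,\tau)\|_{\ell^2_nL^2_\tau},$$ where $\widetilde F$ is the space-time Fourier transform and $\gamma_L(n)=(2\pi/L)^2\sqrt{n^2+n^4}$; let $X^{S,[0,T]}_{s,b}$ and $X^{B,[0,T]}_{s,b}$ be the spaces of restrictions of their elements to $[0,T]$. Consider the periodic initial value problem,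 with $u$ complex-valued and $v$ real-valued, $$iu_t+u_{xx}=\alpha vu,\qquad v_{tt}-v_{xx}+v_{xxxx}=\beta(|u|^2)_{xx},$$ $$u(\cdot,0)=u_0,\qquad v(\cdot,0)=v_0,\qquad v_t(\cdot,0)=(v_1)_x,$$ where the equations and the condition on $v_t$ hold in the sense of periodic distributions. Data are triples $(u_0,v_0,v_1)\in H^s_{per}\times H^s_{per}\times H^{s-1}_{per}$ with $v_0,v_1$ real-valued. There are $b>1/2$ and a positive function $T=T(\|u_0\|_{H^s_{per}},\|v_0\|_{H^s_{per}},\|v_1\|_{H^{s-1}_{per}})$ such that for all data $(u_0,v_0,v_1)$, with $T$ evaluated at their norms, the problem has exactly one solution $(u,v)$ on $[0,T]$ with $$u\in C([0,T];H^s_{per})\cap X^{S,[0,T]}_{s,b},\qquad v\in C([0,T];H^s_{per})\cap X^{B,[0,T]}_{s,b}.$$ Moreover, the map $(u_0,v_0,v_1)\mapsto(u,v)$ is locally Lipschitz from $H^s_{per}\times H^s_{per}\times H^{s-1}_{per}$ into $C([0,T];H^s_{per}\times H^s_{per})$: for all data $(u_0,v_0,v_1)$, with $T$ the time belonging to them,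 there are $r>0$ and $K$ such that all data at distance less than $r$ from $(u_0,v_0,v_1)$ also have exactly one solution on $[0,T]$ in the above class, and for any two such data the corresponding solutions $(u,v)$ and $(u',v')$ satisfy $$\sup_{t\in[0,T]}\big(\|u(t)-u'(t)\|_{H^s_{per}}+\|v(t)-v'(t)\|_{H^s_{per}}\big)\le K\,d,$$ where $d$ is the distance of the two data, i.e. the sum of the $H^s_{per}$, $H^s_{per}$ and $H^{s-1}_{per}$ norms of the differences of their components. -/

import Mathlib

open Complex MeasureTheory Set Filter Topology
open scoped ENNReal ContDiff

noncomputable section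

/-- Test functions: smooth `L`-periodic functions `ℝ → ℂ`. -/
def PerTest (L : ℝ) : Submodule ℂ (ℝ → ℂ) where
  carrier := {φ | ContDiff ℝ ∞ φ ∧ Function.Periodic φ L}
  zero_mem' := ⟨contDiff_const, fun _ => rfl⟩
  add_mem' := fun ha hb => ⟨ha.1.add hb.1, ha.2.add hb.2⟩
  smul_mem' := fun c _ ha => ⟨contDiff_const.smul ha.1, fun x => by
    simp only [Pi.smul_apply, ha.2 x]⟩

/-- Differentiation `φ ↦ φ'` on test functions. -/
def PerTest.deriv (L : ℝ) : PerTest L →ₗ[ℂ] PerTest L where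
  toFun φ := ⟨_root_.deriv φ.1, (contDiff_infty_iff_deriv.1 φ.2.1).2, fun x => by
    rw [← deriv_comp_add_const φ.1 L x]
    congr 1
    funext y
    exact φ.2.2 y⟩
  map_add' φ ψ := by
    ext x
    exact deriv_add (φ.2.1.differentiable (by simp) x) (ψ.2.1.differentiable (by simp) x)
  map_smul' c φ := by
    ext x
    exact deriv_const_smul c (φ.2.1.differentiable (by simp) x)

/-- The exponential `x ↦ e^{2πi n x / L}` as a test function. -/
def PerTest.exp (L : ℝ) [hL : Fact (0 < L)] (n : ℤ) : PerTest L :=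
  ⟨fun x => Complex.exp (2 * Real.pi * I * n / L * x), by
    refine ⟨(contDiff_const.mul ofRealCLM.contDiff).cexp, fun x => ?_⟩
    have h : (L : ℂ) ≠ 0 := by exact_mod_cast hL.out.ne'
    have : (2 * Real.pi * I * n / L * ((x + L : ℝ) : ℂ) : ℂ)
        = 2 * Real.pi * I * n / L * x + n * (2 * Real.pi * I) := by
      push_cast
      field_simp
    simp only [this, Complex.exp_add, Complex.exp_int_mul_two_pi_mul_I, mul_one]⟩

/-- The linear functionals on smooth `L`-periodic functions that are continuous, i.e. bounded by a
constant times the maximum of the sup norms of finitely many derivatives. -/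
def perDistSubmodule (L : ℝ) : Submodule ℂ (PerTest L →ₗ[ℂ] ℂ) where
  carrier := {D | ∃ (C : ℝ) (N : ℕ), ∀ (φ : PerTest L) (M : ℝ),
    (∀ k ≤ N, ∀ x : ℝ, ‖iteratedDeriv k φ.1 x‖ ≤ M) → ‖D φ‖ ≤ C * M}
  zero_mem' := ⟨0, 0, fun φ M _ => by simp⟩
  add_mem' := by
    rintro D E ⟨C, N, h⟩ ⟨C', N', h'⟩
    refine ⟨C + C', max N N', fun φ M hM => ?_⟩
    have h1 := h φ M fun k hk => hM k (hk.trans (le_max_left _ _))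
    have h2 := h' φ M fun k hk => hM k (hk.trans (le_max_right _ _))
    calc ‖(D + E) φ‖ ≤ ‖D φ‖ + ‖E φ‖ := norm_add_le _ _
      _ ≤ (C + C') * M := by linarith
  smul_mem' := by
    rintro c D ⟨C, N, h⟩
    refine ⟨‖c‖ * C, N, fun φ M hM => ?_⟩
    have h1 := h φ M hM
    calc ‖(c • D) φ‖ = ‖c‖ * ‖D φ‖ := by
          rw [LinearMap.smul_apply, smul_eq_mul, norm_mul]
      _ ≤ ‖c‖ * (C * M) := by gcongr
      _ = ‖c‖ * C * M := by ring

/-- The space of `L`-periodic distributions. -/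
abbrev PerDist (L : ℝ) : Type := perDistSubmodule L

namespace PerDist

variable {L : ℝ}

/-- The distributional derivative: `⟨D', φ⟩ = -⟨D, φ'⟩`. -/
def dx (D : PerDist L) : PerDist L :=
  ⟨-(D.1.comp (PerTest.deriv L)), by
    obtain ⟨C, N, h⟩ := D.2
    refine ⟨C, N + 1, fun φ M hM => ?_⟩
    have := h (PerTest.deriv L φ) M fun k hk x => by
      have := hM (k + 1) (by omega) x
      rwa [iteratedDeriv_succ'] at this
    simpa using this⟩

/-- A real-valued distribution: it takes real values on real test functions. -/
def IsReal (D : PerDist L) : Prop :=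
  ∀ φ : PerTest L, (∀ x, (φ.1 x).im = 0) → (D.1 φ).im = 0

/-- Fourier coefficients `(1/L) ⟨D, e^{-2πi n x / L}⟩`. -/
def coeff [Fact (0 < L)] (D : PerDist L) (n : ℤ) : ℂ :=
  (1 / L : ℂ) * D.1 (PerTest.exp L (-n))

/-- `D ∈ H^s_per`, with the weight `⟨n⟩ = 1 + |n|`. -/
def MemHs [Fact (0 < L)] (s : ℝ) (D : PerDist L) : Prop :=
  Summable fun n : ℤ => ((1 + |(n : ℝ)|) ^ s * ‖D.coeff n‖) ^ 2

/-- The norm of `H^s_per`, for `D ∈ H^s_per`. -/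
def hsNorm [Fact (0 < L)] (s : ℝ) (D : PerDist L) : ℝ :=
  Real.sqrt (∑' n : ℤ, ((1 + |(n : ℝ)|) ^ s * ‖D.coeff n‖) ^ 2)

end PerDist

/-- An integrable function on the circle of length `L`, pulled back to `[0, L]`, is integrable. -/
theorem intervalIntegrable_of_circle {L : ℝ} [hL : Fact (0 < L)] {g : AddCircle L → ℂ}
    (hg : Integrable g AddCircle.haarAddCircle) :
    IntervalIntegrable (fun x : ℝ => g x) volume 0 L := by
  have h1 : Integrable g (volume : Measure (AddCircle L)) := by
    rw [AddCircle.volume_eq_smul_haarAddCircle]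
    exact hg.smul_measure ENNReal.ofReal_ne_top
  rw [intervalIntegrable_iff_integrableOn_Ioc_of_le hL.out.le]
  have h2 := (AddCircle.measurePreserving_mk L 0).integrable_comp_of_integrable h1
  rw [zero_add] at h2
  exact h2

/-- The product of an integrable function on the circle with a test function is integrable. -/
theorem intervalIntegrable_mul_test {L : ℝ} [Fact (0 < L)] {g : AddCircle L → ℂ}
    (hg : Integrable g AddCircle.haarAddCircle) (φ : PerTest L) :
    IntervalIntegrable (fun x : ℝ => g x * φ.1 x) volume 0 L :=
  (intervalIntegrable_of_circle hg).mul_continuousOn φ.2.1.continuous.continuousOn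

/-- The periodic distribution `φ ↦ ∫₀ᴸ g φ dx` defined by an integrable `L`-periodic
function `g`. -/
def PerDist.ofFun {L : ℝ} [hL : Fact (0 < L)] (g : AddCircle L → ℂ)
    (hg : Integrable g AddCircle.haarAddCircle) : PerDist L :=
  ⟨{ toFun := fun φ => ∫ x in (0 : ℝ)..L, g x * φ.1 x
     map_add' := fun φ ψ => by
       rw [← intervalIntegral.integral_add (intervalIntegrable_mul_test hg φ)
         (intervalIntegrable_mul_test hg ψ)]
       congr 1
       funext x
       exact mul_add _ _ _
     map_smul' := fun c φ => by
       rw [RingHom.id_apply, ← intervalIntegral.integral_smul]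
       congr 1
       funext x
       exact mul_left_comm (g x) c (φ.1 x) }, by
    refine ⟨∫ x in (0 : ℝ)..L, ‖g x‖, 0, fun φ M hM => ?_⟩
    rw [← intervalIntegral.integral_mul_const]
    refine intervalIntegral.norm_integral_le_of_norm_le hL.out.le (Eventually.of_forall ?_)
      ((intervalIntegrable_of_circle hg).norm.mul_const M)
    intro x _
    rw [norm_mul]
    have := hM 0 le_rfl x
    rw [iteratedDeriv_zero] at this
    gcongr⟩

/-- The space `L²_per` of square-integrable complex functions on the circle of length `L`. -/
abbrev L2Per (L : ℝ) [Fact (0 < L)] : Type :=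
  Lp ℂ 2 (AddCircle.haarAddCircle : Measure (AddCircle L))

namespace L2Per

variable {L : ℝ} [Fact (0 < L)]

/-- The periodic distribution defined by `f ∈ L²_per`. For `s ≥ 0` every element of `H^s_per`
arises from exactly one `f`. -/
def toDist (f : L2Per L) : PerDist L :=
  PerDist.ofFun f ((Lp.memLp f).integrable (by norm_num))

/-- The product `f g ∈ L¹` of `f, g ∈ L²_per`, as a periodic distribution. -/
def mulDist (f g : L2Per L) : PerDist L :=
  PerDist.ofFun (fun x => f x * g x) (MemLp.integrable_mul (Lp.memLp f) (Lp.memLp g))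

/-- The function `|f|² ∈ L¹`, for `f ∈ L²_per`, as a periodic distribution. -/
def absSqDist (f : L2Per L) : PerDist L :=
  PerDist.ofFun (fun x => ((‖f x‖ ^ 2 : ℝ) : ℂ))
    (by
      have h := (memLp_two_iff_integrable_sq_norm (Lp.aestronglyMeasurable f)).1 (Lp.memLp f)
      exact h.ofReal)

end L2Per

section Bourgain

variable {L : ℝ} [Fact (0 < L)]

/-- `F n τ` is the space-time Fourier transform of `w`: `n` is the spatial mode, `τ` the (angular)
time frequency, and the Fourier inversion formula in time holds for each mode. -/
def IsSpaceTimeFourier (w : ℝ → L2Per L) (F : ℤ → ℝ → ℂ) : Prop :=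
  ∀ n : ℤ, Integrable (F n) ∧ ∀ t : ℝ,
    (w t).toDist.coeff n = (1 / (2 * Real.pi) : ℂ) * ∫ τ : ℝ, F n τ * Complex.exp (I * t * τ)

/-- The norm `‖⟨σ(n,τ)⟩^b ⟨n⟩^s F‖` in `ℓ²_n L²_τ`, where `⟨a⟩ = 1 + |a|`. -/
def weightedNorm (σ : ℤ → ℝ → ℝ) (s b : ℝ) (F : ℤ → ℝ → ℂ) : ℝ≥0∞ :=
  (∑' n : ℤ, ∫⁻ τ : ℝ,
    (ENNReal.ofReal ((1 + |σ n τ|) ^ b * (1 + |(n : ℝ)|) ^ s) * ‖F n τ‖ₑ) ^ 2) ^ (1 / 2 : ℝ)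

/-- The Bourgain norm of `w` (infinite if `w` has no space-time Fourier transform with finite
weighted norm). For `b > 1/2` and `s ≥ 0` a finite weighted norm makes every `F n` integrable and
makes its inverse transform continuous in time with values in `H^s_per`, so that the functions of
finite norm are exactly the elements of the completion of the smooth functions. -/
def bourgainNorm (σ : ℤ → ℝ → ℝ) (s b : ℝ) (w : ℝ → L2Per L) : ℝ≥0∞ :=
  ⨅ (F : ℤ → ℝ → ℂ) (_ : IsSpaceTimeFourier w F), weightedNorm σ s b F

/-- The norm of the restriction space on the time set `J`: the infimum of the Bourgain norms of
the extensions of `u` from `J`. -/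
def bourgainNormOn (σ : ℤ → ℝ → ℝ) (s b : ℝ) (J : Set ℝ) (u : ℝ → L2Per L) : ℝ≥0∞ :=
  ⨅ (w : ℝ → L2Per L) (_ : ∀ t ∈ J, w t = u t), bourgainNorm σ s b w

/-- The Schrödinger modulation `τ + (2πn/L)²`. -/
def schrodingerSymbol (L : ℝ) (n : ℤ) (τ : ℝ) : ℝ := τ + (2 * Real.pi * n / L) ^ 2

/-- The Boussinesq modulation `|τ| - γ_L(n)`, with `γ_L(n) = (2π/L)² √(n² + n⁴)`. -/
def boussinesqSymbol (L : ℝ) (n : ℤ) (τ : ℝ) : ℝ :=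
  |τ| - (2 * Real.pi / L) ^ 2 * Real.sqrt ((n : ℝ) ^ 2 + (n : ℝ) ^ 4)

end Bourgain

section System

variable {L : ℝ} [Fact (0 < L)]

/-- `w ∈ C([0,T]; H^s_per)`. -/
def ContinuousInHs (s T : ℝ) (w : ℝ → L2Per L) : Prop :=
  (∀ t ∈ Icc 0 T, (w t).toDist.MemHs s) ∧
  ∀ t₀ ∈ Icc 0 T,
    Tendsto (fun t => (w t - w t₀).toDist.hsNorm s) (𝓝[Icc 0 T] t₀) (𝓝 0)

/-- `w'` is the time derivative of `w` on `[0,T]` (one-sided at the end points) in the sense of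
periodic distributions. -/
def HasTimeDeriv (T : ℝ) (w w' : ℝ → PerDist L) : Prop :=
  ∀ t ∈ Icc 0 T, ∀ φ : PerTest L,
    HasDerivWithinAt (fun r => (w r).1 φ) ((w' t).1 φ) (Icc 0 T) t

/-- `(u, v)`, with `v` real-valued, solves on `[0,T]` in the sense of distributions
`i u_t + u_xx = α v u`, `v_tt - v_xx + v_xxxx = β (|u|²)_xx` with the initial conditions
`u(0) = u₀`, `v(0) = v₀`, `v_t(0) = (v₁)_x`. -/
def SolvesSB (α β T : ℝ) (u₀ v₀ v₁ : PerDist L) (u v : ℝ → L2Per L) : Prop :=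
  (∀ t ∈ Icc 0 T, (v t).toDist.IsReal) ∧
  ∃ ut vt vtt : ℝ → PerDist L,
    HasTimeDeriv T (fun t => (u t).toDist) ut ∧
    HasTimeDeriv T (fun t => (v t).toDist) vt ∧
    HasTimeDeriv T vt vtt ∧
    (∀ t ∈ Icc 0 T, I • ut t + (u t).toDist.dx.dx = (α : ℂ) • L2Per.mulDist (v t) (u t)) ∧
    (∀ t ∈ Icc 0 T, vtt t - (v t).toDist.dx.dx + (v t).toDist.dx.dx.dx.dx =
      (β : ℂ) • (L2Per.absSqDist (u t)).dx.dx) ∧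
    (u 0).toDist = u₀ ∧ (v 0).toDist = v₀ ∧ vt 0 = v₁.dx

/-- `(u, v)` solves the initial value problem on `[0,T]` with
`u ∈ C([0,T]; H^s) ∩ X^{S,[0,T]}_{s,b}` and `v ∈ C([0,T]; H^s) ∩ X^{B,[0,T]}_{s,b}`. -/
def IsSolutionInClass (α β s b T : ℝ) (u₀ v₀ v₁ : PerDist L) (u v : ℝ → L2Per L) : Prop :=
  SolvesSB α β T u₀ v₀ v₁ u v ∧
  ContinuousInHs s T u ∧ bourgainNormOn (schrodingerSymbol L) s b (Icc 0 T) u < ⊤ ∧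
  ContinuousInHs s T v ∧ bourgainNormOn (boussinesqSymbol L) s b (Icc 0 T) v < ⊤

/-- On `[0,T]` there is exactly one solution in the class above. -/
def UniquelySolvable (α β s b T : ℝ) (u₀ v₀ v₁ : PerDist L) : Prop :=
  ∃ u v : ℝ → L2Per L, IsSolutionInClass α β s b T u₀ v₀ v₁ u v ∧
    ∀ u' v' : ℝ → L2Per L, IsSolutionInClass α β s b T u₀ v₀ v₁ u' v' →
      ∀ t ∈ Icc 0 T, u' t = u t ∧ v' t = v t

/-- Initial data: `u₀, v₀ ∈ H^s_per` and `v₁ ∈ H^{s-1}_per`, with `v₀` and `v₁` real-valued. -/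
def IsData (s : ℝ) (u₀ v₀ v₁ : PerDist L) : Prop :=
  u₀.MemHs s ∧ v₀.MemHs s ∧ v₁.MemHs (s - 1) ∧ v₀.IsReal ∧ v₁.IsReal

/-- The distance of two data in `H^s_per × H^s_per × H^{s-1}_per`. -/
def dataDist (s : ℝ) (u₀ v₀ v₁ u₀' v₀' v₁' : PerDist L) : ℝ :=
  (u₀ - u₀').hsNorm s + (v₀ - v₀').hsNorm s + (v₁ - v₁').hsNorm (s - 1)

end System

end

/-! Put θ = (2π/L)² and W = 2πin/L, so that W² = -θn². Since n² ≤ √(n²+n⁴) ≤ n²+1, the Boussinesq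
frequency differs from θn² by a bounded amount, and v_xx may be treated as a perturbation of v_tt +
v_xxxx. On the modes n ≠ 0 set z = (v - i W⁻² v_t)/2. As v is real, v = z + conj z, and z_t = i W² z
- (i/2)(β|u|² + v): the two derivatives on |u|² cancel against W⁻². Thus u and z evolve under the
same Schrödinger group with nonlinearities that lose no derivative; the zero mode of v is constant
in time. Undoing the group and the weights ⟨n⟩^s turns the system into an evolution equation for a
curve ("profile") in ℓ² × ℓ², whose field consists of the convolutions u z, u conj z, u conj u and
of bounded linear terms.

This field need not lie in ℓ² at each single time, but it is square-integrable in time along the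
relevant curves. For free solutions, the n-th coefficient of a product is a trigonometric series in
t with frequencies 2θj(n-j) or 2θn(n-j). These are integer multiples of θ, and apart from the case n
= 0 of the second family each is attained by at most two j. Bessel's inequality over the period P =
2π/θ gives the bilinear estimate `lintegral_bilSq_le`, and the weights are harmless because ⟨n⟩ ≤
⟨j⟩⟨n-j⟩. A curve a + ∫f inherits the estimate: by Cauchy–Schwarz, the squares of linear functionals
at its points are dominated by an average over a and the values of f (`DominatedBy`,
`lintegral_bilSq_pathOf_le`).

The exponent is b = 1, for which a finite Schrödinger norm gives a profile with derivative in
L²([0,T]; ℓ²). The unknown is this derivative. The estimate `lintegral_fieldDistSq_le` is used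
twice: with T small it makes the Picard map a contraction (`exists_isMildSol`); with a weight
e^{-lt}, l large, it gives Lipschitz dependence, hence uniqueness, on all of [0,T] for curves of any
finite size (`IsMildSol.exists_lipschitz`).

The translation to the original problem is coefficientwise. A profile solution satisfies the
equations (`IsMildSol.solvesSB`) and has finite Bourgain norms, by a cut-off in time and Plancherel
(`exists_fourier_extension`). Conversely, Plancherel for difference quotients
(`lintegral_deriv_sq_le`) shows that each solution in the class comes from a profile solution
(`IsSolutionInClass.exists_isMildSol`). -/

noncomputable section

/-! ### Square-summable sequences -/

/-- Square-summable complex sequences indexed by the spatial mode. -/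
abbrev SeqL2 : Type := lp (fun _ : ℤ => ℂ) 2

namespace SeqL2

theorem hasSum_norm_sq (a : SeqL2) : HasSum (fun n => ‖a n‖ ^ 2) (‖a‖ ^ 2) := by
  have := lp.hasSum_norm (p := 2) (by norm_num) a
  simpa using this

theorem enorm_sq_eq (a : SeqL2) : ‖a‖ₑ ^ 2 = ∑' n, ‖a n‖ₑ ^ 2 := by
  have h := hasSum_norm_sq a
  rw [← ofReal_norm, ← ENNReal.ofReal_pow (norm_nonneg _), ← h.tsum_eq,
    ENNReal.ofReal_tsum_of_nonneg (fun n => by positivity) h.summable]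
  congr 1
  funext n
  rw [← ofReal_norm, ENNReal.ofReal_pow (norm_nonneg _)]

theorem memℓp_iff_summable {c : ℤ → ℂ} : Memℓp c 2 ↔ Summable fun n => ‖c n‖ ^ 2 := by
  rw [memℓp_gen_iff (by norm_num)]
  simp

theorem summable_iff_enorm {c : ℤ → ℂ} :
    (Summable fun n => ‖c n‖ ^ 2) ↔ ∑' n, ‖c n‖ₑ ^ 2 ≠ ⊤ := by
  have h : ∀ n, ‖c n‖ₑ ^ 2 = ENNReal.ofReal (‖c n‖ ^ 2) := fun n => by
    rw [← ofReal_norm, ENNReal.ofReal_pow (norm_nonneg _)]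
  simp_rw [h]
  constructor
  · intro hs
    exact hs.tsum_ofReal_ne_top
  · intro hs
    have := ENNReal.summable_toReal hs
    refine this.congr fun n => ?_
    rw [ENNReal.toReal_ofReal (by positivity)]

/-- The sequence `c` as an element of `ℓ²`, and `0` when it is not square-summable. -/
def ofFun (c : ℤ → ℂ) : SeqL2 :=
  open Classical in if h : Memℓp c 2 then ⟨c, h⟩ else 0

theorem ofFun_apply {c : ℤ → ℂ} (h : ∑' n, ‖c n‖ₑ ^ 2 ≠ ⊤) (n : ℤ) : ofFun c n = c n := by
  have : Memℓp c 2 := memℓp_iff_summable.2 (summable_iff_enorm.2 h)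
  rw [ofFun, dif_pos this]

theorem memℓp_comp (a : SeqL2) (σ : ℤ ≃ ℤ) : Memℓp (fun n => a (σ n)) 2 := by
  rw [memℓp_iff_summable]
  exact (σ.summable_iff (f := fun n => ‖a n‖ ^ 2)).2 (hasSum_norm_sq a).summable

/-- The sequence `a` with its index substituted by `σ`. -/
def reindex (σ : ℤ ≃ ℤ) (a : SeqL2) : SeqL2 := ⟨fun n => a (σ n), memℓp_comp a σ⟩

theorem norm_eq_of_sq {a b : SeqL2} (h : ∑' n, ‖a n‖ₑ ^ 2 = ∑' n, ‖b n‖ₑ ^ 2) : ‖a‖ = ‖b‖ := by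
  rw [← enorm_sq_eq, ← enorm_sq_eq] at h
  have h2 := (ENNReal.pow_right_strictMono (n := 2) (by norm_num)).injective h
  rwa [enorm_eq_iff_norm_eq] at h2

theorem norm_reindex (σ : ℤ ≃ ℤ) (a : SeqL2) : ‖reindex σ a‖ = ‖a‖ :=
  norm_eq_of_sq (σ.tsum_eq fun n => ‖a n‖ₑ ^ 2)

/-- The Fourier coefficients `n ↦ conj (a (-n))` of the complex conjugate. -/
def conjL : SeqL2 →ₗᵢ[ℝ] SeqL2 where
  toFun a := star (reindex (Equiv.neg ℤ) a)
  map_add' a b := by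
    ext n
    change star (a (-n) + b (-n)) = star (a (-n)) + star (b (-n))
    rw [star_add]
  map_smul' c a := by
    ext n
    change star (c • a (-n)) = c • star (a (-n))
    rw [star_smul, star_trivial]
  norm_map' a := by
    change ‖star _‖ = _
    rw [norm_star, norm_reindex]

theorem conjL_apply (a : SeqL2) (n : ℤ) : conjL a n = (starRingEnd ℂ) (a (-n)) := rfl

theorem summable_mul_sub (a b : SeqL2) (n : ℤ) : Summable fun j => ‖a j‖ * ‖b (n - j)‖ :=
  lp.summable_mul (p := 2) (q := 2) (by constructor <;> norm_num) a (reindex (Equiv.subLeft n) b)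

theorem tsum_mul_sub_le (a b : SeqL2) (n : ℤ) :
    ∑' j, ‖a j‖ * ‖b (n - j)‖ ≤ ‖a‖ * ‖b‖ := by
  have := lp.tsum_mul_le_mul_norm' (p := 2) (q := 2) (by constructor <;> norm_num) a
    (reindex (Equiv.subLeft n) b)
  rwa [norm_reindex] at this

end SeqL2

/-! ### Sobolev weights -/

/-- The Japanese-bracket weight `⟨n⟩^s`. -/
def bracket (s : ℝ) (n : ℤ) : ℝ := (1 + |(n : ℝ)|) ^ s

theorem bracket_pos (s : ℝ) (n : ℤ) : 0 < bracket s n :=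
  Real.rpow_pos_of_pos (by positivity) s

theorem bracket_neg (s : ℝ) (n : ℤ) : bracket s (-n) = bracket s n := by
  simp [bracket]

theorem one_le_bracket {s : ℝ} (hs : 0 ≤ s) (n : ℤ) : 1 ≤ bracket s n :=
  Real.one_le_rpow (by linarith [abs_nonneg (n : ℝ)]) hs

/-- The triangle inequality gives ⟨n⟩ ≤ ⟨j⟩⟨n-j⟩, and s ≥ 0 preserves it. This reduces product
estimates in H^s to the case s = 0. -/
theorem bracket_div_le {s : ℝ} (hs : 0 ≤ s) (n j : ℤ) :
    bracket s n / (bracket s j * bracket s (n - j)) ≤ 1 := by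
  rw [div_le_one (mul_pos (bracket_pos _ _) (bracket_pos _ _)), bracket, bracket, bracket,
    ← Real.mul_rpow (by positivity) (by positivity)]
  refine Real.rpow_le_rpow (by positivity) ?_ hs
  have : |(n : ℝ)| ≤ |(j : ℝ)| + |((n - j : ℤ) : ℝ)| := by
    have := abs_add_le (j : ℝ) ((n - j : ℤ) : ℝ)
    push_cast at this ⊢
    simpa using this
  nlinarith [abs_nonneg (j : ℝ), abs_nonneg ((n - j : ℤ) : ℝ)]

/-! ### Products in the interaction picture -/

section Bilinear

variable (s θ : ℝ) (ε : ℤ)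

/-- The summand of the `n`-th Fourier coefficient of a product in the interaction picture of the
Schrödinger group (`ε = 1` for `f g`, `ε = -1` for `f` times a conjugate). -/
def bilTerm (n : ℤ) (t : ℝ) (a b : ℤ → ℂ) (j : ℤ) : ℂ :=
  (bracket s n / (bracket s j * bracket s (n - j)) : ℝ) *
    Complex.exp (I * ((t * (θ * ((n ^ 2 - j ^ 2 - ε * (n - j) ^ 2 : ℤ) : ℝ)) : ℝ) : ℂ)) *
    (a j * b (n - j))

/-- The `n`-th Fourier coefficient of a product in the interaction picture, with the weights of
`H^s` removed. -/
def bil (n : ℤ) (t : ℝ) (a b : ℤ → ℂ) : ℂ := ∑' j, bilTerm s θ ε n t a b j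

/-- The square of the `ℓ²` norm of `n ↦ bil n t a b`. -/
def bilSq (t : ℝ) (a b : ℤ → ℂ) : ℝ≥0∞ := ∑' n, ‖bil s θ ε n t a b‖ₑ ^ 2

variable {s θ ε}

theorem norm_bilTerm (n : ℤ) (t : ℝ) (a b : ℤ → ℂ) (j : ℤ) : ‖bilTerm s θ ε n t a b j‖ =
    bracket s n / (bracket s j * bracket s (n - j)) * (‖a j‖ * ‖b (n - j)‖) := by
  have h : 0 < bracket s n / (bracket s j * bracket s (n - j)) :=
    div_pos (bracket_pos _ _) (mul_pos (bracket_pos _ _) (bracket_pos _ _))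
  rw [bilTerm, norm_mul, norm_mul, norm_mul, mul_comm I, Complex.norm_exp_ofReal_mul_I,
    Complex.norm_real, Real.norm_of_nonneg h.le, mul_one]

theorem norm_bilTerm_le (hs : 0 ≤ s) (n : ℤ) (t : ℝ) (a b : ℤ → ℂ) (j : ℤ) :
    ‖bilTerm s θ ε n t a b j‖ ≤ ‖a j‖ * ‖b (n - j)‖ := by
  rw [norm_bilTerm]
  exact mul_le_of_le_one_left (by positivity) (bracket_div_le hs n j)

theorem summable_bilTerm (hs : 0 ≤ s) (n : ℤ) (t : ℝ) (a b : SeqL2) :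
    Summable (bilTerm s θ ε n t a b) :=
  Summable.of_norm_bounded (SeqL2.summable_mul_sub a b n) (norm_bilTerm_le hs n t a b)

theorem norm_bil_le (hs : 0 ≤ s) (n : ℤ) (t : ℝ) (a b : SeqL2) :
    ‖bil s θ ε n t a b‖ ≤ ‖a‖ * ‖b‖ :=
  (tsum_of_norm_bounded (SeqL2.summable_mul_sub a b n).hasSum
    (norm_bilTerm_le hs n t a b)).trans (SeqL2.tsum_mul_sub_le a b n)

/-- `bil` as a continuous bilinear map. -/
def bilCLM (hs : 0 ≤ s) (θ : ℝ) (ε : ℤ) (n : ℤ) (t : ℝ) : SeqL2 →L[ℝ] SeqL2 →L[ℝ] ℂ :=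
  LinearMap.mkContinuous₂
    (LinearMap.mk₂ ℝ (fun a b : SeqL2 => bil s θ ε n t a b)
      (fun a a' b => by
        rw [bil, bil, bil, ← (summable_bilTerm hs n t a b).tsum_add (summable_bilTerm hs n t a' b)]
        congr 1; funext j
        simp only [bilTerm, lp.coeFn_add, Pi.add_apply]; ring)
      (fun c a b => by
        rw [bil, bil, ← (summable_bilTerm hs n t a b).tsum_const_smul]
        congr 1; funext j
        simp only [bilTerm, lp.coeFn_smul, Pi.smul_apply, real_smul]; ring)
      (fun a b b' => by
        rw [bil, bil, bil, ← (summable_bilTerm hs n t a b).tsum_add (summable_bilTerm hs n t a b')]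
        congr 1; funext j
        simp only [bilTerm, lp.coeFn_add, Pi.add_apply]; ring)
      (fun c a b => by
        rw [bil, bil, ← (summable_bilTerm hs n t a b).tsum_const_smul]
        congr 1; funext j
        simp only [bilTerm, lp.coeFn_smul, Pi.smul_apply, real_smul]; ring)) 1
    fun a b => by
      rw [one_mul]
      exact norm_bil_le hs n t a b

theorem bilCLM_apply (hs : 0 ≤ s) (n : ℤ) (t : ℝ) (a b : SeqL2) :
    bilCLM hs θ ε n t a b = bil s θ ε n t a b := rfl

theorem continuous_bil_time (hs : 0 ≤ s) (n : ℤ) (a b : SeqL2) :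
    Continuous fun t => bil s θ ε n t a b := by
  refine continuous_tsum (fun j => ?_) (SeqL2.summable_mul_sub a b n)
    fun j t => norm_bilTerm_le hs n t a b j
  unfold bilTerm
  fun_prop

/-- Continuity in time for fixed sequences is combined with the bilinear bound, which is uniform in
time. Joint continuity supplies the measurability needed to exchange integrals later. -/
theorem continuous_bil (hs : 0 ≤ s) (n : ℤ) :
    Continuous fun x : ℝ × SeqL2 × SeqL2 => bil s θ ε n x.1 x.2.1 x.2.2 := by
  rw [continuous_iff_continuousAt]
  rintro ⟨t₀, a₀, b₀⟩
  have h1 : Tendsto (fun x : ℝ × SeqL2 × SeqL2 => ‖x.2.1 - a₀‖ * ‖x.2.2‖ + ‖a₀‖ * ‖x.2.2 - b₀‖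
      + ‖bil s θ ε n x.1 a₀ b₀ - bil s θ ε n t₀ a₀ b₀‖) (𝓝 (t₀, a₀, b₀)) (𝓝 0) := by
    have : Continuous (fun x : ℝ × SeqL2 × SeqL2 => ‖x.2.1 - a₀‖ * ‖x.2.2‖ + ‖a₀‖ * ‖x.2.2 - b₀‖
      + ‖bil s θ ε n x.1 a₀ b₀ - bil s θ ε n t₀ a₀ b₀‖) := by
      have := (continuous_bil_time (θ := θ) (ε := ε) hs n a₀ b₀).comp
        (continuous_fst (X := ℝ) (Y := SeqL2 × SeqL2))
      simp only [Function.comp_def] at this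
      fun_prop
    convert this.tendsto (t₀, a₀, b₀) using 2
    simp
  rw [ContinuousAt, tendsto_iff_norm_sub_tendsto_zero]
  refine squeeze_zero (fun _ => norm_nonneg _) (fun x => ?_) h1
  have e : bil s θ ε n x.1 x.2.1 x.2.2 - bil s θ ε n t₀ a₀ b₀
      = bil s θ ε n x.1 (x.2.1 - a₀ : SeqL2) x.2.2 + bil s θ ε n x.1 a₀ (x.2.2 - b₀ : SeqL2)
      + (bil s θ ε n x.1 a₀ b₀ - bil s θ ε n t₀ a₀ b₀) := by
    simp only [← bilCLM_apply hs, map_sub, sub_apply]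
    ring
  rw [e]
  refine (norm_add_le _ _).trans (add_le_add_left ((norm_add_le _ _).trans ?_) _)
  exact add_le_add (norm_bil_le hs _ _ _ _) (norm_bil_le hs _ _ _ _)

theorem measurable_bilSq {Ω : Type*} [MeasurableSpace Ω] (hs : 0 ≤ s) {τ : Ω → ℝ}
    {a b : Ω → SeqL2} (hτ : Measurable τ) (ha : StronglyMeasurable a) (hb : StronglyMeasurable b) :
    Measurable fun x => bilSq s θ ε (τ x) (a x) (b x) := by
  refine Measurable.tsum fun n => Measurable.pow_const ?_ _
  exact ((continuous_bil hs n).comp_stronglyMeasurable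
    (hτ.stronglyMeasurable.prodMk (ha.prodMk hb))).measurable.enorm

end Bilinear

theorem ENNReal.add_sq_le (x y : ℝ≥0∞) : (x + y) ^ 2 ≤ 2 * x ^ 2 + 2 * y ^ 2 := by
  have := ENNReal.rpow_add_le_mul_rpow_add_rpow x y (p := 2) (by norm_num)
  norm_num at this
  rwa [mul_add] at this

/-! ### Bessel's inequality in time -/

section Orthogonality

variable {θ P : ℝ}

theorem integral_exp_int_eq_zero (hθP : θ * P = 2 * Real.pi) {m : ℤ} (hm : m ≠ 0) :
    ∫ t in (0 : ℝ)..P, Complex.exp (I * ((t * (θ * (m : ℝ)) : ℝ) : ℂ)) = 0 := by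
  have hθ : θ ≠ 0 := by
    rintro rfl
    have := Real.pi_pos
    linarith
  have hc : (I * (θ * m) : ℂ) ≠ 0 := by
    have : (θ : ℂ) ≠ 0 := by exact_mod_cast hθ
    have : (m : ℂ) ≠ 0 := by exact_mod_cast hm
    simp_all
  have h := integral_exp_mul_complex (a := 0) (b := P) hc
  have e : ∀ t : ℝ, Complex.exp (I * ((t * (θ * (m : ℝ)) : ℝ) : ℂ))
      = Complex.exp (I * (θ * m) * t) := fun t => by
    congr 1; push_cast; ring
  simp_rw [e]
  rw [h]
  have : (I * (θ * m) * P : ℂ) = m * (2 * Real.pi * I) := by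
    have : (θ * P : ℂ) = 2 * Real.pi := by exact_mod_cast hθP
    linear_combination (I * m) * this
  rw [this, Complex.exp_int_mul_two_pi_mul_I]
  simp

/-- Bessel's inequality for a Fourier series with distinct integer frequencies `φ j`. -/
theorem lintegral_sq_tsum_exp_le (hP : 0 ≤ P) (hθP : θ * P = 2 * Real.pi) {c : ℤ → ℂ}
    (hc : Summable fun j => ‖c j‖) {φ : ℤ → ℤ} (hφ : InjOn φ (Function.support c)) :
    ∫⁻ t in Ioc 0 P, ‖∑' j, c j * Complex.exp (I * ((t * (θ * (φ j : ℝ)) : ℝ) : ℂ))‖ₑ ^ 2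
      ≤ ENNReal.ofReal P * ∑' j, ‖c j‖ₑ ^ 2 := by
  set e : ℤ → ℝ → ℂ := fun j t => Complex.exp (I * ((t * (θ * (φ j : ℝ)) : ℝ) : ℂ)) with he
  have hen : ∀ j t, ‖e j t‖ = 1 := fun j t => by
    rw [he]; simp only; rw [mul_comm I, Complex.norm_exp_ofReal_mul_I]
  have hec : ∀ j, Continuous (e j) := fun j => by simp only [he]; fun_prop
  set h : ℝ → ℂ := fun t => ∑' j, c j * e j t with hh
  have hb : ∀ j t, ‖c j * e j t‖ ≤ ‖c j‖ := fun j t => by rw [norm_mul, hen, mul_one]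
  have hcont : Continuous h :=
    continuous_tsum (fun j => continuous_const.mul (hec j)) hc fun j t => hb j t
  have hs : ∀ t, Summable fun j => c j * e j t := fun t => Summable.of_norm_bounded hc (hb · t)
  -- The series may be integrated term by term against any bounded continuous function. It is tested
  -- first against a single exponential, then against its own conjugate.
  have key : ∀ g : ℝ → ℂ, Continuous g → ∀ M : ℝ, (∀ t, ‖g t‖ ≤ M) →
      HasSum (fun j => c j * ∫ t in (0 : ℝ)..P, e j t * g t) (∫ t in (0 : ℝ)..P, h t * g t) := by
    intro g hg M hM
    have := intervalIntegral.hasSum_integral_of_dominated_convergence (μ := volume) (a := 0) (b := P)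
      (F := fun j t => c j * (e j t * g t)) (f := fun t => h t * g t) (fun j _ => ‖c j‖ * M)
      (fun j => (continuous_const.mul ((hec j).mul hg)).aestronglyMeasurable)
      (fun j => Eventually.of_forall fun t _ => by
        rw [norm_mul, norm_mul, hen, one_mul]; gcongr; exact hM t)
      (Eventually.of_forall fun t _ => hc.mul_right M)
      (by simp)
      (Eventually.of_forall fun t _ => by
        have := (hs t).hasSum.mul_right (g t)
        simpa [mul_assoc] using this)
    simpa [intervalIntegral.integral_const_mul] using this
  have hconj : ∀ i j t, e j t * (starRingEnd ℂ) (e i t)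
      = Complex.exp (I * ((t * (θ * ((φ j - φ i : ℤ) : ℝ)) : ℝ) : ℂ)) := fun i j t => by
    simp only [he]
    rw [← Complex.exp_conj, ← Complex.exp_add]
    congr 1
    simp
    ring
  -- Orthogonality is claimed only where `c i ≠ 0`: off the support of `c` the frequencies may
  -- coincide.
  have hort : ∀ i, c i ≠ 0 → ∫ t in (0 : ℝ)..P, h t * (starRingEnd ℂ) (e i t) = P * c i := by
    intro i hi
    have h1 := key (fun t => (starRingEnd ℂ) (e i t)) (Complex.continuous_conj.comp (hec i)) 1
      fun t => by simp [hen]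
    refine h1.unique ?_
    have : ∀ j, (c j * ∫ t in (0 : ℝ)..P, e j t * (starRingEnd ℂ) (e i t))
        = if j = i then (P * c i : ℂ) else 0 := by
      intro j
      by_cases hji : j = i
      · subst hji
        simp_rw [hconj]
        simp [mul_comm]
      · rw [if_neg hji]
        by_cases hj : c j = 0
        · simp [hj]
        · simp_rw [hconj]
          rw [integral_exp_int_eq_zero hθP, mul_zero]
          intro h0
          exact hji (hφ hj hi (by linarith))
    simp_rw [this]
    exact hasSum_ite_eq i _
  obtain ⟨M, hM⟩ : ∃ M, ∀ t, ‖h t‖ ≤ M :=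
    ⟨_, fun t => tsum_of_norm_bounded hc.hasSum (hb · t)⟩
  -- Testing against the conjugate of the sum itself turns the orthogonality relations into
  -- Parseval's identity.
  have h2 := key (fun t => (starRingEnd ℂ) (h t)) (Complex.continuous_conj.comp hcont) M
    fun t => by simpa using hM t
  have h3 : HasSum (fun j => ((P * ‖c j‖ ^ 2 : ℝ) : ℂ))
      ((∫ t in (0 : ℝ)..P, ‖h t‖ ^ 2 : ℝ) : ℂ) := by
    rw [← intervalIntegral.integral_ofReal]
    convert h2 using 1
    · funext j
      by_cases hj : c j = 0
      · simp [hj]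
      · have := congrArg (starRingEnd ℂ) (hort j hj)
        rw [← intervalIntegral.intervalIntegral_conj] at this
        simp only [map_mul, Complex.conj_conj, conj_ofReal] at this
        simp_rw [mul_comm (e j _), this]
        push_cast
        rw [← Complex.mul_conj']
        ring
    · congr 1
      funext t
      rw [Complex.mul_conj']
      push_cast
      rfl
  have h4 : HasSum (fun j => P * ‖c j‖ ^ 2) (∫ t in (0 : ℝ)..P, ‖h t‖ ^ 2) := by
    exact_mod_cast h3
  have h5 : ∫⁻ t in Ioc 0 P, ‖h t‖ₑ ^ 2 = ENNReal.ofReal (∫ t in (0 : ℝ)..P, ‖h t‖ ^ 2) := by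
    rw [intervalIntegral.integral_of_le hP, ofReal_integral_eq_lintegral_ofReal]
    · congr 1; funext t
      rw [← ofReal_norm, ENNReal.ofReal_pow (norm_nonneg _)]
    · exact (hcont.norm.pow 2).integrableOn_Ioc
    · exact Eventually.of_forall fun t => by positivity
  rw [h5, ← h4.tsum_eq, ENNReal.ofReal_tsum_of_nonneg (fun j => by positivity) h4.summable,
    ← ENNReal.tsum_mul_left]
  refine (tsum_congr fun j => ?_).le
  rw [ENNReal.ofReal_mul hP, ENNReal.ofReal_pow (norm_nonneg _), ofReal_norm]

end Orthogonality

/-! ### The bilinear estimate for free solutions -/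

section FreeEstimate

variable {s θ P : ℝ}

/-- The bound of one Fourier coefficient for a phase that is injective on the support. -/
theorem lintegral_bilTerm_le_of_injOn (hs : 0 ≤ s) (hP : 0 ≤ P) (hθP : θ * P = 2 * Real.pi)
    (ε n : ℤ) (a b : SeqL2) (S : Set ℤ)
    (hS : InjOn (fun j : ℤ => n ^ 2 - j ^ 2 - ε * (n - j) ^ 2) S) :
    ∫⁻ t in Ioc 0 P, ‖∑' j, S.indicator (bilTerm s θ ε n t a b) j‖ₑ ^ 2
      ≤ ENNReal.ofReal P * ∑' j, S.indicator (fun j => ‖a j‖ₑ ^ 2 * ‖b (n - j)‖ₑ ^ 2) j := by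
  set c : ℤ → ℂ := S.indicator fun j =>
    (bracket s n / (bracket s j * bracket s (n - j)) : ℝ) * (a j * b (n - j)) with hc
  have hcle : ∀ j, ‖c j‖ ≤ S.indicator (fun j => ‖a j‖ * ‖b (n - j)‖) j := fun j => by
    rw [hc, norm_indicator_eq_indicator_norm]
    refine indicator_le_indicator ?_
    have := norm_bilTerm_le (θ := 0) (ε := 0) hs n 0 a b j
    rw [bilTerm] at this
    simpa using this
  have hsum : Summable fun j => ‖c j‖ :=
    Summable.of_nonneg_of_le (fun _ => norm_nonneg _) hcle
      ((SeqL2.summable_mul_sub a b n).indicator S)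
  have h1 := lintegral_sq_tsum_exp_le hP hθP hsum
    (φ := fun j : ℤ => n ^ 2 - j ^ 2 - ε * (n - j) ^ 2)
    (hS.mono (by rw [hc]; exact support_indicator_subset))
  refine (le_of_eq ?_).trans (h1.trans ?_)
  · congr 1; funext t; congr 3; funext j
    by_cases hj : j ∈ S
    · simp only [hc, indicator_of_mem hj, bilTerm]; ring
    · simp only [hc, indicator_of_notMem hj, zero_mul]
  · gcongr with j
    have := hcle j
    by_cases hj : j ∈ S
    · rw [indicator_of_mem hj] at this ⊢
      rw [← mul_pow]
      gcongr
      rw [← enorm_mul, enorm_le_iff_norm_le, norm_mul]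
      exact this
    · simp [hc, indicator_of_notMem hj]

theorem tsum_indicator_add_compl {f : ℤ → ℂ} (hf : Summable f) (S : Set ℤ) :
    ∑' j, f j = ∑' j, S.indicator f j + ∑' j, Sᶜ.indicator f j := by
  rw [← (hf.indicator S).tsum_add (hf.indicator Sᶜ)]
  congr 1
  funext j
  rw [← Pi.add_apply, indicator_self_add_compl]

/-- The phase n² - j² - (n-j)² = 2j(n-j) is symmetric about j = n/2 and injective on either side.
Splitting there and using (x+y)² ≤ 2x² + 2y² costs the factor 2. -/
theorem lintegral_bil_pos_le (hs : 0 ≤ s) (hP : 0 ≤ P) (hθP : θ * P = 2 * Real.pi)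
    (n : ℤ) (a b : SeqL2) :
    ∫⁻ t in Ioc 0 P, ‖bil s θ 1 n t a b‖ₑ ^ 2
      ≤ 2 * ENNReal.ofReal P * ∑' j, ‖a j‖ₑ ^ 2 * ‖b (n - j)‖ₑ ^ 2 := by
  set S : Set ℤ := {j | 2 * j ≤ n} with hS
  have inj1 : InjOn (fun j : ℤ => n ^ 2 - j ^ 2 - 1 * (n - j) ^ 2) S := by
    intro j hj l hl h
    simp only [hS, mem_ofPred_eq] at hj hl
    have h' : (n - 2 * j) ^ 2 = (n - 2 * l) ^ 2 := by simp only at h; linarith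
    have := (pow_left_inj₀ (by omega) (by omega) (by norm_num)).1 h'
    omega
  have inj2 : InjOn (fun j : ℤ => n ^ 2 - j ^ 2 - 1 * (n - j) ^ 2) Sᶜ := by
    intro j hj l hl h
    simp only [hS, mem_compl_iff, mem_ofPred_eq, not_le] at hj hl
    have h' : (2 * j - n) ^ 2 = (2 * l - n) ^ 2 := by simp only at h; linarith
    have := (pow_left_inj₀ (by omega) (by omega) (by norm_num)).1 h'
    omega
  have h1 := lintegral_bilTerm_le_of_injOn hs hP hθP 1 n a b S inj1
  have h2 := lintegral_bilTerm_le_of_injOn hs hP hθP 1 n a b Sᶜ inj2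
  have hm : ∀ S : Set ℤ, Measurable fun t : ℝ =>
      2 * ‖∑' j, S.indicator (bilTerm s θ 1 n t a b) j‖ₑ ^ 2 := fun S => by
    refine ((Continuous.measurable ?_).enorm.pow_const 2).const_mul 2
    refine continuous_tsum (u := fun j => ‖a j‖ * ‖b (n - j)‖) (fun j => ?_)
      (SeqL2.summable_mul_sub a b n) fun j t => ?_
    · by_cases hj : j ∈ S
      · simp only [indicator_of_mem hj]; unfold bilTerm; fun_prop
      · simp only [indicator_of_notMem hj]; fun_prop
    · rw [norm_indicator_eq_indicator_norm]
      exact (indicator_le_self' (fun _ _ => norm_nonneg _) j).trans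
        (norm_bilTerm_le hs n t a b j)
  calc ∫⁻ t in Ioc 0 P, ‖bil s θ 1 n t a b‖ₑ ^ 2
      ≤ ∫⁻ t in Ioc 0 P, (2 * ‖∑' j, S.indicator (bilTerm s θ 1 n t a b) j‖ₑ ^ 2
          + 2 * ‖∑' j, Sᶜ.indicator (bilTerm s θ 1 n t a b) j‖ₑ ^ 2) := by
        refine lintegral_mono fun t => ?_
        rw [bil, tsum_indicator_add_compl (summable_bilTerm hs n t a b) S]
        exact (pow_le_pow_left' (enorm_add_le _ _) 2).trans (ENNReal.add_sq_le _ _)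
    _ ≤ 2 * (ENNReal.ofReal P * ∑' j, S.indicator (fun j => ‖a j‖ₑ ^ 2 * ‖b (n - j)‖ₑ ^ 2) j)
        + 2 * (ENNReal.ofReal P *
          ∑' j, Sᶜ.indicator (fun j => ‖a j‖ₑ ^ 2 * ‖b (n - j)‖ₑ ^ 2) j) := by
        rw [lintegral_add_left (hm S), lintegral_const_mul' _ _ (by norm_num),
          lintegral_const_mul' _ _ (by norm_num)]
        gcongr
    _ = _ := by
        rw [← mul_assoc, ← mul_assoc, ← mul_add, ← ENNReal.tsum_add]
        congr 2
        funext j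
        rw [← Pi.add_apply, indicator_self_add_compl]

/-- The phase n² - j² + (n-j)² = 2n(n-j) is injective in j as soon as n ≠ 0, so no splitting is
needed. -/
theorem lintegral_bil_neg_le (hs : 0 ≤ s) (hP : 0 ≤ P) (hθP : θ * P = 2 * Real.pi)
    {n : ℤ} (hn : n ≠ 0) (a b : SeqL2) :
    ∫⁻ t in Ioc 0 P, ‖bil s θ (-1) n t a b‖ₑ ^ 2
      ≤ ENNReal.ofReal P * ∑' j, ‖a j‖ₑ ^ 2 * ‖b (n - j)‖ₑ ^ 2 := by
  have := lintegral_bilTerm_le_of_injOn hs hP hθP (-1) n a b univ (by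
    intro j _ l _ h
    have h' : n * (j - l) = 0 := by simp only at h; linarith
    rcases mul_eq_zero.1 h' with h0 | h0
    · exact absurd h0 hn
    · omega)
  simpa only [indicator_univ, bil] using this

theorem SeqL2.tsum_tsum_mul_sub (a b : SeqL2) :
    ∑' n : ℤ, ∑' j, ‖a j‖ₑ ^ 2 * ‖b (n - j)‖ₑ ^ 2 = ‖a‖ₑ ^ 2 * ‖b‖ₑ ^ 2 := by
  rw [ENNReal.tsum_comm]
  simp_rw [ENNReal.tsum_mul_left]
  have : ∀ j : ℤ, ∑' n : ℤ, ‖b (n - j)‖ₑ ^ 2 = ‖b‖ₑ ^ 2 := fun j => by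
    rw [SeqL2.enorm_sq_eq b]
    exact (Equiv.subRight j).tsum_eq fun n => ‖b n‖ₑ ^ 2
  simp_rw [this]
  rw [ENNReal.tsum_mul_right, ← SeqL2.enorm_sq_eq]

/-- The bilinear `L²` space-time estimate for free solutions of the periodic Schrödinger equation
over one time period. -/
theorem lintegral_bilSq_le (hs : 0 ≤ s) (hP : 0 ≤ P) (hθP : θ * P = 2 * Real.pi)
    {ε : ℤ} (hε : ε = 1 ∨ ε = -1) (a b : SeqL2) :
    ∫⁻ t in Ioc 0 P, bilSq s θ ε t a b ≤ 2 * ENNReal.ofReal P * (‖a‖ₑ ^ 2 * ‖b‖ₑ ^ 2) := by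
  have hm : ∀ n, Measurable fun t => ‖bil s θ ε n t a b‖ₑ ^ 2 := fun n =>
    (continuous_bil_time hs n a b).measurable.enorm.pow_const 2
  unfold bilSq
  rw [lintegral_tsum fun n => (hm n).aemeasurable]
  rcases hε with rfl | rfl
  · rw [← SeqL2.tsum_tsum_mul_sub, ← ENNReal.tsum_mul_left]
    gcongr with n
    exact lintegral_bil_pos_le hs hP hθP n a b
  -- For n = 0 the phase vanishes identically and there is no oscillation. A single mode is bounded
  -- at every time by Cauchy–Schwarz, which accounts for the second unit of the constant 2.
  · have h0 : ∫⁻ t in Ioc 0 P, ‖bil s θ (-1) 0 t a b‖ₑ ^ 2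
        ≤ ENNReal.ofReal P * (‖a‖ₑ ^ 2 * ‖b‖ₑ ^ 2) := by
      calc _ ≤ ∫⁻ t in Ioc 0 P, (‖a‖ₑ ^ 2 * ‖b‖ₑ ^ 2) := by
            refine lintegral_mono fun t => ?_
            rw [← mul_pow]
            gcongr
            rw [← enorm_norm a, ← enorm_norm b, ← enorm_mul, enorm_le_iff_norm_le]
            simpa using norm_bil_le hs 0 t a b
        _ = _ := by simp [mul_comm]
    have : ∀ n : ℤ, ∫⁻ t in Ioc 0 P, ‖bil s θ (-1) n t a b‖ₑ ^ 2 ≤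
        ENNReal.ofReal P * ∑' j, ‖a j‖ₑ ^ 2 * ‖b (n - j)‖ₑ ^ 2
          + if n = 0 then ENNReal.ofReal P * (‖a‖ₑ ^ 2 * ‖b‖ₑ ^ 2) else 0 := fun n => by
      by_cases hn : n = 0
      · subst hn
        rw [if_pos rfl]
        exact h0.trans le_add_self
      · rw [if_neg hn, add_zero]
        exact lintegral_bil_neg_le hs hP hθP hn a b
    refine (ENNReal.tsum_le_tsum this).trans ?_
    rw [ENNReal.tsum_add, ENNReal.tsum_mul_left, SeqL2.tsum_tsum_mul_sub, tsum_ite_eq, mul_assoc,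
      two_mul]

end FreeEstimate

/-! ### Curves with square-integrable derivative -/

section Path

variable {X : Type*} [NormedAddCommGroup X] [NormedSpace ℝ X]

/-- The curve with initial value `a` and derivative `f`. -/
def pathOf (a : X) (f : ℝ → X) (t : ℝ) : X := a + ∫ σ in (0 : ℝ)..t, f σ

/-- The square of an exponentially weighted `L²` norm on `[0, T]`. -/
def expNormSq (l T : ℝ) (f : ℝ → X) : ℝ≥0∞ :=
  ∫⁻ σ in Ioc 0 T, ENNReal.ofReal (Real.exp (-l * σ)) * ‖f σ‖ₑ ^ 2

/-- `κ` bounds the integrals `∫₀ᵗ e^{-l (t - σ)} dσ` for `t ≤ T`. -/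
def ExpKernelBound (l T : ℝ) (κ : ℝ≥0∞) : Prop :=
  ∀ t ∈ Ioc 0 T, ∫⁻ σ in Ioc 0 t, ENNReal.ofReal (Real.exp (-l * (t - σ))) ≤ κ

/-- Without a weight the gain is the length of the interval; it serves for existence on short
intervals and for measuring the size of curves. -/
theorem expKernelBound_zero (T : ℝ) : ExpKernelBound 0 T (ENNReal.ofReal T) := by
  intro t ht
  simp only [neg_zero, zero_mul, Real.exp_zero, ENNReal.ofReal_one, lintegral_const, one_mul,
    Measure.restrict_apply, MeasurableSet.univ, univ_inter, Real.volume_Ioc, sub_zero]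
  exact ENNReal.ofReal_le_ofReal ht.2

/-- With a weight the gain 1/l does not depend on the interval, so an absorption argument works on
all of [0, T] at once. -/
theorem expKernelBound_inv {l : ℝ} (hl : 0 < l) (T : ℝ) :
    ExpKernelBound l T (ENNReal.ofReal (1 / l)) := by
  intro t ht
  have hc : Continuous fun σ : ℝ => Real.exp (-l * (t - σ)) := by fun_prop
  rw [← ofReal_integral_eq_lintegral_ofReal (hc.integrableOn_Ioc)
    (Eventually.of_forall fun σ => (Real.exp_pos _).le)]
  apply ENNReal.ofReal_le_ofReal
  rw [← intervalIntegral.integral_of_le ht.1.le]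
  have hd : ∀ x ∈ uIcc 0 t, HasDerivAt (fun σ : ℝ => (1 / l) * Real.exp (-l * (t - σ)))
      (Real.exp (-l * (t - x))) x := fun x _ => by
    have h1 : HasDerivAt (fun σ : ℝ => -l * (t - σ)) l x := by
      simpa using ((hasDerivAt_id x).const_sub t).const_mul (-l)
    have h2 := (h1.exp).const_mul (1 / l)
    rwa [mul_comm (Real.exp _), ← mul_assoc, one_div, inv_mul_cancel₀ hl.ne', one_mul,
      ← one_div] at h2
  rw [intervalIntegral.integral_eq_sub_of_hasDerivAt hd (hc.intervalIntegrable _ _)]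
  simp only [sub_self, mul_zero, Real.exp_zero, mul_one, sub_zero]
  have : 0 ≤ (1 / l) * Real.exp (-l * t) := by positivity
  linarith

/-- Factor e^{-lt/2} = e^{-l(t-σ)/2} e^{-lσ/2} and apply Cauchy–Schwarz: the first factor yields the
kernel integral, the second the weighted norm of `g`. -/
theorem exp_mul_sq_lintegral_le {l T : ℝ} {κ : ℝ≥0∞} (hκ : ExpKernelBound l T κ) {t : ℝ}
    (ht : t ∈ Ioc 0 T) {g : ℝ → ℝ≥0∞} (hg : Measurable g) :
    ENNReal.ofReal (Real.exp (-l * t)) * (∫⁻ σ in Ioc 0 t, g σ) ^ 2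
      ≤ κ * ∫⁻ σ in Ioc 0 T, ENNReal.ofReal (Real.exp (-l * σ)) * g σ ^ 2 := by
  set u : ℝ → ℝ≥0∞ := fun σ => ENNReal.ofReal (Real.exp (-l * (t - σ) / 2))
  set v : ℝ → ℝ≥0∞ := fun σ => ENNReal.ofReal (Real.exp (-l * σ / 2)) * g σ
  have hu : Measurable u := by fun_prop
  have hv : Measurable v := by fun_prop
  have hsq : ∀ x : ℝ, ENNReal.ofReal (Real.exp (x / 2)) ^ 2 = ENNReal.ofReal (Real.exp x) :=
    fun x => by
      rw [← ENNReal.ofReal_pow (Real.exp_pos _).le, ← Real.exp_nat_mul]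
      congr 2; push_cast; ring
  have h := ENNReal.lintegral_mul_le_Lp_mul_Lq (volume.restrict (Ioc 0 t))
    Real.HolderConjugate.two_two hu.aemeasurable hv.aemeasurable
  have h2 := pow_le_pow_left' h 2
  rw [mul_pow, ← ENNReal.rpow_natCast, ← ENNReal.rpow_natCast, ← ENNReal.rpow_natCast,
    ← ENNReal.rpow_mul, ← ENNReal.rpow_mul] at h2
  norm_num at h2
  have e1 : ∫⁻ σ in Ioc 0 t, u σ * v σ
      = ENNReal.ofReal (Real.exp (-l * t / 2)) * ∫⁻ σ in Ioc 0 t, g σ := by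
    rw [← lintegral_const_mul _ hg]
    congr 1; funext σ
    simp only [u, v]
    rw [← mul_assoc, ← ENNReal.ofReal_mul (Real.exp_pos _).le, ← Real.exp_add]
    congr 3; ring
  rw [e1, mul_pow, hsq] at h2
  refine h2.trans (mul_le_mul' ?_ ?_)
  · simp only [u, hsq]
    exact hκ t ht
  · simp only [v, mul_pow, hsq]
    exact lintegral_mono_set (Ioc_subset_Ioc_right ht.2)

/-- The right-hand side involves `Λ` only through its values at `a` and at the values of `f`, with
constants independent of `Λ`. Hence the bound can be summed over a family of functionals, such as
the coefficients of a bilinear map with one argument frozen. -/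
theorem enorm_pathOf_sq_le [CompleteSpace X] {Y : Type*} [NormedAddCommGroup Y]
    [NormedSpace ℝ Y] [CompleteSpace Y]
    {l T : ℝ} (hl : 0 ≤ l) {κ : ℝ≥0∞}
    (hκ : ExpKernelBound l T κ) {a : X} {f : ℝ → X} (hf : StronglyMeasurable f)
    (hfi : IntegrableOn f (Ioc 0 T)) (Λ : X →L[ℝ] Y) {t : ℝ} (ht : t ∈ Ioc 0 T) :
    ENNReal.ofReal (Real.exp (-l * t)) * ‖Λ (pathOf a f t)‖ₑ ^ 2
      ≤ 2 * (‖Λ a‖ₑ ^ 2 + κ * expNormSq l T fun σ => Λ (f σ)) := by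
  have hii : IntervalIntegrable f volume 0 t := by
    rw [intervalIntegrable_iff_integrableOn_Ioc_of_le ht.1.le]
    exact hfi.mono_set (Ioc_subset_Ioc_right ht.2)
  have h1 : ‖Λ (pathOf a f t)‖ₑ ≤ ‖Λ a‖ₑ + ∫⁻ σ in Ioc 0 t, ‖Λ (f σ)‖ₑ := by
    rw [pathOf, map_add, ← Λ.intervalIntegral_comp_comm hii,
      intervalIntegral.integral_of_le ht.1.le]
    exact (enorm_add_le _ _).trans (add_le_add_right (enorm_integral_le_lintegral_enorm _) _)
  have hm : Measurable fun σ => ‖Λ (f σ)‖ₑ :=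
    (Λ.continuous.comp_stronglyMeasurable hf).enorm
  have h2 := exp_mul_sq_lintegral_le hκ ht hm
  have he : ENNReal.ofReal (Real.exp (-l * t)) ≤ 1 := by
    rw [ENNReal.ofReal_le_one, Real.exp_le_one_iff]
    nlinarith [ht.1]
  calc _ ≤ ENNReal.ofReal (Real.exp (-l * t)) * (2 * ‖Λ a‖ₑ ^ 2
          + 2 * (∫⁻ σ in Ioc 0 t, ‖Λ (f σ)‖ₑ) ^ 2) := by
        gcongr
        exact (pow_le_pow_left' h1 2).trans (ENNReal.add_sq_le _ _)
    _ = 2 * (ENNReal.ofReal (Real.exp (-l * t)) * ‖Λ a‖ₑ ^ 2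
          + ENNReal.ofReal (Real.exp (-l * t)) * (∫⁻ σ in Ioc 0 t, ‖Λ (f σ)‖ₑ) ^ 2) := by ring
    _ ≤ _ := by
        exact mul_le_mul_right (add_le_add (mul_le_of_le_one_left' he) h2) _

theorem continuous_pathOf {a : X} {f : ℝ → X} (hf : ∀ x y, IntervalIntegrable f volume x y) :
    Continuous (pathOf a f) :=
  continuous_const.add (intervalIntegral.continuous_primitive hf 0)

end Path

/-! ### Transfer of the bilinear estimate to curves -/

section KeyEstimate

variable {s θ P : ℝ}

/-- `p` is dominated, after multiplication by the weight `e`, by an average of `φ` in every square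
sum of linear functionals. -/
def DominatedBy {Ω : Type*} [MeasurableSpace Ω] (T : ℝ) (e : ℝ → ℝ≥0∞) (p : ℝ → SeqL2)
    (ν : Measure Ω) (φ : Ω → SeqL2) : Prop :=
  ∀ t ∈ Ioc 0 T, ∀ Λ : ℤ → SeqL2 →L[ℝ] ℂ,
    e t * ∑' n, ‖Λ n (p t)‖ₑ ^ 2 ≤ 2 * ∫⁻ x, ∑' n, ‖Λ n (φ x)‖ₑ ^ 2 ∂ν

/-- At a fixed time each argument in turn is frozen and the other is replaced by its average. After
exchanging the integrals, the innermost time integral contains constant sequences only, that is free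
solutions, and `T ≤ P` brings it under the estimate over one period. The constant is 8 = 2 · 2 · 2.
-/
theorem lintegral_bilSq_le_of_dominatedBy {Ω₁ Ω₂ : Type*} [MeasurableSpace Ω₁]
    [MeasurableSpace Ω₂] (hs : 0 ≤ s) (hP : 0 ≤ P) (hθP : θ * P = 2 * Real.pi)
    {ε : ℤ} (hε : ε = 1 ∨ ε = -1) {T : ℝ} (hT : T ≤ P) {e₁ e₂ : ℝ → ℝ≥0∞} {p₁ p₂ : ℝ → SeqL2}
    {ν₁ : Measure Ω₁} {ν₂ : Measure Ω₂} [SFinite ν₁] [SFinite ν₂]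
    {φ₁ : Ω₁ → SeqL2} {φ₂ : Ω₂ → SeqL2}
    (hφ₁ : StronglyMeasurable φ₁) (hφ₂ : StronglyMeasurable φ₂) (he₂ : ∀ t, e₂ t ≠ ⊤)
    (h₁ : DominatedBy T e₁ p₁ ν₁ φ₁) (h₂ : DominatedBy T e₂ p₂ ν₂ φ₂) :
    ∫⁻ t in Ioc 0 T, e₁ t * e₂ t * bilSq s θ ε t (p₁ t) (p₂ t)
      ≤ 8 * ENNReal.ofReal P * ((∫⁻ x, ‖φ₁ x‖ₑ ^ 2 ∂ν₁) * ∫⁻ y, ‖φ₂ y‖ₑ ^ 2 ∂ν₂) := by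
  have hm3 : Measurable fun z : (ℝ × Ω₁) × Ω₂ => bilSq s θ ε z.1.1 (φ₁ z.1.2) (φ₂ z.2) :=
    measurable_bilSq hs (by fun_prop) (hφ₁.comp_measurable (by fun_prop))
      (hφ₂.comp_measurable (by fun_prop))
  have hm2 : Measurable fun z : ℝ × Ω₁ => ∫⁻ y, bilSq s θ ε z.1 (φ₁ z.2) (φ₂ y) ∂ν₂ :=
    hm3.lintegral_prod_right'
  have hpt : ∀ t ∈ Ioc 0 T, e₁ t * e₂ t * bilSq s θ ε t (p₁ t) (p₂ t)
      ≤ 4 * ∫⁻ x, ∫⁻ y, bilSq s θ ε t (φ₁ x) (φ₂ y) ∂ν₂ ∂ν₁ := by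
    intro t ht
    have a1 := h₁ t ht fun n => (bilCLM hs θ ε n t).flip (p₂ t)
    simp only [ContinuousLinearMap.flip_apply, bilCLM_apply] at a1
    have a2 : ∀ x, e₂ t * bilSq s θ ε t (φ₁ x) (p₂ t)
        ≤ 2 * ∫⁻ y, bilSq s θ ε t (φ₁ x) (φ₂ y) ∂ν₂ := fun x => by
      have := h₂ t ht fun n => bilCLM hs θ ε n t (φ₁ x)
      simp only [bilCLM_apply] at this
      exact this
    calc e₁ t * e₂ t * bilSq s θ ε t (p₁ t) (p₂ t)
        = e₂ t * (e₁ t * bilSq s θ ε t (p₁ t) (p₂ t)) := by ring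
      _ ≤ e₂ t * (2 * ∫⁻ x, bilSq s θ ε t (φ₁ x) (p₂ t) ∂ν₁) := mul_le_mul_right a1 _
      _ = 2 * ∫⁻ x, e₂ t * bilSq s θ ε t (φ₁ x) (p₂ t) ∂ν₁ := by
          rw [lintegral_const_mul' _ _ (he₂ t)]; ring
      _ ≤ 2 * ∫⁻ x, 2 * ∫⁻ y, bilSq s θ ε t (φ₁ x) (φ₂ y) ∂ν₂ ∂ν₁ := by
          exact mul_le_mul_right (lintegral_mono a2) _
      _ = _ := by
          rw [lintegral_const_mul' _ _ (by norm_num), ← mul_assoc]; norm_num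
  calc _ ≤ ∫⁻ t in Ioc 0 T, 4 * ∫⁻ x, ∫⁻ y, bilSq s θ ε t (φ₁ x) (φ₂ y) ∂ν₂ ∂ν₁ :=
        setLIntegral_mono' measurableSet_Ioc hpt
    _ = 4 * ∫⁻ x, ∫⁻ y, (∫⁻ t in Ioc 0 T, bilSq s θ ε t (φ₁ x) (φ₂ y)) ∂ν₂ ∂ν₁ := by
        rw [lintegral_const_mul' _ _ (by norm_num), lintegral_lintegral_swap hm2.aemeasurable]
        congr 2; funext x
        rw [lintegral_lintegral_swap]
        refine (measurable_bilSq hs (by fun_prop) stronglyMeasurable_const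
          (hφ₂.comp_measurable (by fun_prop))).aemeasurable
    _ ≤ 4 * ∫⁻ x, ∫⁻ y, 2 * ENNReal.ofReal P * (‖φ₁ x‖ₑ ^ 2 * ‖φ₂ y‖ₑ ^ 2) ∂ν₂ ∂ν₁ := by
        gcongr with x y
        exact (lintegral_mono_set (Ioc_subset_Ioc_right hT)).trans
          (lintegral_bilSq_le hs hP hθP hε _ _)
    _ = _ := by
        have m2 : Measurable fun y => ‖φ₂ y‖ₑ ^ 2 := hφ₂.enorm.pow_const 2
        have m1 : Measurable fun y => ‖φ₁ y‖ₑ ^ 2 := hφ₁.enorm.pow_const 2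
        have hc : (2 * ENNReal.ofReal P) ≠ ⊤ := ENNReal.mul_ne_top (by norm_num) (by simp)
        simp_rw [lintegral_const_mul' _ _ hc]
        simp_rw [lintegral_const_mul _ m2]
        rw [lintegral_mul_const _ m1]
        ring

/-- The averaging measure has a Dirac mass carrying the initial value and a density on (0, T]
carrying the derivative. -/
theorem dominatedBy_pathOf {l T : ℝ} (hl : 0 ≤ l) {κ : ℝ≥0∞} (hκ : ExpKernelBound l T κ)
    {a : SeqL2} {f : ℝ → SeqL2} (hf : StronglyMeasurable f) (hfi : IntegrableOn f (Ioc 0 T)) :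
    ∃ (ν : Measure ℝ) (φ : ℝ → SeqL2), SFinite ν ∧ StronglyMeasurable φ ∧
      DominatedBy T (fun t => ENNReal.ofReal (Real.exp (-l * t))) (pathOf a f) ν φ ∧
      ∫⁻ x, ‖φ x‖ₑ ^ 2 ∂ν = ‖a‖ₑ ^ 2 + κ * expNormSq l T f := by
  set d : ℝ → ℝ≥0∞ := fun σ => κ * ENNReal.ofReal (Real.exp (-l * σ)) with hd
  have hdm : Measurable d := by fun_prop
  -- The Dirac mass sits at the artificial parameter -1, outside (0, T], so that one function of a
  -- real variable encodes both `a` and `f`.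
  set φ : ℝ → SeqL2 := fun σ => if σ ∈ Iio (0 : ℝ) then a else f σ with hφ
  have hφm : StronglyMeasurable φ :=
    StronglyMeasurable.ite measurableSet_Iio stronglyMeasurable_const hf
  have hint : ∀ g : SeqL2 → ℝ≥0∞, Measurable (fun σ => g (φ σ)) →
      ∫⁻ x, g (φ x) ∂(Measure.dirac (-1) + (volume.restrict (Ioc 0 T)).withDensity d)
        = g a + κ * ∫⁻ σ in Ioc 0 T, ENNReal.ofReal (Real.exp (-l * σ)) * g (f σ) := by
    intro g hg
    rw [lintegral_add_measure, lintegral_dirac' _ hg,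
      lintegral_withDensity_eq_lintegral_mul _ hdm hg]
    congr 1
    · simp [hφ]
    · have hgf : EqOn (fun σ => (d * fun x => g (φ x)) σ)
          (fun σ => κ * (ENNReal.ofReal (Real.exp (-l * σ)) * g (φ σ))) (Ioc 0 T) := fun σ _ => by
        simp [hd, mul_assoc]
      rw [setLIntegral_congr_fun measurableSet_Ioc hgf, lintegral_const_mul]
      swap
      · exact (by fun_prop : Measurable fun σ : ℝ => ENNReal.ofReal (Real.exp (-l * σ))).mul hg
      congr 1
      refine setLIntegral_congr_fun measurableSet_Ioc fun σ hσ => ?_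
      simp [hφ, not_lt.2 hσ.1.le]
  refine ⟨_, φ, inferInstance, hφm, ?_, hint (fun x => ‖x‖ₑ ^ 2) (hφm.enorm.pow_const 2)⟩
  intro t ht Λ
  rw [hint (fun x => ∑' n, ‖Λ n x‖ₑ ^ 2) (Measurable.tsum fun n =>
    ((Λ n).continuous.comp_stronglyMeasurable hφm).enorm.pow_const 2), ← ENNReal.tsum_mul_left]
  refine (ENNReal.tsum_le_tsum fun n => enorm_pathOf_sq_le hl hκ hf hfi (Λ n) ht).trans_eq ?_
  rw [ENNReal.tsum_mul_left, ENNReal.tsum_add, ENNReal.tsum_mul_left]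
  congr 3
  simp_rw [expNormSq, ← ENNReal.tsum_mul_left]
  rw [lintegral_tsum]
  intro n
  have : Measurable fun σ => ‖Λ n (f σ)‖ₑ ^ 2 :=
    ((Λ n).continuous.comp_stronglyMeasurable hf).enorm.pow_const 2
  exact ((by fun_prop : Measurable fun σ : ℝ => ENNReal.ofReal (Real.exp (-l * σ))).mul
    this).aemeasurable

/-- The bilinear estimate for curves in the interaction picture. -/
theorem lintegral_bilSq_pathOf_le (hs : 0 ≤ s) (hP : 0 ≤ P) (hθP : θ * P = 2 * Real.pi)
    {ε : ℤ} (hε : ε = 1 ∨ ε = -1) {T : ℝ} (hT : T ≤ P) {l₁ l₂ : ℝ} (hl₁ : 0 ≤ l₁) (hl₂ : 0 ≤ l₂)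
    {κ₁ κ₂ : ℝ≥0∞} (hκ₁ : ExpKernelBound l₁ T κ₁) (hκ₂ : ExpKernelBound l₂ T κ₂)
    {a₁ a₂ : SeqL2} {f₁ f₂ : ℝ → SeqL2}
    (hf₁ : StronglyMeasurable f₁) (hfi₁ : IntegrableOn f₁ (Ioc 0 T))
    (hf₂ : StronglyMeasurable f₂) (hfi₂ : IntegrableOn f₂ (Ioc 0 T)) :
    ∫⁻ t in Ioc 0 T, ENNReal.ofReal (Real.exp (-(l₁ + l₂) * t)) *
        bilSq s θ ε t (pathOf a₁ f₁ t : SeqL2) (pathOf a₂ f₂ t : SeqL2)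
      ≤ 8 * ENNReal.ofReal P * ((‖a₁‖ₑ ^ 2 + κ₁ * expNormSq l₁ T f₁) *
          (‖a₂‖ₑ ^ 2 + κ₂ * expNormSq l₂ T f₂)) := by
  obtain ⟨ν₁, φ₁, _, hφ₁, hd₁, e₁⟩ := dominatedBy_pathOf hl₁ hκ₁ (a := a₁) hf₁ hfi₁
  obtain ⟨ν₂, φ₂, _, hφ₂, hd₂, e₂⟩ := dominatedBy_pathOf hl₂ hκ₂ (a := a₂) hf₂ hfi₂
  have := lintegral_bilSq_le_of_dominatedBy hs hP hθP hε hT hφ₁ hφ₂ (fun _ => by simp) hd₁ hd₂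
  rw [e₁, e₂] at this
  refine (le_of_eq ?_).trans this
  congr 1; funext t
  rw [← ENNReal.ofReal_mul (Real.exp_pos _).le, ← Real.exp_add]
  congr 3; ring

end KeyEstimate

/-! ### The vector field and its Lipschitz estimate -/

/-- The space of pairs of profiles. -/
abbrev Profile : Type := SeqL2 × SeqL2

section Field

variable (s θ α β : ℝ)

/-- The time derivative of the `n`-th Schrödinger profile coefficient. -/
def fieldU (n : ℤ) (t : ℝ) (x : Profile) : ℂ :=
  -(I * α) * (bil s θ 1 n t x.1 x.2 + bil s θ (-1) n t x.1 (SeqL2.conjL x.2))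

/-- The time derivative of the `n`-th coefficient of the profile of the half-wave `z`, where
`v = z + conj z`. -/
def fieldZ (n : ℤ) (t : ℝ) (x : Profile) : ℂ :=
  if n = 0 then 0 else -(I / 2) * (β * bil s θ (-1) n t x.1 (SeqL2.conjL x.1) + x.2 n
    + Complex.exp (I * ((2 * (t * (θ * (n : ℝ) ^ 2)) : ℝ) : ℂ)) * SeqL2.conjL x.2 n)

/-- The squared `ℓ²` distance of the vector field at two points. -/
def fieldDistSq (t : ℝ) (x y : Profile) : ℝ≥0∞ :=
  ∑' n, ‖fieldU s θ α n t x - fieldU s θ α n t y‖ₑ ^ 2 +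
    ∑' n, ‖fieldZ s θ β n t x - fieldZ s θ β n t y‖ₑ ^ 2

/-- The vector field of the system in the interaction picture. -/
def fieldVec (t : ℝ) (x : Profile) : Profile :=
  (SeqL2.ofFun fun n => fieldU s θ α n t x, SeqL2.ofFun fun n => fieldZ s θ β n t x)

/-- The constant of the Lipschitz estimate of the vector field. -/
def fieldConst (α β P : ℝ) : ℝ≥0∞ :=
  ENNReal.ofReal (4 * (α ^ 2 + β ^ 2 + 1)) * (48 * ENNReal.ofReal P)

variable {s θ α β}

theorem enorm_add4_sq_le (a b c d : ℂ) :
    ‖a + b + (c + d)‖ₑ ^ 2 ≤ 4 * (‖a‖ₑ ^ 2 + ‖b‖ₑ ^ 2 + (‖c‖ₑ ^ 2 + ‖d‖ₑ ^ 2)) := by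
  have h : ∀ x y : ℂ, ‖x + y‖ₑ ^ 2 ≤ 2 * ‖x‖ₑ ^ 2 + 2 * ‖y‖ₑ ^ 2 := fun x y =>
    (pow_le_pow_left' (enorm_add_le _ _) 2).trans (ENNReal.add_sq_le _ _)
  calc _ ≤ 2 * ‖a + b‖ₑ ^ 2 + 2 * ‖c + d‖ₑ ^ 2 := h _ _
    _ ≤ 2 * (2 * ‖a‖ₑ ^ 2 + 2 * ‖b‖ₑ ^ 2) + 2 * (2 * ‖c‖ₑ ^ 2 + 2 * ‖d‖ₑ ^ 2) := by
        gcongr <;> exact h _ _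
    _ = _ := by ring

theorem bil_sub_left (hs : 0 ≤ s) (ε n : ℤ) (t : ℝ) (a a' b : SeqL2) :
    bil s θ ε n t (a - a' : SeqL2) b = bil s θ ε n t a b - bil s θ ε n t a' b := by
  simp only [← bilCLM_apply hs, map_sub, sub_apply]

theorem bil_sub_right (hs : 0 ≤ s) (ε n : ℤ) (t : ℝ) (a b b' : SeqL2) :
    bil s θ ε n t a (b - b' : SeqL2) = bil s θ ε n t a b - bil s θ ε n t a b' := by
  simp only [← bilCLM_apply hs, map_sub]

/-- Each bilinear expression Q satisfies Q(x,x) - Q(y,y) = Q(x-y,x) + Q(y,x-y). The three products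
give six terms, and the linear part, z and its conjugate, gives 2‖x₂-y₂‖². -/
theorem fieldDistSq_le (hs : 0 ≤ s) (t : ℝ) (x y : Profile) :
    fieldDistSq s θ α β t x y ≤ ENNReal.ofReal (4 * (α ^ 2 + β ^ 2 + 1)) *
      (bilSq s θ 1 t (x.1 - y.1 : SeqL2) x.2 + bilSq s θ 1 t y.1 (x.2 - y.2 : SeqL2)
        + bilSq s θ (-1) t (x.1 - y.1 : SeqL2) (SeqL2.conjL x.2)
        + bilSq s θ (-1) t y.1 (SeqL2.conjL (x.2 - y.2))
        + bilSq s θ (-1) t (x.1 - y.1 : SeqL2) (SeqL2.conjL x.1)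
        + bilSq s θ (-1) t y.1 (SeqL2.conjL (x.1 - y.1))
        + 2 * ‖x.2 - y.2‖ₑ ^ 2) := by
  set c := ENNReal.ofReal (4 * (α ^ 2 + β ^ 2 + 1)) with hc
  have hc4 : c = 4 * ENNReal.ofReal (α ^ 2 + β ^ 2 + 1) := by
    rw [hc, ENNReal.ofReal_mul (by norm_num)]; norm_num
  have hsq : ∀ r : ℝ, r ^ 2 ≤ α ^ 2 + β ^ 2 + 1 → ∀ w : ℂ, ‖(r : ℂ) * w‖ₑ ^ 2
      ≤ ENNReal.ofReal (α ^ 2 + β ^ 2 + 1) * ‖w‖ₑ ^ 2 := fun r hr w => by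
    rw [enorm_mul, mul_pow]
    gcongr
    rw [← ofReal_norm, ← ENNReal.ofReal_pow (norm_nonneg _), Complex.norm_real,
      Real.norm_eq_abs, sq_abs]
    exact ENNReal.ofReal_le_ofReal hr
  have hI : ‖-I‖ₑ = 1 := by rw [← ofReal_norm]; simp
  have h2 : ‖-(I / 2)‖ₑ ^ 2 ≤ 1 := by
    rw [← ofReal_norm, ← ENNReal.ofReal_pow (norm_nonneg _), ENNReal.ofReal_le_one]
    simp; norm_num
  have hU : ∀ n, ‖fieldU s θ α n t x - fieldU s θ α n t y‖ₑ ^ 2 ≤ c *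
      (‖bil s θ 1 n t (x.1 - y.1 : SeqL2) x.2‖ₑ ^ 2
        + ‖bil s θ 1 n t y.1 (x.2 - y.2 : SeqL2)‖ₑ ^ 2
        + (‖bil s θ (-1) n t (x.1 - y.1 : SeqL2) (SeqL2.conjL x.2)‖ₑ ^ 2
        + ‖bil s θ (-1) n t y.1 (SeqL2.conjL (x.2 - y.2))‖ₑ ^ 2)) := fun n => by
    have e : fieldU s θ α n t x - fieldU s θ α n t y = -I * ((α : ℂ) *
        (bil s θ 1 n t (x.1 - y.1 : SeqL2) x.2 + bil s θ 1 n t y.1 (x.2 - y.2 : SeqL2)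
        + (bil s θ (-1) n t (x.1 - y.1 : SeqL2) (SeqL2.conjL x.2)
        + bil s θ (-1) n t y.1 (SeqL2.conjL (x.2 - y.2))))) := by
      rw [fieldU, fieldU, map_sub, bil_sub_left hs, bil_sub_left hs, bil_sub_right hs,
        bil_sub_right hs]
      ring
    rw [e, enorm_mul, hI, one_mul]
    refine (hsq α (by nlinarith [sq_nonneg β]) _).trans ?_
    rw [hc4, mul_comm (4 : ℝ≥0∞), mul_assoc]
    exact mul_le_mul_right (enorm_add4_sq_le _ _ _ _) _
  have hZ : ∀ n, ‖fieldZ s θ β n t x - fieldZ s θ β n t y‖ₑ ^ 2 ≤ c *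
      (‖bil s θ (-1) n t (x.1 - y.1 : SeqL2) (SeqL2.conjL x.1)‖ₑ ^ 2
        + ‖bil s θ (-1) n t y.1 (SeqL2.conjL (x.1 - y.1))‖ₑ ^ 2
        + (‖(x.2 - y.2 : SeqL2) n‖ₑ ^ 2 + ‖SeqL2.conjL (x.2 - y.2) n‖ₑ ^ 2)) := fun n => by
    by_cases hn : n = 0
    · simp [fieldZ, hn]
    have e : fieldZ s θ β n t x - fieldZ s θ β n t y = -(I / 2) *
        (β * bil s θ (-1) n t (x.1 - y.1 : SeqL2) (SeqL2.conjL x.1)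
        + β * bil s θ (-1) n t y.1 (SeqL2.conjL (x.1 - y.1))
        + ((x.2 - y.2 : SeqL2) n + Complex.exp (I * ((2 * (t * (θ * (n : ℝ) ^ 2)) : ℝ) : ℂ))
          * SeqL2.conjL (x.2 - y.2) n)) := by
      rw [fieldZ, fieldZ, if_neg hn, if_neg hn, map_sub, map_sub, bil_sub_left hs,
        bil_sub_right hs]
      simp only [lp.coeFn_sub, Pi.sub_apply]
      ring
    rw [e, enorm_mul, mul_pow]
    refine (mul_le_of_le_one_left' h2).trans ((enorm_add4_sq_le _ _ _ _).trans ?_)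
    rw [hc4, mul_assoc]
    refine mul_le_mul_right ?_ _
    have h1 : 1 ≤ ENNReal.ofReal (α ^ 2 + β ^ 2 + 1) := by
      rw [ENNReal.one_le_ofReal]; nlinarith [sq_nonneg α, sq_nonneg β]
    have hexp : ‖Complex.exp (I * ((2 * (t * (θ * (n : ℝ) ^ 2)) : ℝ) : ℂ))‖ₑ = 1 := by
      rw [← ofReal_norm, mul_comm I, Complex.norm_exp_ofReal_mul_I, ENNReal.ofReal_one]
    rw [enorm_mul (Complex.exp _), hexp, one_mul, mul_add, mul_add]
    gcongr
    · exact hsq β (by nlinarith [sq_nonneg α]) _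
    · exact hsq β (by nlinarith [sq_nonneg α]) _
    · exact le_mul_of_one_le_left' h1
  have hJ : ∑' n, ‖SeqL2.conjL (x.2 - y.2) n‖ₑ ^ 2 = ‖x.2 - y.2‖ₑ ^ 2 := by
    rw [← SeqL2.enorm_sq_eq]
    congr 1
    rw [enorm_eq_iff_norm_eq]
    exact SeqL2.conjL.norm_map _
  calc _ ≤ _ := add_le_add (ENNReal.tsum_le_tsum hU) (ENNReal.tsum_le_tsum hZ)
    _ = _ := by
      simp_rw [ENNReal.tsum_mul_left, ENNReal.tsum_add, hJ, ← SeqL2.enorm_sq_eq]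
      simp only [bilSq]
      ring

end Field

section FieldEstimate

variable {s θ P α β : ℝ}

theorem pathOf_clm {X Y : Type*} [NormedAddCommGroup X] [NormedSpace ℝ X] [CompleteSpace X]
    [NormedAddCommGroup Y] [NormedSpace ℝ Y] [CompleteSpace Y] (Λ : X →L[ℝ] Y) {a : X} {f : ℝ → X}
    {T : ℝ} (hfi : IntegrableOn f (Ioc 0 T)) {t : ℝ} (ht : t ∈ Icc 0 T) :
    Λ (pathOf a f t) = pathOf (Λ a) (fun σ => Λ (f σ)) t := by
  have hii : IntervalIntegrable f volume 0 t := by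
    rw [intervalIntegrable_iff_integrableOn_Ioc_of_le ht.1]
    exact hfi.mono_set (Ioc_subset_Ioc_right ht.2)
  rw [pathOf, pathOf, map_add, Λ.intervalIntegral_comp_comm hii]

theorem pathOf_sub {X : Type*} [NormedAddCommGroup X] [NormedSpace ℝ X]
    {a b : X} {f g : ℝ → X} {T : ℝ} (hf : IntegrableOn f (Ioc 0 T)) (hg : IntegrableOn g (Ioc 0 T))
    {t : ℝ} (ht : t ∈ Icc 0 T) :
    pathOf (a - b) (fun σ => f σ - g σ) t = pathOf a f t - pathOf b g t := by
  have hii : ∀ f : ℝ → X, IntegrableOn f (Ioc 0 T) → IntervalIntegrable f volume 0 t :=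
    fun f hf => by
      rw [intervalIntegrable_iff_integrableOn_Ioc_of_le ht.1]
      exact hf.mono_set (Ioc_subset_Ioc_right ht.2)
  rw [pathOf, pathOf, pathOf, intervalIntegral.integral_sub (hii f hf) (hii g hg)]
  abel

/-- The squared size of a curve given by an initial value and a derivative. -/
def pathNormSq {X : Type*} [NormedAddCommGroup X] (l T : ℝ) (κ : ℝ≥0∞) (a : X) (f : ℝ → X) :
    ℝ≥0∞ := ‖a‖ₑ ^ 2 + κ * expNormSq l T f

theorem pathNormSq_clm_le {X Y : Type*} [NormedAddCommGroup X] [NormedSpace ℝ X]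
    [NormedAddCommGroup Y] [NormedSpace ℝ Y] {Λ : X →L[ℝ] Y} (hΛ : ∀ x, ‖Λ x‖ₑ ≤ ‖x‖ₑ)
    (l T : ℝ) (κ : ℝ≥0∞) (a : X) (f : ℝ → X) :
    pathNormSq l T κ (Λ a) (fun σ => Λ (f σ)) ≤ pathNormSq l T κ a f := by
  unfold pathNormSq expNormSq
  gcongr
  · exact hΛ a
  · exact hΛ _

theorem lintegral_bilSq_clm_le (hs : 0 ≤ s) (hP : 0 ≤ P) (hθP : θ * P = 2 * Real.pi)
    {ε : ℤ} (hε : ε = 1 ∨ ε = -1) {T : ℝ} (hT : T ≤ P) {l₁ l₂ : ℝ} (hl₁ : 0 ≤ l₁) (hl₂ : 0 ≤ l₂)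
    {κ₁ κ₂ : ℝ≥0∞} (hκ₁ : ExpKernelBound l₁ T κ₁) (hκ₂ : ExpKernelBound l₂ T κ₂)
    {X : Type*} [NormedAddCommGroup X] [NormedSpace ℝ X] [CompleteSpace X]
    {a₁ a₂ : X} {f₁ f₂ : ℝ → X} {Λ₁ Λ₂ : X →L[ℝ] SeqL2}
    (hΛ₁ : ∀ x, ‖Λ₁ x‖ₑ ≤ ‖x‖ₑ) (hΛ₂ : ∀ x, ‖Λ₂ x‖ₑ ≤ ‖x‖ₑ)
    (hf₁ : StronglyMeasurable f₁) (hfi₁ : IntegrableOn f₁ (Ioc 0 T))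
    (hf₂ : StronglyMeasurable f₂) (hfi₂ : IntegrableOn f₂ (Ioc 0 T)) :
    ∫⁻ t in Ioc 0 T, ENNReal.ofReal (Real.exp (-(l₁ + l₂) * t)) *
        bilSq s θ ε t (Λ₁ (pathOf a₁ f₁ t)) (Λ₂ (pathOf a₂ f₂ t))
      ≤ 8 * ENNReal.ofReal P *
        (pathNormSq l₁ T κ₁ a₁ f₁ * pathNormSq l₂ T κ₂ a₂ f₂) := by
  have h := lintegral_bilSq_pathOf_le hs hP hθP hε hT hl₁ hl₂ hκ₁ hκ₂ (a₁ := Λ₁ a₁) (a₂ := Λ₂ a₂)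
    (Λ₁.continuous.comp_stronglyMeasurable hf₁) (Λ₁.integrable_comp hfi₁)
    (Λ₂.continuous.comp_stronglyMeasurable hf₂) (Λ₂.integrable_comp hfi₂)
  refine (le_of_eq ?_).trans (h.trans (mul_le_mul_right (mul_le_mul'
    (pathNormSq_clm_le hΛ₁ l₁ T κ₁ a₁ f₁) (pathNormSq_clm_le hΛ₂ l₂ T κ₂ a₂ f₂)) _))
  refine setLIntegral_congr_fun measurableSet_Ioc fun t ht => ?_
  simp only
  rw [pathOf_clm Λ₁ hfi₁ (Ioc_subset_Icc_self ht), pathOf_clm Λ₂ hfi₂ (Ioc_subset_Icc_self ht)]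

theorem measurable_bilSq_pathOf (hs : 0 ≤ s) (ε : ℤ) (l : ℝ) {x y : ℝ → SeqL2}
    (hx : StronglyMeasurable x) (hy : StronglyMeasurable y) :
    Measurable fun t => ENNReal.ofReal (Real.exp (-l * t)) * bilSq s θ ε t (x t) (y t) := by
  exact (by fun_prop : Measurable fun t : ℝ => ENNReal.ofReal (Real.exp (-l * t))).mul
    (measurable_bilSq hs measurable_id hx hy)

/-- The Lipschitz estimate of the vector field along curves. -/
theorem lintegral_fieldDistSq_le (hs : 0 ≤ s) (hP : 0 ≤ P) (hθP : θ * P = 2 * Real.pi)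
    {T : ℝ} (hT : T ≤ P) {l : ℝ} (hl : 0 ≤ l) {κ : ℝ≥0∞} (hκ : ExpKernelBound l T κ)
    {a b : Profile} {f g : ℝ → Profile}
    (hf : StronglyMeasurable f) (hfi : Integrable f) (hg : StronglyMeasurable g)
    (hgi : Integrable g) :
    ∫⁻ t in Ioc 0 T, ENNReal.ofReal (Real.exp (-l * t)) *
        fieldDistSq s θ α β t (pathOf a f t) (pathOf b g t)
      ≤ fieldConst α β P * (1 + pathNormSq 0 T (ENNReal.ofReal T) a f
          + pathNormSq 0 T (ENNReal.ofReal T) b g)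
        * pathNormSq l T κ (a - b) (fun σ => f σ - g σ) := by
  have hκ0 := expKernelBound_zero T
  have hδm := hf.sub hg
  have hδi := hfi.sub hgi
  have cf : Continuous (pathOf a f) := continuous_pathOf fun _ _ => hfi.intervalIntegrable
  have cg : Continuous (pathOf b g) := continuous_pathOf fun _ _ => hgi.intervalIntegrable
  have cδ : Continuous (pathOf (a - b) (f - g)) :=
    continuous_pathOf fun _ _ => hδi.intervalIntegrable
  set A := pathNormSq 0 T (ENNReal.ofReal T) a f
  set B := pathNormSq 0 T (ENNReal.ofReal T) b g
  set D := pathNormSq l T κ (a - b) (fun σ => f σ - g σ) with hD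
  let Jc : SeqL2 →L[ℝ] SeqL2 := SeqL2.conjL.toContinuousLinearMap
  let F₁ : Profile →L[ℝ] SeqL2 := ContinuousLinearMap.fst ℝ SeqL2 SeqL2
  let F₂ : Profile →L[ℝ] SeqL2 := ContinuousLinearMap.snd ℝ SeqL2 SeqL2
  have n1 : ∀ x, ‖F₁ x‖ₑ ≤ ‖x‖ₑ := fun x => enorm_le_iff_norm_le.2 (norm_fst_le x)
  have n2 : ∀ x, ‖F₂ x‖ₑ ≤ ‖x‖ₑ := fun x => enorm_le_iff_norm_le.2 (norm_snd_le x)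
  have nJ : ∀ x, ‖Jc x‖ₑ = ‖x‖ₑ := fun x => enorm_eq_iff_norm_eq.2 (SeqL2.conjL.norm_map x)
  have nJ1 : ∀ x, ‖(Jc.comp F₁) x‖ₑ ≤ ‖x‖ₑ := fun x => (nJ (F₁ x)).le.trans (n1 x)
  have nJ2 : ∀ x, ‖(Jc.comp F₂) x‖ₑ ≤ ‖x‖ₑ := fun x => (nJ (F₂ x)).le.trans (n2 x)
  have one : (1 : ℤ) = 1 ∨ (1 : ℤ) = -1 := Or.inl rfl
  have neg : (-1 : ℤ) = 1 ∨ (-1 : ℤ) = -1 := Or.inr rfl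
  -- The whole weight e^{-lt} is spent on the difference of the curves. The other factor is measured
  -- without weight, so its size does not depend on l.
  have L : ∀ {ε : ℤ} (_ : ε = 1 ∨ ε = -1) (Λ₁ Λ₂ : Profile →L[ℝ] SeqL2)
      (_ : ∀ x, ‖Λ₁ x‖ₑ ≤ ‖x‖ₑ) (_ : ∀ x, ‖Λ₂ x‖ₑ ≤ ‖x‖ₑ),
      ∫⁻ t in Ioc 0 T, ENNReal.ofReal (Real.exp (-l * t)) *
        bilSq s θ ε t (Λ₁ (pathOf (a - b) (f - g) t)) (Λ₂ (pathOf a f t))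
      ≤ 8 * ENNReal.ofReal P * (D * A) := fun hε Λ₁ Λ₂ h₁ h₂ => by
    have := lintegral_bilSq_clm_le hs hP hθP hε hT hl le_rfl hκ hκ0 (a₁ := a - b) (a₂ := a) h₁ h₂
      hδm hδi.integrableOn hf hfi.integrableOn
    rwa [add_zero] at this
  have R : ∀ {ε : ℤ} (_ : ε = 1 ∨ ε = -1) (Λ₁ Λ₂ : Profile →L[ℝ] SeqL2)
      (_ : ∀ x, ‖Λ₁ x‖ₑ ≤ ‖x‖ₑ) (_ : ∀ x, ‖Λ₂ x‖ₑ ≤ ‖x‖ₑ),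
      ∫⁻ t in Ioc 0 T, ENNReal.ofReal (Real.exp (-l * t)) *
        bilSq s θ ε t (Λ₁ (pathOf b g t)) (Λ₂ (pathOf (a - b) (f - g) t))
      ≤ 8 * ENNReal.ofReal P * (B * D) := fun hε Λ₁ Λ₂ h₁ h₂ => by
    have := lintegral_bilSq_clm_le hs hP hθP hε hT le_rfl hl hκ0 hκ (a₁ := b) (a₂ := a - b) h₁ h₂
      hg hgi.integrableOn hδm hδi.integrableOn
    rwa [zero_add] at this
  have lin : ∫⁻ t in Ioc 0 T, ENNReal.ofReal (Real.exp (-l * t)) *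
      ‖F₂ (pathOf (a - b) (f - g) t)‖ₑ ^ 2 ≤ 2 * ENNReal.ofReal P * D := by
    calc _ ≤ ∫⁻ t in Ioc 0 T, 2 * D := by
          refine setLIntegral_mono' measurableSet_Ioc fun t ht => ?_
          refine (enorm_pathOf_sq_le hl hκ hδm hδi.integrableOn F₂ ht).trans ?_
          exact mul_le_mul_right (pathNormSq_clm_le n2 l T κ _ _) _
      _ = 2 * D * ENNReal.ofReal T := by simp
      _ ≤ _ := by
          rw [mul_right_comm]
          gcongr
  have hsm : ∀ (Λ : Profile →L[ℝ] SeqL2) {x : ℝ → Profile}, Continuous x →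
      StronglyMeasurable fun t => Λ (x t) := fun Λ x hx =>
    (Λ.continuous.comp hx).stronglyMeasurable
  have M := fun (ε : ℤ) (Λ₁ Λ₂ : Profile →L[ℝ] SeqL2) {x y : ℝ → Profile} (hx : Continuous x)
    (hy : Continuous y) => measurable_bilSq_pathOf (θ := θ) hs ε l (hsm Λ₁ hx) (hsm Λ₂ hy)
  set c := ENNReal.ofReal (4 * (α ^ 2 + β ^ 2 + 1)) with hc
  set e : ℝ → ℝ≥0∞ := fun t => ENNReal.ofReal (Real.exp (-l * t)) with he
  calc _ ≤ ∫⁻ t in Ioc 0 T, c * (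
        e t * bilSq s θ 1 t (F₁ (pathOf (a - b) (f - g) t)) (F₂ (pathOf a f t))
        + (e t * bilSq s θ 1 t (F₁ (pathOf b g t)) (F₂ (pathOf (a - b) (f - g) t))
        + (e t * bilSq s θ (-1) t (F₁ (pathOf (a - b) (f - g) t)) ((Jc.comp F₂) (pathOf a f t))
        + (e t * bilSq s θ (-1) t (F₁ (pathOf b g t)) ((Jc.comp F₂) (pathOf (a - b) (f - g) t))
        + (e t * bilSq s θ (-1) t (F₁ (pathOf (a - b) (f - g) t)) ((Jc.comp F₁) (pathOf a f t))
        + (e t * bilSq s θ (-1) t (F₁ (pathOf b g t)) ((Jc.comp F₁) (pathOf (a - b) (f - g) t))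
        + 2 * (e t * ‖F₂ (pathOf (a - b) (f - g) t)‖ₑ ^ 2))))))) := by
        refine setLIntegral_mono' measurableSet_Ioc fun t ht => ?_
        have hd : pathOf (a - b) (f - g) t = pathOf a f t - pathOf b g t :=
          pathOf_sub hfi.integrableOn hgi.integrableOn (Ioc_subset_Icc_self ht)
        refine (mul_le_mul_right (fieldDistSq_le hs t _ _) _).trans (le_of_eq ?_)
        rw [hd]
        simp only [F₁, F₂, Jc, ContinuousLinearMap.coe_comp, Function.comp_apply,
          ContinuousLinearMap.coe_fst', ContinuousLinearMap.coe_snd', Prod.fst_sub, Prod.snd_sub,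
          LinearIsometry.coe_toContinuousLinearMap]
        ring
    _ ≤ c * (8 * ENNReal.ofReal P * (D * A) + (8 * ENNReal.ofReal P * (B * D)
        + (8 * ENNReal.ofReal P * (D * A) + (8 * ENNReal.ofReal P * (B * D)
        + (8 * ENNReal.ofReal P * (D * A) + (8 * ENNReal.ofReal P * (B * D)
        + 2 * (2 * ENNReal.ofReal P * D))))))) := by
        rw [lintegral_const_mul' _ _ ENNReal.ofReal_ne_top,
          lintegral_add_left (M 1 F₁ F₂ cδ cf), lintegral_add_left (M 1 F₁ F₂ cg cδ),
          lintegral_add_left (M (-1) F₁ (Jc.comp F₂) cδ cf),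
          lintegral_add_left (M (-1) F₁ (Jc.comp F₂) cg cδ),
          lintegral_add_left (M (-1) F₁ (Jc.comp F₁) cδ cf),
          lintegral_add_left (M (-1) F₁ (Jc.comp F₁) cg cδ),
          lintegral_const_mul' _ _ (by norm_num)]
        refine mul_le_mul_right ?_ _
        exact add_le_add (L one _ _ n1 n2) (add_le_add (R one _ _ n1 n2)
          (add_le_add (L neg _ _ n1 nJ2) (add_le_add (R neg _ _ n1 nJ2)
          (add_le_add (L neg _ _ n1 nJ1) (add_le_add (R neg _ _ n1 nJ1)
          (mul_le_mul_right lin _))))))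
    -- Three bilinear terms with constant 8 fall on each curve, and the linear part contributes 2 ·
    -- 2. The coefficients are then enlarged to the common value 48 of `fieldConst`.
    _ = c * (ENNReal.ofReal P * D * (4 + 24 * A + 24 * B)) := by ring
    _ ≤ c * (ENNReal.ofReal P * D * (48 + 48 * A + 48 * B)) := by gcongr <;> norm_num
    _ = _ := by rw [fieldConst]; ring

end FieldEstimate

/-! ### Lipschitz dependence and uniqueness of profiles -/

section MildSolution

variable {s θ P α β : ℝ}

/-- `f` is the time derivative on `[0, T]` of a solution curve with initial value `a` of the system
in the interaction picture. -/
structure IsMildSol (s θ α β T : ℝ) (a : Profile) (f : ℝ → Profile) : Prop where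
  stronglyMeasurable : StronglyMeasurable f
  integrable : Integrable f
  expNormSq_ne_top : expNormSq 0 T f ≠ ⊤
  ae_eq : ∀ᵐ t ∂volume.restrict (Ioc 0 T), ∀ n,
    (f t).1 n = fieldU s θ α n t (pathOf a f t) ∧ (f t).2 n = fieldZ s θ β n t (pathOf a f t)

theorem Profile.enorm_sq_le (x : Profile) : ‖x‖ₑ ^ 2 ≤ ‖x.1‖ₑ ^ 2 + ‖x.2‖ₑ ^ 2 := by
  rcases le_total ‖x.1‖ₑ ‖x.2‖ₑ with h | h
  · have : ‖x‖ₑ = ‖x.2‖ₑ := by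
      rw [enorm_eq_iff_norm_eq, Prod.norm_def, max_eq_right (enorm_le_iff_norm_le.1 h)]
    rw [this]; exact le_add_self
  · have : ‖x‖ₑ = ‖x.1‖ₑ := by
      rw [enorm_eq_iff_norm_eq, Prod.norm_def, max_eq_left (enorm_le_iff_norm_le.1 h)]
    rw [this]; exact le_self_add

theorem expNormSq_ne_top_of_zero {X : Type*} [NormedAddCommGroup X] {l T : ℝ} (hl : 0 ≤ l)
    {f : ℝ → X} (hf : expNormSq 0 T f ≠ ⊤) : expNormSq l T f ≠ ⊤ := by
  refine ne_top_of_le_ne_top hf (setLIntegral_mono' measurableSet_Ioc fun t ht => ?_)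
  gcongr
  nlinarith [ht.1]

theorem expNormSq_sub_ne_top {X : Type*} [NormedAddCommGroup X] {T : ℝ}
    {f g : ℝ → X} (hfm : StronglyMeasurable f) (hf : expNormSq 0 T f ≠ ⊤)
    (hg : expNormSq 0 T g ≠ ⊤) : expNormSq 0 T (fun t => f t - g t) ≠ ⊤ := by
  have : expNormSq 0 T (fun t => f t - g t) ≤ 2 * expNormSq 0 T f + 2 * expNormSq 0 T g := by
    have hm : Measurable fun t => 2 * ‖f t‖ₑ ^ 2 := (hfm.enorm.pow_const 2).const_mul 2
    simp only [expNormSq, neg_zero, zero_mul, Real.exp_zero, ENNReal.ofReal_one, one_mul]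
    rw [← lintegral_const_mul' _ _ (by norm_num), ← lintegral_const_mul' _ _ (by norm_num),
      ← lintegral_add_left hm]
    refine lintegral_mono fun t => ?_
    exact (pow_le_pow_left' enorm_sub_le 2).trans (ENNReal.add_sq_le _ _)
  refine ne_top_of_le_ne_top ?_ this
  finiteness

/-- Solution curves depend Lipschitz continuously on the initial value, with a constant that depends
only on the size of the curves. -/
theorem IsMildSol.exists_lipschitz (hs : 0 ≤ s) (hP : 0 ≤ P) (hθP : θ * P = 2 * Real.pi)
    {T : ℝ} (hT : T ≤ P) {M : ℝ≥0∞} (hM : M ≠ ⊤) :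
    ∃ K : ℝ≥0∞, K ≠ ⊤ ∧ ∀ (a b : Profile) (f g : ℝ → Profile),
      IsMildSol s θ α β T a f → IsMildSol s θ α β T b g →
      pathNormSq 0 T (ENNReal.ofReal T) a f ≤ M → pathNormSq 0 T (ENNReal.ofReal T) b g ≤ M →
      ∀ t ∈ Icc 0 T, ‖pathOf a f t - pathOf b g t‖ₑ ≤ K * ‖a - b‖ₑ := by
  set F : ℝ≥0∞ := fieldConst α β P * (1 + M + M) with hF
  have hFt : F ≠ ⊤ := by
    have : fieldConst α β P ≠ ⊤ := by unfold fieldConst; finiteness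
    finiteness
  -- The weight is chosen so that κF ≤ 1/2; the summand 1 keeps l positive when F = 0.
  set l : ℝ := 2 * (F.toReal + 1) with hl
  have hlpos : 0 < l := by positivity
  set κ := ENNReal.ofReal (1 / l) with hκ
  have hFκ : F * κ ≤ 1 / 2 := by
    rw [← ENNReal.ofReal_toReal hFt, hκ, ← ENNReal.ofReal_mul (by positivity)]
    have : F.toReal * (1 / l) ≤ 1 / 2 := by
      rw [mul_one_div, div_le_div_iff₀ hlpos two_pos]
      linarith
    refine (ENNReal.ofReal_le_ofReal this).trans (le_of_eq ?_)
    rw [ENNReal.ofReal_div_of_pos two_pos]; norm_num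
  refine ⟨2 * ENNReal.ofReal (Real.exp (l * T / 2)), by finiteness, ?_⟩
  intro a b f g hf hg hNf hNg t ht
  have hκb := expKernelBound_inv hlpos T
  set y := expNormSq l T fun σ => f σ - g σ with hy
  -- Finiteness of y is what permits subtracting κy/2 from both sides in the absorption below.
  have hyt : y ≠ ⊤ := expNormSq_ne_top_of_zero hlpos.le
    (expNormSq_sub_ne_top hf.stronglyMeasurable hf.expNormSq_ne_top hg.expNormSq_ne_top)
  have h1 : y ≤ ∫⁻ t in Ioc 0 T, ENNReal.ofReal (Real.exp (-l * t)) *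
      fieldDistSq s θ α β t (pathOf a f t) (pathOf b g t) := by
    refine lintegral_mono_ae ?_
    filter_upwards [hf.ae_eq, hg.ae_eq] with t h1 h2
    gcongr
    refine (Profile.enorm_sq_le _).trans (le_of_eq ?_)
    rw [SeqL2.enorm_sq_eq, SeqL2.enorm_sq_eq, fieldDistSq]
    simp only [Prod.fst_sub, Prod.snd_sub, lp.coeFn_sub, Pi.sub_apply, fun n => (h1 n).1,
      fun n => (h1 n).2, fun n => (h2 n).1, fun n => (h2 n).2]
  have h2 : y ≤ F * (‖a - b‖ₑ ^ 2 + κ * y) := by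
    refine h1.trans ((lintegral_fieldDistSq_le hs hP hθP hT hlpos.le hκb hf.stronglyMeasurable
      hf.integrable hg.stronglyMeasurable hg.integrable).trans ?_)
    rw [hF]
    gcongr
    rfl
  -- Multiplying the estimate by κ gives κy ≤ (‖a-b‖² + κy)/2, and the last term is absorbed.
  have h3 : κ * y ≤ ‖a - b‖ₑ ^ 2 := by
    have : κ * y ≤ ‖a - b‖ₑ ^ 2 / 2 + κ * y / 2 := by
      calc κ * y ≤ κ * (F * (‖a - b‖ₑ ^ 2 + κ * y)) := by gcongr
        _ = F * κ * (‖a - b‖ₑ ^ 2 + κ * y) := by ring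
        _ ≤ 1 / 2 * (‖a - b‖ₑ ^ 2 + κ * y) := by gcongr
        _ = _ := by rw [mul_add, one_div, div_eq_mul_inv, div_eq_mul_inv]; ring
    have hk : κ * y ≠ ⊤ := by finiteness
    have hk2 : κ * y / 2 ≠ ⊤ := ENNReal.div_ne_top hk (by norm_num)
    have h4 : κ * y / 2 + κ * y / 2 ≤ ‖a - b‖ₑ ^ 2 / 2 + κ * y / 2 := by
      rwa [ENNReal.add_halves]
    have h5 := (ENNReal.add_le_add_iff_right hk2).1 h4
    have h6 := add_le_add h5 h5
    rwa [ENNReal.add_halves, ENNReal.add_halves] at h6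
  -- The integral estimates concern (0, T], so the initial time is treated separately: there the
  -- difference is a - b and the constant is at least 1.
  rcases ht.1.eq_or_lt with rfl | ht0
  · have h1 : (1 : ℝ≥0∞) ≤ 2 * ENNReal.ofReal (Real.exp (l * T / 2)) := by
      have : (1 : ℝ≥0∞) ≤ ENNReal.ofReal (Real.exp (l * T / 2)) := by
        rw [ENNReal.one_le_ofReal]
        exact Real.one_le_exp (by have := ht.2; positivity)
      exact this.trans (le_mul_of_one_le_left' (by norm_num))
    simp only [pathOf, intervalIntegral.integral_same, add_zero]
    exact le_mul_of_one_le_left' h1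
  have ht' : t ∈ Ioc 0 T := ⟨ht0, ht.2⟩
  have h4 := enorm_pathOf_sq_le hlpos.le hκb (a := a - b)
    (hf.stronglyMeasurable.sub hg.stronglyMeasurable)
    (hf.integrable.sub hg.integrable).integrableOn (ContinuousLinearMap.id ℝ Profile) ht'
  simp only [ContinuousLinearMap.id_apply] at h4
  have hd : pathOf (a - b) (f - g) t = pathOf a f t - pathOf b g t :=
    pathOf_sub hf.integrable.integrableOn hg.integrable.integrableOn ht
  rw [hd] at h4
  have h5 : ENNReal.ofReal (Real.exp (-l * t)) * ‖pathOf a f t - pathOf b g t‖ₑ ^ 2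
      ≤ 4 * ‖a - b‖ₑ ^ 2 := by
    refine h4.trans ?_
    calc _ ≤ 2 * (‖a - b‖ₑ ^ 2 + ‖a - b‖ₑ ^ 2) := by gcongr; exact h3
      _ = _ := by ring
  have h6 : ‖pathOf a f t - pathOf b g t‖ₑ ^ 2
      ≤ (2 * ENNReal.ofReal (Real.exp (l * T / 2)) * ‖a - b‖ₑ) ^ 2 := by
    calc ‖pathOf a f t - pathOf b g t‖ₑ ^ 2
        = ENNReal.ofReal (Real.exp (l * t)) * (ENNReal.ofReal (Real.exp (-l * t)) *
          ‖pathOf a f t - pathOf b g t‖ₑ ^ 2) := by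
          rw [← mul_assoc, ← ENNReal.ofReal_mul (Real.exp_pos _).le, ← Real.exp_add]
          simp
      _ ≤ ENNReal.ofReal (Real.exp (l * T)) * (4 * ‖a - b‖ₑ ^ 2) := by
          gcongr
          exact ht.2
      _ = _ := by
          have : ENNReal.ofReal (Real.exp (l * T)) = ENNReal.ofReal (Real.exp (l * T / 2)) ^ 2 := by
            rw [← ENNReal.ofReal_pow (Real.exp_pos _).le, ← Real.exp_nat_mul]
            congr 2; push_cast; ring
          rw [this]; ring
  exact (ENNReal.pow_le_pow_left_iff (by norm_num)).1 h6

end MildSolution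

/-! ### Existence by contraction -/

section Existence

variable {s θ P α β : ℝ}

theorem bil_zero_left (ε n : ℤ) (t : ℝ) (b : ℤ → ℂ) : bil s θ ε n t (0 : SeqL2) b = 0 := by
  simp [bil, bilTerm]

theorem fieldU_zero (n : ℤ) (t : ℝ) : fieldU s θ α n t 0 = 0 := by
  change -(I * α) * (bil s θ 1 n t (0 : SeqL2) _ + bil s θ (-1) n t (0 : SeqL2) _) = 0
  rw [bil_zero_left, bil_zero_left, add_zero, mul_zero]

theorem fieldZ_zero (n : ℤ) (t : ℝ) : fieldZ s θ β n t 0 = 0 := by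
  rw [fieldZ]
  have : bil s θ (-1) n t (0 : Profile).1 (SeqL2.conjL (0 : Profile).1) = 0 :=
    bil_zero_left _ _ _ _
  rw [this]
  simp

theorem fieldDistSq_zero (t : ℝ) (x : Profile) : fieldDistSq s θ α β t x 0 =
    ∑' n, ‖fieldU s θ α n t x‖ₑ ^ 2 + ∑' n, ‖fieldZ s θ β n t x‖ₑ ^ 2 := by
  simp only [fieldDistSq, fieldU_zero, fieldZ_zero, sub_zero]

/-- A finite distance to the field at 0, which vanishes, says that both coefficient sequences are
square-summable, so the default value 0 of `SeqL2.ofFun` does not intervene. -/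
theorem fieldVec_apply {t : ℝ} {x : Profile} (h : fieldDistSq s θ α β t x 0 ≠ ⊤) (n : ℤ) :
    (fieldVec s θ α β t x).1 n = fieldU s θ α n t x ∧
      (fieldVec s θ α β t x).2 n = fieldZ s θ β n t x := by
  rw [fieldDistSq_zero, ENNReal.add_ne_top] at h
  exact ⟨SeqL2.ofFun_apply h.1 n, SeqL2.ofFun_apply h.2 n⟩

theorem enorm_fieldVec_sub_le {t : ℝ} {x y : Profile} (hx : fieldDistSq s θ α β t x 0 ≠ ⊤)
    (hy : fieldDistSq s θ α β t y 0 ≠ ⊤) :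
    ‖fieldVec s θ α β t x - fieldVec s θ α β t y‖ₑ ^ 2 ≤ fieldDistSq s θ α β t x y := by
  refine (Profile.enorm_sq_le _).trans (le_of_eq ?_)
  rw [SeqL2.enorm_sq_eq, SeqL2.enorm_sq_eq, fieldDistSq]
  simp only [Prod.fst_sub, Prod.snd_sub, lp.coeFn_sub, Pi.sub_apply,
    fun n => (fieldVec_apply hx n).1, fun n => (fieldVec_apply hx n).2,
    fun n => (fieldVec_apply hy n).1, fun n => (fieldVec_apply hy n).2]

theorem fieldVec_zero (t : ℝ) : fieldVec s θ α β t 0 = 0 := by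
  have h : fieldDistSq s θ α β t (0 : Profile) 0 ≠ ⊤ := by
    simp [fieldDistSq]
  ext n
  · rw [(fieldVec_apply h n).1, fieldU_zero]; rfl
  · rw [(fieldVec_apply h n).2, fieldZ_zero]; rfl

/-- Finite truncations are measurable because their coordinates are, and they converge in ℓ²
wherever the sequence is square-summable. -/
theorem SeqL2.aestronglyMeasurable_ofFun {μ : Measure ℝ} {c : ℝ → ℤ → ℂ}
    (hc : ∀ n, Measurable fun t => c t n) (hfin : ∀ᵐ t ∂μ, ∑' n, ‖c t n‖ₑ ^ 2 ≠ ⊤) :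
    AEStronglyMeasurable (fun t => SeqL2.ofFun (c t)) μ := by
  refine aestronglyMeasurable_of_tendsto_ae (u := (atTop : Filter (Finset ℤ)))
    (f := fun S t => ∑ n ∈ S, lp.single (E := fun _ : ℤ => ℂ) 2 n (c t n)) (fun S => ?_) ?_
  · refine Finset.aestronglyMeasurable_fun_sum S fun n _ => ?_
    have hcont : Continuous fun z : ℂ => (lp.single (E := fun _ : ℤ => ℂ) 2 n z : SeqL2) :=
      (lp.singleContinuousLinearMap ℂ (fun _ : ℤ => ℂ) 2 n).continuous
    exact hcont.comp_aestronglyMeasurable (hc n).aestronglyMeasurable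
  · filter_upwards [hfin] with t ht
    have := lp.hasSum_single (E := fun _ : ℤ => ℂ) (p := 2) (by norm_num) (SeqL2.ofFun (c t))
    simp_rw [SeqL2.ofFun_apply ht] at this
    exact this

theorem continuous_fieldU (hs : 0 ≤ s) (n : ℤ) {x : ℝ → Profile} (hx : Continuous x) :
    Continuous fun t => fieldU s θ α n t (x t) := by
  have h : ∀ ε : ℤ, ∀ {a b : ℝ → SeqL2}, Continuous a → Continuous b →
      Continuous fun t => bil s θ ε n t (a t) (b t) := fun ε a b ha hb =>
    (continuous_bil (θ := θ) (ε := ε) hs n).comp (continuous_id.prodMk (ha.prodMk hb))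
  have := h 1 hx.fst hx.snd
  have := h (-1) hx.fst (SeqL2.conjL.continuous.comp hx.snd)
  simp only [Function.comp_def] at this
  unfold fieldU
  fun_prop

theorem continuous_fieldZ (hs : 0 ≤ s) (n : ℤ) {x : ℝ → Profile} (hx : Continuous x) :
    Continuous fun t => fieldZ s θ β n t (x t) := by
  have h1 : Continuous fun t => bil s θ (-1) n t (x t).1 (SeqL2.conjL (x t).1) :=
    (continuous_bil (θ := θ) (ε := -1) hs n).comp (continuous_id.prodMk
      (hx.fst.prodMk (SeqL2.conjL.continuous.comp hx.fst)))
  have hev : ∀ {a : ℝ → SeqL2}, Continuous a → Continuous fun t => a t n := fun ha =>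
    (lp.evalCLM ℂ (fun _ : ℤ => ℂ) 2 n).continuous.comp ha
  have h2 := hev hx.snd
  have h3 := hev (SeqL2.conjL.continuous.comp hx.snd)
  simp only [Function.comp_def] at h3
  unfold fieldZ
  by_cases hn : n = 0
  · simp only [hn, if_true]; exact continuous_const
  · simp only [if_neg hn]; fun_prop

theorem aestronglyMeasurable_fieldVec (hs : 0 ≤ s) {μ : Measure ℝ} {x : ℝ → Profile}
    (hx : Continuous x) (hfin : ∀ᵐ t ∂μ, fieldDistSq s θ α β t (x t) 0 ≠ ⊤) :
    AEStronglyMeasurable (fun t => fieldVec s θ α β t (x t)) μ := by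
  refine AEStronglyMeasurable.prodMk ?_ ?_
  · refine SeqL2.aestronglyMeasurable_ofFun (fun n => (continuous_fieldU hs n hx).measurable) ?_
    filter_upwards [hfin] with t ht
    rw [fieldDistSq_zero, ENNReal.add_ne_top] at ht
    exact ht.1
  · refine SeqL2.aestronglyMeasurable_ofFun (fun n => (continuous_fieldZ hs n hx).measurable) ?_
    filter_upwards [hfin] with t ht
    rw [fieldDistSq_zero, ENNReal.add_ne_top] at ht
    exact ht.2

theorem eLpNorm_two_sq {X Ω : Type*} [NormedAddCommGroup X] [MeasurableSpace Ω] (μ : Measure Ω)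
    (f : Ω → X) : eLpNorm f 2 μ ^ 2 = ∫⁻ x, ‖f x‖ₑ ^ 2 ∂μ := by
  have := eLpNorm_nnreal_pow_eq_lintegral (μ := μ) (f := f) (p := 2) (by norm_num)
  simpa using this

theorem expNormSq_zero_eq {X : Type*} [NormedAddCommGroup X] (T : ℝ) (f : ℝ → X) :
    expNormSq 0 T f = ∫⁻ t in Ioc 0 T, ‖f t‖ₑ ^ 2 := by
  simp [expNormSq]

theorem MeasureTheory.Lp.enorm_sq_eq {X : Type*} [NormedAddCommGroup X] {T : ℝ}
    (F : Lp X 2 (volume.restrict (Ioc 0 T))) : ‖F‖ₑ ^ 2 = expNormSq 0 T F := by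
  rw [Lp.enorm_def, eLpNorm_two_sq, expNormSq_zero_eq]

theorem expNormSq_congr_ae {X : Type*} [NormedAddCommGroup X] {l T : ℝ} {f g : ℝ → X}
    (h : f =ᵐ[volume.restrict (Ioc 0 T)] g) : expNormSq l T f = expNormSq l T g :=
  lintegral_congr_ae (by filter_upwards [h] with t ht; rw [ht])

theorem integrable_indicator_Lp {X : Type*} [NormedAddCommGroup X] {T : ℝ}
    (F : Lp X 2 (volume.restrict (Ioc 0 T))) : Integrable ((Ioc 0 T).indicator F) :=
  (integrable_indicator_iff measurableSet_Ioc).2 ((Lp.memLp F).integrable (by norm_num))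

theorem stronglyMeasurable_indicator_Lp {X : Type*} [NormedAddCommGroup X] {T : ℝ}
    (F : Lp X 2 (volume.restrict (Ioc 0 T))) : StronglyMeasurable ((Ioc 0 T).indicator F) :=
  (Lp.stronglyMeasurable F).indicator measurableSet_Ioc

theorem indicator_ae_eq {X : Type*} [NormedAddCommGroup X] {T : ℝ} (f : ℝ → X) :
    (Ioc 0 T).indicator f =ᵐ[volume.restrict (Ioc 0 T)] f :=
  indicator_ae_eq_restrict measurableSet_Ioc

/-- Local existence for the system in the interaction picture. -/
theorem exists_isMildSol (hs : 0 ≤ s) (hP : 0 < P) (hθP : θ * P = 2 * Real.pi) {A : ℝ}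
    (hA : 0 ≤ A) : ∃ T : ℝ, 0 < T ∧ T ≤ P ∧ ∃ M : ℝ≥0∞, M ≠ ⊤ ∧ ∀ a : Profile,
      ‖a‖ₑ ^ 2 ≤ ENNReal.ofReal A → ∃ f : ℝ → Profile, IsMildSol s θ α β T a f ∧
        pathNormSq 0 T (ENNReal.ofReal T) a f ≤ M ∧ ∀ t ∉ Ioc 0 T, f t = 0 := by
  have hC : fieldConst α β P ≠ ⊤ := by unfold fieldConst; finiteness
  obtain ⟨C, hC0, hCeq⟩ : ∃ C : ℝ, 0 ≤ C ∧ fieldConst α β P = ENNReal.ofReal C :=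
    ⟨_, ENNReal.toReal_nonneg, (ENNReal.ofReal_toReal hC).symm⟩
  -- R bounds the squared norm of the derivative. While TR ≤ 1 the curve has squared size at most A
  -- + 1, so the field has squared L² norm at most C(1 + (A+1))(A+1) ≤ R.
  set R : ℝ := C * (A + 2) ^ 2 with hR
  have hR0 : 0 ≤ R := by positivity
  -- With T ≤ 1/D both requirements hold: TR ≤ 1 for invariance of the ball, and C(1 + 2(A+1))T ≤
  -- 1/4 for contraction.
  set D : ℝ := 1 + R + 4 * (C * (2 * A + 3)) with hD
  have hDpos : 0 < D := by positivity
  set T : ℝ := min P (1 / D) with hT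
  have hTpos : 0 < T := lt_min hP (by positivity)
  have hTD : T * D ≤ 1 := by
    rw [← le_div_iff₀ hDpos]; exact min_le_right _ _
  have hTR : T * R ≤ 1 := by
    refine le_trans ?_ hTD
    gcongr
    rw [hD]
    have : 0 ≤ C * (2 * A + 3) := by positivity
    linarith
  have hTC : C * (2 * A + 3) * T ≤ 1 / 4 := by
    have : T * (4 * (C * (2 * A + 3))) ≤ T * D := by
      gcongr
      rw [hD]; linarith
    linarith
  have hTP : T ≤ P := min_le_left _ _
  clear_value T
  refine ⟨T, hTpos, hTP, ENNReal.ofReal (A + 1), ENNReal.ofReal_ne_top, ?_⟩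
  intro a ha
  let E := Lp Profile 2 (volume.restrict (Ioc 0 T))
  let fn : E → ℝ → Profile := fun F => (Ioc 0 T).indicator F
  have hfi : ∀ F : E, Integrable (fn F) := integrable_indicator_Lp
  have hfm : ∀ F : E, StronglyMeasurable (fn F) := stronglyMeasurable_indicator_Lp
  have hfae : ∀ F : E, fn F =ᵐ[volume.restrict (Ioc 0 T)] F := fun F => indicator_ae_eq _
  have hcont : ∀ F : E, Continuous (pathOf a (fn F)) := fun F =>
    continuous_pathOf fun _ _ => (hfi F).intervalIntegrable
  let S : Set E := {F | ‖F‖ₑ ^ 2 ≤ ENNReal.ofReal R}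
  have hN : ∀ F ∈ S, pathNormSq 0 T (ENNReal.ofReal T) a (fn F) ≤ ENNReal.ofReal (A + 1) := by
    intro F hF
    rw [ENNReal.ofReal_add hA zero_le_one]
    refine add_le_add ha ?_
    rw [expNormSq_congr_ae (hfae F), ← Lp.enorm_sq_eq]
    refine (mul_le_mul_right hF _).trans ?_
    rw [← ENNReal.ofReal_mul hTpos.le]
    exact ENNReal.ofReal_le_ofReal hTR
  have hdist : ∀ F ∈ S, ∫⁻ t in Ioc 0 T, fieldDistSq s θ α β t (pathOf a (fn F) t) 0
      ≤ ENNReal.ofReal R := by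
    intro F hF
    -- Comparison with the zero curve turns the Lipschitz estimate into a bound for the field
    -- itself.
    have h := lintegral_fieldDistSq_le (α := α) (β := β) hs hP.le hθP hTP
      le_rfl (expKernelBound_zero T) (a := a) (b := 0) (hfm F) (hfi F)
      (stronglyMeasurable_const (b := (0 : Profile))) (integrable_zero ℝ Profile volume)
    have h0 : pathNormSq 0 T (ENNReal.ofReal T) (0 : Profile) (fun _ => (0 : Profile)) = 0 := by
      simp [pathNormSq, expNormSq]
    have hp0 : ∀ t, pathOf (0 : Profile) (fun _ => (0 : Profile)) t = 0 := by simp [pathOf]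
    simp only [neg_zero, zero_mul, Real.exp_zero, ENNReal.ofReal_one, one_mul, sub_zero, h0, hp0,
      add_zero] at h
    refine h.trans ?_
    calc _ ≤ ENNReal.ofReal C * (1 + ENNReal.ofReal (A + 1)) * ENNReal.ofReal (A + 1) := by
          rw [hCeq]
          refine mul_le_mul' (mul_le_mul_right (add_le_add_right ?_ _) _) ?_ <;> exact hN F hF
      _ = ENNReal.ofReal (C * (1 + (A + 1)) * (A + 1)) := by
          rw [ENNReal.ofReal_mul (by positivity), ENNReal.ofReal_mul hC0,
            ENNReal.ofReal_add zero_le_one (by positivity), ENNReal.ofReal_one]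
      _ ≤ _ := by
          apply ENNReal.ofReal_le_ofReal
          rw [hR, mul_assoc]
          gcongr
          nlinarith
  have hfin : ∀ F ∈ S, ∀ᵐ t ∂volume.restrict (Ioc 0 T),
      fieldDistSq s θ α β t (pathOf a (fn F) t) 0 ≠ ⊤ := by
    intro F hF
    have hm : Measurable fun t => fieldDistSq s θ α β t (pathOf a (fn F) t) 0 := by
      simp_rw [fieldDistSq_zero]
      exact (Measurable.tsum fun n =>
        (continuous_fieldU hs n (hcont F)).measurable.enorm.pow_const 2).add
        (Measurable.tsum fun n =>
        (continuous_fieldZ hs n (hcont F)).measurable.enorm.pow_const 2)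
    filter_upwards [ae_lt_top hm (ne_top_of_le_ne_top ENNReal.ofReal_ne_top (hdist F hF))]
      with t ht using ht.ne
  have hsub0 : ∀ {t : ℝ} {x : Profile}, fieldDistSq s θ α β t x 0 ≠ ⊤ →
      ‖fieldVec s θ α β t x‖ₑ ^ 2 ≤ fieldDistSq s θ α β t x 0 := fun {t x} hx => by
    have := enorm_fieldVec_sub_le hx (y := 0) (by simp [fieldDistSq])
    rwa [fieldVec_zero, sub_zero] at this
  have hsq : ∀ F ∈ S, ∫⁻ t in Ioc 0 T, ‖fieldVec s θ α β t (pathOf a (fn F) t)‖ₑ ^ 2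
      ≤ ENNReal.ofReal R := fun F hF => by
    refine (lintegral_mono_ae ?_).trans (hdist F hF)
    filter_upwards [hfin F hF] with t ht using hsub0 ht
  have hmem : ∀ F ∈ S, MemLp (fun t => fieldVec s θ α β t (pathOf a (fn F) t)) 2
      (volume.restrict (Ioc 0 T)) := fun F hF => by
    refine ⟨aestronglyMeasurable_fieldVec hs (hcont F) (hfin F hF), ?_⟩
    have h : eLpNorm (fun t => fieldVec s θ α β t (pathOf a (fn F) t)) 2
        (volume.restrict (Ioc 0 T)) ^ 2 < ⊤ := by
      rw [eLpNorm_two_sq]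
      exact (hsq F hF).trans_lt ENNReal.ofReal_lt_top
    exact (ENNReal.pow_lt_top_iff.1 h).resolve_right (by norm_num)
  classical
  -- The Picard map on derivatives. Outside `S` the field need not be square-integrable; the value 0
  -- there is immaterial, since only the restriction to `S` is iterated.
  let Ψ : E → E := fun F => if hF : F ∈ S then (hmem F hF).toLp _ else 0
  have hΨ : ∀ F ∈ S, Ψ F =ᵐ[volume.restrict (Ioc 0 T)]
      fun t => fieldVec s θ α β t (pathOf a (fn F) t) := fun F hF => by
    simp only [Ψ, dif_pos hF]
    exact (hmem F hF).coeFn_toLp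
  have hmaps : MapsTo Ψ S S := fun F hF => by
    change ‖Ψ F‖ₑ ^ 2 ≤ _
    rw [Lp.enorm_sq_eq, expNormSq_congr_ae (hΨ F hF), expNormSq_zero_eq]
    exact hsq F hF
  have hlip : ∀ F ∈ S, ∀ G ∈ S, ‖Ψ F - Ψ G‖ₑ ^ 2 ≤ ENNReal.ofReal (1 / 4) * ‖F - G‖ₑ ^ 2 := by
    intro F hF G hG
    have h := lintegral_fieldDistSq_le (α := α) (β := β) hs hP.le hθP hTP
      le_rfl (expKernelBound_zero T) (a := a) (b := a) (hfm F) (hfi F) (hfm G) (hfi G)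
    simp only [neg_zero, zero_mul, Real.exp_zero, ENNReal.ofReal_one, one_mul] at h
    have e1 : ‖Ψ F - Ψ G‖ₑ ^ 2 ≤ ∫⁻ t in Ioc 0 T,
        fieldDistSq s θ α β t (pathOf a (fn F) t) (pathOf a (fn G) t) := by
      rw [Lp.enorm_sq_eq, expNormSq_zero_eq]
      refine lintegral_mono_ae ?_
      filter_upwards [hΨ F hF, hΨ G hG, hfin F hF, hfin G hG, Lp.coeFn_sub (Ψ F) (Ψ G)]
        with t h1 h2 h3 h4 h5
      rw [h5, Pi.sub_apply, h1, h2]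
      exact enorm_fieldVec_sub_le h3 h4
    refine e1.trans (h.trans ?_)
    have e2 : pathNormSq 0 T (ENNReal.ofReal T) (a - a) (fun σ => fn F σ - fn G σ)
        = ENNReal.ofReal T * ‖F - G‖ₑ ^ 2 := by
      have : (fun σ => fn F σ - fn G σ) =ᵐ[volume.restrict (Ioc 0 T)] (F - G : E) := by
        filter_upwards [hfae F, hfae G, Lp.coeFn_sub F G] with t h1 h2 h3
        rw [h3, Pi.sub_apply, h1, h2]
      rw [pathNormSq, sub_self, expNormSq_congr_ae this, Lp.enorm_sq_eq]
      simp
    rw [e2, ← mul_assoc]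
    gcongr
    calc _ ≤ ENNReal.ofReal C * (1 + ENNReal.ofReal (A + 1) + ENNReal.ofReal (A + 1))
          * ENNReal.ofReal T := by
          rw [hCeq]
          gcongr
          · exact hN F hF
          · exact hN G hG
      _ = ENNReal.ofReal (C * (1 + (A + 1) + (A + 1)) * T) := by
          rw [ENNReal.ofReal_mul (by positivity), ENNReal.ofReal_mul hC0,
            ENNReal.ofReal_add (p := 1 + (A + 1)) (by positivity) (by positivity),
            ENNReal.ofReal_add (q := A + 1) zero_le_one (by positivity), ENNReal.ofReal_one]
      _ ≤ _ := by
          apply ENNReal.ofReal_le_ofReal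
          refine le_trans (le_of_eq ?_) hTC
          ring
  -- The constant 1/4 for squared norms is the contraction factor 1/2.
  have hcontr : ContractingWith (1 / 2) (hmaps.restrict Ψ S S) := by
    refine ⟨by norm_num, fun F G => ?_⟩
    have h := hlip F.1 F.2 G.1 G.2
    change edist (Ψ F.1) (Ψ G.1) ≤ _ * edist F.1 G.1
    rw [edist_eq_enorm_sub, edist_eq_enorm_sub]
    refine (ENNReal.pow_le_pow_left_iff (n := 2) (by norm_num)).1 (h.trans (le_of_eq ?_))
    rw [mul_pow]
    congr 1
    rw [ENNReal.ofReal_div_of_pos (by norm_num)]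
    norm_num
    rw [← ENNReal.inv_pow]
    norm_num
  have hclosed : IsClosed S :=
    isClosed_le ((ENNReal.continuous_pow 2).comp continuous_enorm) continuous_const
  obtain ⟨F, hFS, hFfix, -⟩ := ContractingWith.exists_fixedPoint' hclosed.isComplete hmaps hcontr
    (x := 0) (by simp [S]) (edist_ne_top _ _)
  refine ⟨fn F, ⟨hfm F, hfi F, ?_, ?_⟩, hN F hFS, fun t ht => indicator_of_notMem ht _⟩
  · rw [expNormSq_congr_ae (hfae F), ← Lp.enorm_sq_eq]
    exact ne_top_of_le_ne_top ENNReal.ofReal_ne_top hFS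
  · have h1 := hΨ F hFS
    rw [hFfix.eq] at h1
    filter_upwards [h1, hfae F, hfin F hFS] with t h1 h2 h3
    intro n
    rw [h2, h1]
    exact fieldVec_apply h3 n

end Existence

/-! ### Time Fourier transform: derivatives and extensions -/

section Plancherel

open scoped FourierTransform SchwartzMap RealInnerProductSpace

/-- Plancherel's theorem for integrable square-integrable functions on the line. -/
theorem lintegral_sq_fourier_eq {f : ℝ → ℂ} (hf : Integrable f) (hf2 : MemLp f 2) :
    ∫⁻ x, ‖𝓕 f x‖ₑ ^ 2 = ∫⁻ x, ‖f x‖ₑ ^ 2 := by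
  set g : Lp ℂ 2 (volume : Measure ℝ) := hf2.toLp f with hg
  have hcont : Continuous (𝓕 f) :=
    VectorFourier.fourierIntegral_continuous Real.continuous_fourierChar
      (by exact continuous_inner) hf
  -- The L² Fourier transform is defined by extension. It is identified with the integral by testing
  -- both against smooth compactly supported functions and moving the transform onto the test
  -- function.
  have hae : ∀ᵐ x, (𝓕 g : Lp ℂ 2 (volume : Measure ℝ)) x = 𝓕 f x := by
    refine ae_eq_of_integral_contDiff_smul_eq
      ((Lp.memLp _).locallyIntegrable (by norm_num)) hcont.locallyIntegrable fun φ hφ hφc => ?_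
    let ψ : 𝓢(ℝ, ℂ) := HasCompactSupport.toSchwartzMap (f := fun x => (φ x : ℂ))
      (hφc.comp_left (g := ((↑) : ℝ → ℂ)) rfl) (Complex.ofRealCLM.contDiff.comp hφ)
    have hψ : ∀ x, ψ x = (φ x : ℂ) := fun x => rfl
    have h1 := congrArg (fun D : 𝓢'(ℝ, ℂ) => D ψ) (Lp.fourier_toTemperedDistribution_eq g)
    simp only [TemperedDistribution.fourier_apply, Lp.toTemperedDistribution_apply] at h1
    have h2 : ∫ x, (𝓕 ψ) x • g x = ∫ x, (𝓕 ψ) x • f x := by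
      refine integral_congr_ae ?_
      filter_upwards [hf2.coeFn_toLp] with x hx
      rw [hg, hx]
    have h3 := VectorFourier.integral_fourierIntegral_smul_eq_flip (μ := volume) (ν := volume)
      (L := innerₗ ℝ) (f := fun x => ψ x) (g := f) Real.continuous_fourierChar continuous_inner
      ψ.integrable hf
    rw [flip_innerₗ] at h3
    have h4 : ∫ x, (𝓕 ψ) x • f x = ∫ x, ψ x • 𝓕 f x := by
      rw [SchwartzMap.fourier_coe]
      exact h3
    rw [h2, h4] at h1
    simp only [hψ] at h1
    exact h1.symm
  have h5 := congrArg (· ^ 2) (enorm_eq_iff_norm_eq.2 (Lp.norm_fourier_eq g))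
  simp only [Lp.enorm_def, eLpNorm_two_sq] at h5
  rw [lintegral_congr_ae (g := fun x => ‖𝓕 f x‖ₑ ^ 2)
    (by filter_upwards [hae] with x hx; rw [hx])] at h5
  rw [h5]
  refine lintegral_congr_ae ?_
  filter_upwards [hf2.coeFn_toLp] with x hx
  rw [hg, hx]

theorem integral_mul_exp_eq_fourier (K : ℝ → ℂ) (t : ℝ) :
    ∫ τ : ℝ, K τ * Complex.exp (I * t * τ) = 𝓕 K (-(t / (2 * Real.pi))) := by
  rw [Real.fourier_real_eq_integral_exp_smul]
  congr 1
  funext τ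
  rw [smul_eq_mul, mul_comm]
  congr 2
  push_cast
  have : (Real.pi : ℂ) ≠ 0 := by exact_mod_cast Real.pi_ne_zero
  field_simp

theorem lintegral_comp_neg_div (g : ℝ → ℝ≥0∞) :
    ∫⁻ t : ℝ, g (-(t / (2 * Real.pi))) = ENNReal.ofReal (2 * Real.pi) * ∫⁻ t, g t := by
  have hc : (-(1 / (2 * Real.pi))) ≠ 0 := by
    have := Real.pi_pos
    simp
  have h := lintegral_map_equiv (μ := volume) g (Homeomorph.mulLeft₀ _ hc).toMeasurableEquiv
  have h2 := Real.map_volume_mul_left hc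
  simp only [Homeomorph.toMeasurableEquiv_coe, Homeomorph.coe_mulLeft₀] at h
  rw [h2, lintegral_smul_measure] at h
  convert h.symm using 1
  · congr 1; funext t; congr 1; ring
  · rw [smul_eq_mul]
    congr 2
    rw [abs_of_neg (by rw [inv_lt_zero]; simp [Real.pi_pos])]
    field_simp

theorem lintegral_sq_integral_exp_eq {K : ℝ → ℂ} (hK : Integrable K) (hK2 : MemLp K 2) :
    ∫⁻ t : ℝ, ‖∫ τ : ℝ, K τ * Complex.exp (I * t * τ)‖ₑ ^ 2
      = ENNReal.ofReal (2 * Real.pi) * ∫⁻ τ, ‖K τ‖ₑ ^ 2 := by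
  simp_rw [integral_mul_exp_eq_fourier]
  rw [lintegral_comp_neg_div fun x => ‖𝓕 K x‖ₑ ^ 2, lintegral_sq_fourier_eq hK hK2]

theorem continuous_integral_mul_exp {K : ℝ → ℂ} (hK : Integrable K) :
    Continuous fun t : ℝ => ∫ τ : ℝ, K τ * Complex.exp (I * t * τ) := by
  simp_rw [integral_mul_exp_eq_fourier]
  have hcont : Continuous (𝓕 K) :=
    VectorFourier.fourierIntegral_continuous Real.continuous_fourierChar
      (by exact continuous_inner) hK
  exact hcont.comp (by fun_prop)

theorem integrable_mul_exp {K : ℝ → ℂ} (hK : Integrable K) (t : ℝ) :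
    Integrable fun τ : ℝ => K τ * Complex.exp (I * t * τ) := by
  refine hK.mul_bdd (c := 1) (by fun_prop) (Eventually.of_forall fun τ => ?_)
  have : (I * t * τ : ℂ) = ((t * τ : ℝ) : ℂ) * I := by push_cast; ring
  rw [this, Complex.norm_exp_ofReal_mul_I]

/-- The derivative of a function with integrable frequency function `F`, whose frequencies are
shifted by `c`, is bounded in `L²` by the weighted `L²` norm of `F`. -/
theorem lintegral_deriv_sq_le {F : ℝ → ℂ} (hF : Integrable F) (c T : ℝ) {p p' : ℝ → ℂ}
    (hp : ∀ t ∈ Icc 0 T, p t = Complex.exp (I * t * c) *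
      ((1 / (2 * Real.pi) : ℂ) * ∫ τ : ℝ, F τ * Complex.exp (I * t * τ)))
    (hd : ∀ t ∈ Ioo 0 T, HasDerivAt p (p' t) t) :
    ∫⁻ t in Ioc 0 T, ‖p' t‖ₑ ^ 2 ≤ ∫⁻ τ, (ENNReal.ofReal |τ + c| * ‖F τ‖ₑ) ^ 2 := by
  by_cases htop : ∫⁻ τ, (ENNReal.ofReal |τ + c| * ‖F τ‖ₑ) ^ 2 = ⊤
  · rw [htop]; exact le_top
  set G : ℝ → ℂ := fun t => Complex.exp (I * t * c) *
      ((1 / (2 * Real.pi) : ℂ) * ∫ τ : ℝ, F τ * Complex.exp (I * t * τ)) with hG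
  have hGc : Continuous G := by
    have := continuous_integral_mul_exp hF
    simp only [hG]; fun_prop
  have hGd : ∀ t ∈ Ioo 0 T, HasDerivAt G (p' t) t := fun t ht =>
    (hd t ht).congr_of_eventuallyEq (by
      filter_upwards [Ioo_mem_nhds ht.1 ht.2] with r hr using (hp r (Ioo_subset_Icc_self hr)).symm)
  -- Up to a unimodular factor and 1/(2π), `G (t + h) - G t` is the inverse transform of `K h`, and
  -- |e^{ix} - 1| ≤ |x| bounds `K h` by |h||τ + c||F|.
  set K : ℝ → ℝ → ℂ := fun h τ => F τ * (Complex.exp (I * ((h * (τ + c) : ℝ) : ℂ)) - 1) with hK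
  have hKle : ∀ h τ, ‖K h τ‖ₑ ^ 2 ≤
      ENNReal.ofReal (h ^ 2) * (ENNReal.ofReal |τ + c| * ‖F τ‖ₑ) ^ 2 := fun h τ => by
    have h1 : ‖Complex.exp (I * ((h * (τ + c) : ℝ) : ℂ)) - 1‖ₑ
        ≤ ENNReal.ofReal |h| * ENNReal.ofReal |τ + c| := by
      rw [← ENNReal.ofReal_mul (abs_nonneg _), ← abs_mul, ← ofReal_norm]
      exact ENNReal.ofReal_le_ofReal (Real.norm_exp_I_mul_ofReal_sub_one_le)
    rw [hK, enorm_mul, ← sq_abs h, ENNReal.ofReal_pow (abs_nonneg _), ← mul_pow]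
    refine pow_le_pow_left' ((mul_le_mul_right h1 _).trans (le_of_eq ?_)) 2
    ring
  have hKi : ∀ h, Integrable (K h) := fun h => by
    refine hF.mul_bdd (c := 2) (by fun_prop) (Eventually.of_forall fun τ => ?_)
    refine (norm_sub_le _ _).trans ?_
    rw [mul_comm I, Complex.norm_exp_ofReal_mul_I]
    norm_num
  have hKsq : ∀ h, ∫⁻ τ, ‖K h τ‖ₑ ^ 2 ≤ ENNReal.ofReal (h ^ 2) *
      ∫⁻ τ, (ENNReal.ofReal |τ + c| * ‖F τ‖ₑ) ^ 2 := fun h => by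
    rw [← lintegral_const_mul' _ _ ENNReal.ofReal_ne_top]
    exact lintegral_mono (hKle h)
  have hK2 : ∀ h, MemLp (K h) 2 := fun h => by
    refine ⟨(hKi h).aestronglyMeasurable, ?_⟩
    have : eLpNorm (K h) 2 volume ^ 2 < ⊤ := by
      rw [eLpNorm_two_sq]
      exact (hKsq h).trans_lt (ENNReal.mul_lt_top ENNReal.ofReal_lt_top (lt_top_iff_ne_top.2 htop))
    exact (ENNReal.pow_lt_top_iff.1 this).resolve_right (by norm_num)
  have hdiff : ∀ h t : ℝ, ‖G (t + h) - G t‖ₑ ^ 2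
      ≤ ENNReal.ofReal (1 / (2 * Real.pi)) *
        ‖∫ τ : ℝ, K h τ * Complex.exp (I * t * τ)‖ₑ ^ 2 := fun h t => by
    have e : G (t + h) - G t = Complex.exp (I * t * c) * ((1 / (2 * Real.pi) : ℂ) *
        ∫ τ : ℝ, K h τ * Complex.exp (I * t * τ)) := by
      have e1 : ∫ τ : ℝ, K h τ * Complex.exp (I * t * τ)
          = Complex.exp (I * h * c) * (∫ τ : ℝ, F τ * Complex.exp (I * (t + h : ℝ) * τ))
            - ∫ τ : ℝ, F τ * Complex.exp (I * t * τ) := by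
        rw [← integral_const_mul, ← integral_sub
          ((integrable_mul_exp hF _).const_mul _) (integrable_mul_exp hF _)]
        congr 1
        funext τ
        have : Complex.exp (I * ((h * (τ + c) : ℝ) : ℂ)) * Complex.exp (I * t * τ)
            = Complex.exp (I * h * c) * Complex.exp (I * (t + h : ℝ) * τ) := by
          rw [← Complex.exp_add, ← Complex.exp_add]
          congr 1; push_cast; ring
        simp only [hK]
        linear_combination F τ * this
      rw [e1]
      simp only [hG]
      have : Complex.exp (I * ((t + h : ℝ) : ℂ) * c)
          = Complex.exp (I * t * c) * Complex.exp (I * h * c) := by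
        rw [← Complex.exp_add]; congr 1; push_cast; ring
      rw [this]; ring
    have h1 : ‖Complex.exp (I * t * c)‖ₑ = 1 := by
      have : (I * t * c : ℂ) = ((t * c : ℝ) : ℂ) * I := by push_cast; ring
      rw [this, ← ofReal_norm, Complex.norm_exp_ofReal_mul_I, ENNReal.ofReal_one]
    -- One of the two factors 1/(2π) is discarded; the other cancels the 2π of Plancherel's theorem.
    have h2 : ‖(1 / (2 * Real.pi) : ℂ)‖ₑ ^ 2 ≤ ENNReal.ofReal (1 / (2 * Real.pi)) := by
      have e2 : (1 / (2 * Real.pi) : ℂ) = ((1 / (2 * Real.pi) : ℝ) : ℂ) := by push_cast; ring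
      have hpos : 0 < 1 / (2 * Real.pi) := by positivity
      rw [e2, ← ofReal_norm, ← ENNReal.ofReal_pow (norm_nonneg _), Complex.norm_real,
        Real.norm_of_nonneg hpos.le]
      apply ENNReal.ofReal_le_ofReal
      have : 1 / (2 * Real.pi) ≤ 1 := by
        rw [div_le_one (by positivity)]
        linarith [Real.pi_gt_three]
      nlinarith
    rw [e, enorm_mul, h1, one_mul, enorm_mul, mul_pow]
    gcongr
  -- Squared difference quotients with step 1/(k+1). Their integrals are bounded uniformly in k, and
  -- Fatou's lemma passes to the derivative.
  set q : ℕ → ℝ → ℝ≥0∞ := fun k t =>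
    ENNReal.ofReal ((k + 1 : ℝ) ^ 2) * ‖G (t + 1 / (k + 1)) - G t‖ₑ ^ 2 with hq
  have hqle : ∀ k, ∫⁻ t in Ioo 0 T, q k t ≤
      ∫⁻ τ, (ENNReal.ofReal |τ + c| * ‖F τ‖ₑ) ^ 2 := fun k => by
    calc ∫⁻ t in Ioo 0 T, q k t ≤ ∫⁻ t, q k t := setLIntegral_le_lintegral _ _
      _ ≤ ∫⁻ t : ℝ, ENNReal.ofReal ((k + 1 : ℝ) ^ 2) * (ENNReal.ofReal (1 / (2 * Real.pi)) *
            ‖∫ τ : ℝ, K (1 / (k + 1)) τ * Complex.exp (I * t * τ)‖ₑ ^ 2) :=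
          lintegral_mono fun t => mul_le_mul_right (hdiff _ _) _
      _ = ENNReal.ofReal ((k + 1 : ℝ) ^ 2) * (ENNReal.ofReal (1 / (2 * Real.pi)) *
            (ENNReal.ofReal (2 * Real.pi) * ∫⁻ τ, ‖K (1 / (k + 1)) τ‖ₑ ^ 2)) := by
          rw [lintegral_const_mul' _ _ ENNReal.ofReal_ne_top,
            lintegral_const_mul' _ _ ENNReal.ofReal_ne_top,
            lintegral_sq_integral_exp_eq (hKi _) (hK2 _)]
      _ = ENNReal.ofReal ((k + 1 : ℝ) ^ 2) * ∫⁻ τ, ‖K (1 / (k + 1)) τ‖ₑ ^ 2 := by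
          rw [← mul_assoc (ENNReal.ofReal (1 / _)), ← ENNReal.ofReal_mul (by positivity),
            one_div_mul_cancel (by positivity), ENNReal.ofReal_one, one_mul]
      _ ≤ ENNReal.ofReal ((k + 1 : ℝ) ^ 2) * (ENNReal.ofReal ((1 / (k + 1 : ℝ)) ^ 2) *
            ∫⁻ τ, (ENNReal.ofReal |τ + c| * ‖F τ‖ₑ) ^ 2) := mul_le_mul_right (hKsq _) _
      _ = _ := by
          rw [← mul_assoc, ← ENNReal.ofReal_mul (by positivity), ← mul_pow,
            mul_one_div_cancel (by positivity), one_pow, ENNReal.ofReal_one, one_mul]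
  have hqm : ∀ k, Measurable (q k) := fun k => by
    have h1 : Continuous fun t => G (t + 1 / (k + 1)) - G t := by fun_prop
    exact (h1.measurable.enorm.pow_const 2).const_mul _
  rw [← setLIntegral_congr Ioo_ae_eq_Ioc]
  calc ∫⁻ t in Ioo 0 T, ‖p' t‖ₑ ^ 2
      ≤ ∫⁻ t in Ioo 0 T, liminf (fun k => q k t) atTop := by
        refine setLIntegral_mono' measurableSet_Ioo fun t ht => le_of_eq ?_
        refine (Tendsto.liminf_eq ?_).symm
        have h1 := (hGd t ht).tendsto_slope_zero_right.comp
          (tendsto_nhdsWithin_iff.2 ⟨tendsto_one_div_add_atTop_nhds_zero_nat (𝕜 := ℝ),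
            Eventually.of_forall fun k => by simp only [mem_Ioi]; positivity⟩)
        have h2 := ((ENNReal.continuous_pow 2).comp continuous_enorm).tendsto (p' t) |>.comp h1
        refine h2.congr fun k => ?_
        simp only [Function.comp_apply, hq]
        rw [enorm_smul, mul_pow]
        congr 1
        rw [← ofReal_norm, ← ENNReal.ofReal_pow (norm_nonneg _)]
        simp
    _ ≤ liminf (fun k => ∫⁻ t in Ioo 0 T, q k t) atTop := lintegral_liminf_le hqm
    _ ≤ liminf (fun _ : ℕ => ∫⁻ τ, (ENNReal.ofReal |τ + c| * ‖F τ‖ₑ) ^ 2) atTop :=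
        liminf_le_liminf (Eventually.of_forall hqle)
    _ = _ := liminf_const _

/-- A continuous compactly supported function that is differentiable off a countable set, with
square-integrable derivative, is the inverse Fourier transform of an integrable function `F` with
`(1 + |τ|) F` square-integrable. -/
theorem exists_fourier_of_compactSupport {p h : ℝ → ℂ} {A B : ℝ} (hAB : A ≤ B) (hpc : Continuous p)
    (hp0 : ∀ t ∉ Ioo A B, p t = 0) (hh : Integrable h) (hh0 : ∀ t ∉ Ioo A B, h t = 0)
    (hh2 : MemLp h 2) {S : Set ℝ} (hS : S.Countable) (hd : ∀ t ∉ S, HasDerivAt p (h t) t) :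
    ∃ F : ℝ → ℂ, Integrable F ∧
      (∀ t : ℝ, p t = (1 / (2 * Real.pi) : ℂ) * ∫ τ : ℝ, F τ * Complex.exp (I * t * τ)) ∧
      ∫⁻ τ, (ENNReal.ofReal (1 + |τ|) * ‖F τ‖ₑ) ^ 2
        ≤ ENNReal.ofReal (4 * Real.pi) * ((∫⁻ t, ‖p t‖ₑ ^ 2) + ∫⁻ t, ‖h t‖ₑ ^ 2) := by
  have hcs : HasCompactSupport p := HasCompactSupport.intro isCompact_Icc fun t ht =>
    hp0 t fun h' => ht (Ioo_subset_Icc_self h')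
  have hpi : Integrable p := hpc.integrable_of_hasCompactSupport hcs
  have hp2 : MemLp p 2 := hpc.memLp_of_hasCompactSupport hcs
  set Ft : (ℝ → ℂ) → ℝ → ℂ := fun K τ => ∫ t : ℝ, K t * Complex.exp (I * τ * t) with hFt
  -- Integration by parts. The boundary terms vanish with `p`, and the countable exceptional set
  -- does not matter as `p` is continuous.
  have hrel : ∀ τ : ℝ, Ft h τ = -(I * τ) * Ft p τ := by
    intro τ
    have hz : ∀ K : ℝ → ℂ, (∀ t ∉ Ioo A B, K t = 0) →
        ∫ t : ℝ, K t = ∫ t in A..B, K t := fun K hK => by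
      rw [intervalIntegral.integral_of_le hAB, integral_Ioc_eq_integral_Ioo,
        setIntegral_eq_integral_of_forall_compl_eq_zero hK]
    have h1 := MeasureTheory.integral_eq_of_hasDerivAt_off_countable_of_le
      (fun t : ℝ => p t * Complex.exp (I * τ * t))
      (fun t : ℝ => h t * Complex.exp (I * τ * t) + p t * (Complex.exp (I * τ * t) * (I * τ)))
      hAB hS (by fun_prop) (fun t ht => by
        refine (hd t ht.2).mul ?_
        have := ((hasDerivAt_id (t : ℂ)).const_mul (I * τ)).cexp.comp_ofReal
        simpa using this)
      (((integrable_mul_exp hh τ).add (by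
        have := (integrable_mul_exp hpi τ).mul_const (I * τ)
        simpa [mul_assoc] using this)).intervalIntegrable)
    rw [← hz _ (fun t ht => by simp [hp0 t ht, hh0 t ht]), hp0 A (by simp), hp0 B (by simp),
      integral_add (integrable_mul_exp hh τ) (by
        have := (integrable_mul_exp hpi τ).mul_const (I * τ)
        simpa [mul_assoc] using this)] at h1
    simp_rw [← mul_assoc (p _)] at h1
    rw [integral_mul_const] at h1
    simp only [hFt]
    linear_combination h1
  set F : ℝ → ℂ := fun τ => Ft p (-τ) with hF
  have hneg : ∀ g : ℝ → ℝ≥0∞, ∫⁻ τ, g (-τ) = ∫⁻ τ, g τ := fun g => lintegral_neg_eq_self g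
  have e0 : ∫⁻ τ, ‖F τ‖ₑ ^ 2 = ENNReal.ofReal (2 * Real.pi) * ∫⁻ t, ‖p t‖ₑ ^ 2 := by
    rw [← lintegral_sq_integral_exp_eq hpi hp2, ← hneg]
    simp [hF, hFt]
  have e1 : ∫⁻ τ, (ENNReal.ofReal |τ| * ‖F τ‖ₑ) ^ 2
      = ENNReal.ofReal (2 * Real.pi) * ∫⁻ t, ‖h t‖ₑ ^ 2 := by
    rw [← lintegral_sq_integral_exp_eq hh hh2, ← hneg]
    congr 1; funext τ
    change _ = ‖Ft h τ‖ₑ ^ 2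
    rw [hrel, enorm_mul, enorm_neg, enorm_mul]
    congr 2
    · rw [← ofReal_norm I, ← ofReal_norm (τ : ℂ)]; simp
    · simp [hF]
  have hFc : Continuous F := (continuous_integral_mul_exp hpi).comp continuous_neg
  have hsq : ∫⁻ τ, (ENNReal.ofReal (1 + |τ|) * ‖F τ‖ₑ) ^ 2
      ≤ ENNReal.ofReal (4 * Real.pi) * ((∫⁻ t, ‖p t‖ₑ ^ 2) + ∫⁻ t, ‖h t‖ₑ ^ 2) := by
    calc _ ≤ ∫⁻ τ, (2 * ‖F τ‖ₑ ^ 2 + 2 * (ENNReal.ofReal |τ| * ‖F τ‖ₑ) ^ 2) := by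
          refine lintegral_mono fun τ => ?_
          rw [ENNReal.ofReal_add zero_le_one (abs_nonneg _), ENNReal.ofReal_one, add_mul, one_mul]
          exact ENNReal.add_sq_le _ _
      _ = _ := by
          have e4 : ENNReal.ofReal (4 * Real.pi) = 2 * ENNReal.ofReal (2 * Real.pi) := by
            rw [show 4 * Real.pi = 2 * (2 * Real.pi) by ring, ENNReal.ofReal_mul zero_le_two,
              ENNReal.ofReal_ofNat]
          rw [lintegral_add_left (by fun_prop), lintegral_const_mul' _ _ (by norm_num),
            lintegral_const_mul' _ _ (by norm_num), e0, e1, e4]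
          ring
  have hfin : ∫⁻ τ, (ENNReal.ofReal (1 + |τ|) * ‖F τ‖ₑ) ^ 2 < ⊤ := by
    refine hsq.trans_lt (ENNReal.mul_lt_top ENNReal.ofReal_lt_top (ENNReal.add_lt_top.2 ⟨?_, ?_⟩))
    · rw [← eLpNorm_two_sq]; exact ENNReal.pow_lt_top hp2.2
    · rw [← eLpNorm_two_sq]; exact ENNReal.pow_lt_top hh2.2
  -- (1 + |τ|)⁻¹ is square-integrable on the line, so Cauchy–Schwarz makes `F` integrable.
  have hFi : Integrable F := by
    have m1 : MemLp (fun τ : ℝ => ((1 + |τ| : ℝ) : ℂ) * F τ) 2 := by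
      refine ⟨by fun_prop, ?_⟩
      have : eLpNorm (fun τ : ℝ => ((1 + |τ| : ℝ) : ℂ) * F τ) 2 volume ^ 2 < ⊤ := by
        rw [eLpNorm_two_sq]
        refine lt_of_eq_of_lt (lintegral_congr fun τ => ?_) hfin
        rw [enorm_mul, ← ofReal_norm, Complex.norm_real, Real.norm_of_nonneg (by positivity)]
      exact (ENNReal.pow_lt_top_iff.1 this).resolve_right (by norm_num)
    have m2 : MemLp (fun τ : ℝ => (((1 + |τ|)⁻¹ : ℝ) : ℂ)) 2 := by
      have hc : Continuous fun τ : ℝ => (((1 + |τ|)⁻¹ : ℝ) : ℂ) := by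
        refine Complex.continuous_ofReal.comp (Continuous.inv₀ (by fun_prop) fun τ => ?_)
        positivity
      rw [memLp_two_iff_integrable_sq_norm hc.aestronglyMeasurable]
      refine integrable_inv_one_add_sq.mono' (by fun_prop) (Eventually.of_forall fun τ => ?_)
      rw [Complex.norm_real, norm_pow, norm_norm, norm_inv, Real.norm_of_nonneg (by positivity),
        inv_pow]
      refine inv_anti₀ (by positivity) ?_
      rw [← sq_abs τ]
      nlinarith [abs_nonneg τ]
    refine (m2.integrable_mul m1).congr (Eventually.of_forall fun τ => ?_)
    simp only [Pi.mul_apply]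
    rw [← mul_assoc, ← Complex.ofReal_mul, inv_mul_cancel₀ (by positivity), Complex.ofReal_one,
      one_mul]
  refine ⟨F, hFi, fun t => ?_, hsq⟩
  have hF𝓕 : ∀ τ, F τ = 𝓕 p (τ / (2 * Real.pi)) := fun τ => by
    simp only [hF, hFt]
    rw [integral_mul_exp_eq_fourier, neg_div, neg_neg]
  have hpi0 : (2 * Real.pi) ≠ 0 := by positivity
  have h𝓕i : Integrable (𝓕 p) := by
    have := hFi.comp_mul_left' hpi0
    refine this.congr (Eventually.of_forall fun ξ => ?_)
    simp only [hF𝓕]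
    field_simp
  have hinv := congrFun (hpc.fourierInv_fourier_eq hpi h𝓕i) t
  rw [Real.fourierInv_eq'] at hinv
  rw [← hinv]
  have := Measure.integral_comp_div (fun ξ : ℝ => Complex.exp (((2 * Real.pi * inner ℝ ξ t : ℝ) : ℂ)
    * I) • 𝓕 p ξ) (2 * Real.pi)
  rw [abs_of_pos (by positivity)] at this
  have e2 : ∀ τ : ℝ, Complex.exp (((2 * Real.pi * inner ℝ (τ / (2 * Real.pi)) t : ℝ) : ℂ) * I) •
      𝓕 p (τ / (2 * Real.pi)) = F τ * Complex.exp (I * t * τ) := fun τ => by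
    rw [← hF𝓕, smul_eq_mul, mul_comm]
    congr 2
    simp only [RCLike.inner_apply, conj_trivial]
    have : 2 * Real.pi * (t * (τ / (2 * Real.pi))) = t * τ := by field_simp
    rw [this]
    push_cast
    ring
  simp_rw [e2] at this
  rw [this, real_smul, ← mul_assoc]
  have : (1 / (2 * Real.pi) : ℂ) * ((2 * Real.pi : ℝ) : ℂ) = 1 := by
    push_cast
    have : (Real.pi : ℂ) ≠ 0 := by exact_mod_cast Real.pi_ne_zero
    field_simp
  rw [this, one_mul]

/-- Every curve on `[0, T]` with continuous derivative is, up to a fixed cut-off function, the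
inverse Fourier transform of a function `F` whose weighted norm is controlled by the curve and its
derivative in `L²`. -/
theorem exists_fourier_extension {T : ℝ} (hT : 0 < T) : ∃ η : ℝ → ℝ, (∀ t ∈ Icc 0 T, η t = 1) ∧
    ∃ C : ℝ≥0∞, C ≠ ⊤ ∧ ∀ (a : ℂ) (g : ℝ → ℂ), Continuous g → ∃ F : ℝ → ℂ, Integrable F ∧
      (∀ t : ℝ, η t * pathOf a ((Ioc 0 T).indicator g) t
        = (1 / (2 * Real.pi) : ℂ) * ∫ τ : ℝ, F τ * Complex.exp (I * t * τ)) ∧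
      ∫⁻ τ, (ENNReal.ofReal (1 + |τ|) * ‖F τ‖ₑ) ^ 2
        ≤ C * ((∫⁻ t in Ioo (-2) (T + 2), ‖pathOf a ((Ioc 0 T).indicator g) t‖ₑ ^ 2)
          + ∫⁻ t in Ioc 0 T, ‖g t‖ₑ ^ 2) := by
  -- The cut-off equals 1 on [0, T] and vanishes outside [-1, T + 1], hence outside (-2, T + 2).
  let b : ContDiffBump (T / 2 : ℝ) := ⟨T / 2, T / 2 + 1, by linarith, by linarith⟩
  have hbsm : ContDiff ℝ 1 b := b.contDiff
  have hball : ∀ t, t ∉ Ioo (-2) (T + 2) → t ∉ Metric.closedBall (T / 2) (T / 2 + 1) := by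
    intro t ht h
    rw [Real.closedBall_eq_Icc] at h
    exact ht ⟨by linarith [h.1], by linarith [h.2]⟩
  have hη0 : ∀ t ∉ Ioo (-2) (T + 2), b t = 0 := fun t ht =>
    image_eq_zero_of_notMem_tsupport (by rw [b.tsupport_eq]; exact hball t ht)
  have hη'0 : ∀ t ∉ Ioo (-2) (T + 2), deriv b t = 0 := fun t ht => by
    have h1 : t ∉ tsupport b := by rw [b.tsupport_eq]; exact hball t ht
    exact Function.notMem_support.1 fun h2 => h1 (support_deriv_subset h2)
  have hη'c : Continuous (deriv b) := hbsm.continuous_deriv le_rfl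
  have hcsupp : ∀ f : ℝ → ℂ, (∀ t ∉ Ioo (-2) (T + 2), f t = 0) → HasCompactSupport f :=
    fun f hf => HasCompactSupport.intro (isCompact_Icc (a := -2) (b := T + 2)) fun t ht =>
      hf t fun h' => ht (Ioo_subset_Icc_self h')
  obtain ⟨D, hD⟩ : ∃ D : ℝ, ∀ t, ‖deriv b t‖ ≤ D :=
    (b.hasCompactSupport.deriv).exists_bound_of_continuous hη'c
  refine ⟨b, fun t ht => b.one_of_mem_closedBall ?_, ENNReal.ofReal (4 * Real.pi) *
    (2 + 2 * ENNReal.ofReal (D ^ 2)), by finiteness, fun a g hg => ?_⟩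
  · rw [Real.closedBall_eq_Icc]
    change t ∈ Icc (T / 2 - T / 2) (T / 2 + T / 2)
    exact ⟨by linarith [ht.1], by linarith [ht.2]⟩
  set f := (Ioc 0 T).indicator g with hf
  have hfi : Integrable f := (integrable_indicator_iff measurableSet_Ioc).2 hg.integrableOn_Ioc
  set p := pathOf a f with hp
  have hpc : Continuous p := continuous_pathOf fun _ _ => hfi.intervalIntegrable
  have hbc : Continuous b := hbsm.continuous
  set h₁ : ℝ → ℂ := fun t => ((deriv (b : ℝ → ℝ) t : ℝ) : ℂ) * p t with hh₁
  set h₂ : ℝ → ℂ := (Ioc 0 T).indicator fun t => (b t : ℂ) * g t with hh₂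
  have c1 : Continuous h₁ := by fun_prop
  have c2 : Continuous fun t => (b t : ℂ) * g t := by fun_prop
  have s1 := hcsupp h₁ fun t ht => by simp [hh₁, hη'0 t ht]
  have s2 := hcsupp (fun t => (b t : ℂ) * g t) fun t ht => by simp [hη0 t ht]
  have i2 : Integrable h₂ := (c2.integrable_of_hasCompactSupport s2).indicator measurableSet_Ioc
  have m2 : MemLp h₂ 2 := (c2.memLp_of_hasCompactSupport s2).indicator measurableSet_Ioc
  -- The derivative of the extended curve may jump at 0 and T, because the curve is continued by
  -- constants.
  have hd : ∀ t ∉ ({0, T} : Set ℝ), HasDerivAt (fun t => (b t : ℂ) * p t) ((h₁ + h₂) t) t := by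
    intro t ht
    simp only [mem_insert_iff, mem_singleton_iff, not_or] at ht
    have hfc : ContinuousAt f t := by
      rcases lt_or_ge t 0 with h0 | h0
      · refine (continuousAt_const (y := (0 : ℂ))).congr ?_
        filter_upwards [Iio_mem_nhds h0] with r hr
        rw [hf, indicator_of_notMem fun h' => absurd h'.1 (not_lt.2 (le_of_lt hr))]
      rcases lt_or_ge T t with h1 | h1
      · refine (continuousAt_const (y := (0 : ℂ))).congr ?_
        filter_upwards [Ioi_mem_nhds h1] with r hr
        rw [hf, indicator_of_notMem fun h' => absurd h'.2 (not_le.2 hr)]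
      · refine hg.continuousAt.congr ?_
        filter_upwards [Ioo_mem_nhds (lt_of_le_of_ne h0 (Ne.symm ht.1)) (lt_of_le_of_ne h1 ht.2)]
          with r hr
        rw [hf, indicator_of_mem (Ioo_subset_Ioc_self hr)]
    have hpd : HasDerivAt p (f t) t :=
      (intervalIntegral.integral_hasDerivAt_right hfi.intervalIntegrable
        (hfi.aestronglyMeasurable.stronglyMeasurableAtFilter) hfc).const_add a
    have hbd : HasDerivAt (fun t => (b t : ℂ)) ((deriv (b : ℝ → ℝ) t : ℝ) : ℂ) t :=
      ((hbsm.differentiable one_ne_zero) t).hasDerivAt.ofReal_comp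
    have := hbd.mul hpd
    refine this.congr_deriv ?_
    rw [Pi.add_apply]
    refine congrArg (h₁ t + ·) ?_
    rw [hf, hh₂]
    by_cases hm : t ∈ Ioc 0 T
    · rw [indicator_of_mem hm, indicator_of_mem hm]
    · rw [indicator_of_notMem hm, indicator_of_notMem hm, mul_zero]
  obtain ⟨F, hFi, hFeq, hFle⟩ := exists_fourier_of_compactSupport (A := -2) (B := T + 2)
    (p := fun t => (b t : ℂ) * p t) (h := h₁ + h₂) (by linarith) (by fun_prop)
    (fun t ht => by simp [hη0 t ht]) ((c1.integrable_of_hasCompactSupport s1).add i2)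
    (fun t ht => by
      have : t ∉ Ioc 0 T := fun h' => ht ⟨by linarith [h'.1], by linarith [h'.2]⟩
      simp [hh₁, hh₂, hη'0 t ht, indicator_of_notMem this])
    ((c1.memLp_of_hasCompactSupport s1).add m2) (Set.toFinite {0, T}).countable hd
  refine ⟨F, hFi, hFeq, hFle.trans ?_⟩
  rw [mul_assoc]
  refine mul_le_mul_right ?_ _
  have hb1 : ∀ t, ‖(b t : ℂ)‖ₑ ≤ 1 := fun t => by
    rw [← ofReal_norm, ENNReal.ofReal_le_one, Complex.norm_real, Real.norm_of_nonneg b.nonneg]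
    exact b.le_one
  have hb2 : ∀ t, ‖((deriv (b : ℝ → ℝ) t : ℝ) : ℂ)‖ₑ ^ 2 ≤ ENNReal.ofReal (D ^ 2) := fun t => by
    rw [← ofReal_norm, Complex.norm_real, ← ENNReal.ofReal_pow (norm_nonneg _)]
    exact ENNReal.ofReal_le_ofReal (pow_le_pow_left₀ (norm_nonneg _) (hD t) 2)
  have hset : ∀ (f : ℝ → ℂ) (S : Set ℝ), MeasurableSet S → (∀ t ∉ S, f t = 0) →
      ∫⁻ t, ‖f t‖ₑ ^ 2 = ∫⁻ t in S, ‖f t‖ₑ ^ 2 := fun f S hS hf => by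
    rw [setLIntegral_eq_of_support_subset]
    intro t ht
    by_contra hn
    simp [hf t hn] at ht
  have e1 : ∫⁻ t, ‖(b t : ℂ) * p t‖ₑ ^ 2 ≤ ∫⁻ t in Ioo (-2) (T + 2), ‖p t‖ₑ ^ 2 := by
    rw [hset _ (Ioo (-2) (T + 2)) measurableSet_Ioo fun t ht => by simp [hη0 t ht]]
    refine lintegral_mono fun t => pow_le_pow_left' ?_ 2
    rw [enorm_mul]
    exact mul_le_of_le_one_left' (hb1 t)
  have e2 : ∫⁻ t, ‖h₁ t‖ₑ ^ 2
      ≤ ENNReal.ofReal (D ^ 2) * ∫⁻ t in Ioo (-2) (T + 2), ‖p t‖ₑ ^ 2 := by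
    rw [hset _ (Ioo (-2) (T + 2)) measurableSet_Ioo fun t ht => by simp [hh₁, hη'0 t ht],
      ← lintegral_const_mul' _ _ ENNReal.ofReal_ne_top]
    refine lintegral_mono fun t => ?_
    rw [hh₁, enorm_mul, mul_pow]
    exact mul_le_mul_left (hb2 t) _
  have e3 : ∫⁻ t, ‖h₂ t‖ₑ ^ 2 ≤ ∫⁻ t in Ioc 0 T, ‖g t‖ₑ ^ 2 := by
    rw [hset _ (Ioc 0 T) measurableSet_Ioc fun t ht => by simp [hh₂, indicator_of_notMem ht]]
    refine setLIntegral_mono' measurableSet_Ioc fun t ht => pow_le_pow_left' ?_ 2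
    rw [hh₂, indicator_of_mem ht, enorm_mul]
    exact mul_le_of_le_one_left' (hb1 t)
  have e4 : ∫⁻ t, ‖(h₁ + h₂) t‖ₑ ^ 2 ≤ 2 * (∫⁻ t, ‖h₁ t‖ₑ ^ 2) + 2 * ∫⁻ t, ‖h₂ t‖ₑ ^ 2 := by
    have hm : Measurable fun t => 2 * ‖h₁ t‖ₑ ^ 2 := by fun_prop
    rw [← lintegral_const_mul' _ _ (by norm_num), ← lintegral_const_mul' _ _ (by norm_num),
      ← lintegral_add_left hm]
    exact lintegral_mono fun t =>
      (pow_le_pow_left' (enorm_add_le _ _) 2).trans (ENNReal.add_sq_le _ _)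
  set X := ∫⁻ t in Ioo (-2) (T + 2), ‖p t‖ₑ ^ 2
  set Y := ∫⁻ t in Ioc 0 T, ‖g t‖ₑ ^ 2
  set d := ENNReal.ofReal (D ^ 2)
  calc _ ≤ X + (2 * (d * X) + 2 * Y) :=
        add_le_add e1 (e4.trans (add_le_add (mul_le_mul_right e2 _) (mul_le_mul_right e3 _)))
    _ ≤ (X + (2 * (d * X) + 2 * Y)) + (X + 2 * d * Y) := le_self_add
    _ = _ := by ring

end Plancherel

/-! ### Fourier series of test functions and periodic distributions -/

section PeriodicDistributions

variable {L : ℝ}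

namespace PerTest

theorem summable_inv_sq : Summable fun n : ℤ => ((1 + |(n : ℝ)|) ^ 2)⁻¹ := by
  refine Summable.of_norm_bounded_eventually
    (g := fun n : ℤ => |(n : ℝ)| ^ (-2 : ℝ)) (Real.summable_abs_int_rpow (by norm_num)) ?_
  filter_upwards [(Set.finite_singleton (0 : ℤ)).compl_mem_cofinite] with n hn
  have hn' : 0 < |(n : ℝ)| := abs_pos.2 (by exact_mod_cast hn)
  rw [Real.norm_of_nonneg (by positivity), Real.rpow_neg hn'.le, Real.rpow_two]
  gcongr
  linarith

/-- The wave number `2πi n / L`. -/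
def waveNumber (L : ℝ) (n : ℤ) : ℂ := 2 * Real.pi * I * n / L

theorem waveNumber_neg (n : ℤ) : waveNumber L (-n) = -waveNumber L n := by
  simp [waveNumber, neg_div]

theorem iteratedDeriv_eq (φ : PerTest L) (k : ℕ) :
    iteratedDeriv k φ.1 = ((PerTest.deriv L)^[k] φ).1 := by
  induction k with
  | zero => simp
  | succ k ih => rw [iteratedDeriv_succ, ih, Function.iterate_succ_apply']; rfl

theorem iterate_deriv_sub (k : ℕ) (φ ψ : PerTest L) :
    (PerTest.deriv L)^[k] (φ - ψ) = (PerTest.deriv L)^[k] φ - (PerTest.deriv L)^[k] ψ := by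
  simp only [← Module.End.pow_apply, map_sub]

/-- A test function as a continuous function on the circle. -/
def toCircle (φ : PerTest L) : C(AddCircle L, ℂ) :=
  ⟨φ.2.2.lift, continuous_coinduced_dom.mpr φ.2.1.continuous⟩

theorem toCircle_coe (φ : PerTest L) (x : ℝ) : toCircle φ x = φ.1 x := rfl

variable [hL : Fact (0 < L)]

theorem exp_coe (n : ℤ) (x : ℝ) : (exp L n).1 x = fourier n (x : AddCircle L) := by
  rw [fourier_coe_apply]
  change Complex.exp _ = _
  congr 1
  ring

theorem norm_waveNumber (n : ℤ) : ‖waveNumber L n‖ = 2 * Real.pi / L * |(n : ℝ)| := by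
  rw [waveNumber]
  simp only [norm_div, norm_mul, Complex.norm_real, norm_I, RCLike.norm_ofNat,
    Complex.norm_intCast, Real.norm_of_nonneg Real.pi_pos.le, Real.norm_of_nonneg hL.out.le]
  ring

theorem hasDerivAt_exp (n : ℤ) (x : ℝ) :
    HasDerivAt (exp L n).1 (waveNumber L n * (exp L n).1 x) x := by
  have h1 : HasDerivAt (fun x : ℝ => 2 * Real.pi * I * n / L * (x : ℂ)) (waveNumber L n) x := by
    simpa [waveNumber] using (Complex.ofRealCLM.hasDerivAt (x := x)).const_mul
      (2 * Real.pi * I * n / L : ℂ)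
  rw [mul_comm]
  exact h1.cexp

theorem deriv_expFun (n : ℤ) : PerTest.deriv L (exp L n) = waveNumber L n • exp L n := by
  ext x
  exact (hasDerivAt_exp n x).deriv

/-- The Fourier coefficients of a test function. -/
def fc (φ : PerTest L) (n : ℤ) : ℂ := fourierCoeff (toCircle φ) n

theorem fc_eq_integral (φ : PerTest L) (n : ℤ) :
    fc φ n = (1 / L : ℂ) * ∫ x in (0 : ℝ)..L, (exp L (-n)).1 x * φ.1 x := by
  rw [fc, fourierCoeff_eq_intervalIntegral _ n 0, zero_add, real_smul]
  push_cast
  congr 1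
  refine intervalIntegral.integral_congr fun x _ => ?_
  simp only [smul_eq_mul, toCircle_coe, exp_coe]

theorem fc_deriv (φ : PerTest L) (n : ℤ) :
    fc (PerTest.deriv L φ) n = waveNumber L n * fc φ n := by
  have hφ : ∀ x, HasDerivAt φ.1 ((PerTest.deriv L φ).1 x) x := fun x =>
    (φ.2.1.differentiable (by simp) x).hasDerivAt
  have hc : ∀ ψ : PerTest L, Continuous ψ.1 := fun ψ => ψ.2.1.continuous
  have i1 : IntervalIntegrable (fun x => waveNumber L (-n) * (exp L (-n)).1 x * φ.1 x) volume 0 L :=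
    (((hc _).const_mul _).mul (hc φ)).intervalIntegrable 0 L
  have i2 : IntervalIntegrable (fun x => (exp L (-n)).1 x * (PerTest.deriv L φ).1 x) volume 0 L :=
    ((hc _).mul (hc _)).intervalIntegrable 0 L
  have h0 := intervalIntegral.integral_eq_sub_of_hasDerivAt (a := 0) (b := L)
    (fun x _ => (hasDerivAt_exp (L := L) (-n) x).mul (hφ x))
    (i1.add i2)
  have hp : ∀ ψ : PerTest L, ψ.1 L = ψ.1 0 := fun ψ => by simpa using ψ.2.2 0
  simp only [Pi.mul_apply, hp, sub_self] at h0
  rw [intervalIntegral.integral_add i1 i2] at h0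
  simp_rw [mul_assoc (waveNumber L (-n))] at h0
  rw [intervalIntegral.integral_const_mul] at h0
  rw [fc_eq_integral, fc_eq_integral]
  rw [waveNumber_neg] at h0
  linear_combination (1 / L : ℂ) * h0

theorem fc_iterate_deriv (φ : PerTest L) (k : ℕ) (n : ℤ) :
    fc ((PerTest.deriv L)^[k] φ) n = waveNumber L n ^ k * fc φ n := by
  induction k with
  | zero => simp
  | succ k ih => rw [Function.iterate_succ_apply', fc_deriv, ih, pow_succ]; ring

theorem norm_fc_le (φ : PerTest L) : ∃ M : ℝ, ∀ n, ‖fc φ n‖ ≤ M := by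
  refine ⟨‖toCircle φ‖, fun n => ?_⟩
  rw [fc, fourierCoeff]
  refine (norm_integral_le_of_norm_le_const (C := ‖toCircle φ‖)
    (Eventually.of_forall fun x => ?_)).trans (by simp)
  rw [norm_smul, fourier_apply, Circle.norm_coe, one_mul]
  exact (toCircle φ).norm_coe_le_norm x

/-- The coefficients of φ and of its derivative of order N + 2 are bounded, so those of φ decay like
|n|^{-(N+2)}; the two extra powers make the series converge. -/
theorem summable_pow_mul_fc (φ : PerTest L) (N : ℕ) :
    Summable fun n : ℤ => (1 + |(n : ℝ)|) ^ N * ‖fc φ n‖ := by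
  obtain ⟨M, hM⟩ := norm_fc_le φ
  obtain ⟨M', hM'⟩ := norm_fc_le ((PerTest.deriv L)^[N + 2] φ)
  have hLpos := hL.out
  set κ := 2 * Real.pi / L with hκ
  have hκpos : 0 < κ := by positivity
  have key : ∀ n : ℤ, (1 + |(n : ℝ)|) ^ (N + 2) * ‖fc φ n‖
      ≤ 2 ^ (N + 2) * (M + M' / κ ^ (N + 2)) := by
    intro n
    have h1 := hM' n
    rw [fc_iterate_deriv, norm_mul, norm_pow] at h1
    rw [norm_waveNumber, mul_pow] at h1
    have h3 : |(n : ℝ)| ^ (N + 2) * ‖fc φ n‖ ≤ M' / κ ^ (N + 2) := by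
      rw [le_div_iff₀ (by positivity)]
      linarith
    have h4 : (1 + |(n : ℝ)|) ^ (N + 2) ≤ 2 ^ (N + 2) * (1 + |(n : ℝ)| ^ (N + 2)) := by
      have h5 : 1 + |(n : ℝ)| ≤ 2 * max 1 |(n : ℝ)| := by
        linarith [le_max_left 1 |(n : ℝ)|, le_max_right 1 |(n : ℝ)|]
      calc _ ≤ (2 * max 1 |(n : ℝ)|) ^ (N + 2) := by gcongr
        _ ≤ _ := by
          rw [mul_pow]
          gcongr
          rcases max_cases 1 |(n : ℝ)| with h | h <;> rw [h.1]
          · rw [one_pow]; linarith [pow_nonneg (abs_nonneg (n : ℝ)) (N + 2)]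
          · linarith
    calc _ ≤ 2 ^ (N + 2) * (1 + |(n : ℝ)| ^ (N + 2)) * ‖fc φ n‖ := by gcongr
      _ = 2 ^ (N + 2) * (‖fc φ n‖ + |(n : ℝ)| ^ (N + 2) * ‖fc φ n‖) := by ring
      _ ≤ _ := by gcongr; exact hM n
  refine Summable.of_nonneg_of_le (fun n => by positivity) (fun n => ?_)
    (summable_inv_sq.mul_left (2 ^ (N + 2) * (M + M' / κ ^ (N + 2))))
  rw [← div_eq_mul_inv, le_div_iff₀ (by positivity)]
  refine le_trans (le_of_eq ?_) (key n)
  ring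

theorem summable_fc (φ : PerTest L) : Summable (fc φ) :=
  Summable.of_norm (by simpa using summable_pow_mul_fc φ 0)

theorem iterate_deriv_exp (k : ℕ) (n : ℤ) :
    (PerTest.deriv L)^[k] (exp L n) = waveNumber L n ^ k • exp L n := by
  induction k with
  | zero => simp
  | succ k ih =>
    rw [Function.iterate_succ_apply', ih, map_smul, deriv_expFun, smul_smul, pow_succ]

theorem iterate_deriv_sum (k : ℕ) (S : Finset ℤ) (c : ℤ → ℂ) :
    (PerTest.deriv L)^[k] (∑ n ∈ S, c n • exp L n) = ∑ n ∈ S, (waveNumber L n ^ k * c n) •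
      exp L n := by
  rw [← Module.End.pow_apply, map_sum]
  refine Finset.sum_congr rfl fun n _ => ?_
  rw [map_smul, Module.End.pow_apply, iterate_deriv_exp, smul_smul, mul_comm]

end PerTest

namespace PerDist

variable [hL : Fact (0 < L)]

open PerTest

theorem eval_exp (D : PerDist L) (n : ℤ) : D.1 (exp L n) = L * D.coeff (-n) := by
  have : (L : ℂ) ≠ 0 := by exact_mod_cast hL.out.ne'
  rw [coeff, neg_neg]
  field_simp

/-- A periodic distribution is evaluated through the Fourier series of the test function. -/
theorem hasSum_coeff (D : PerDist L) (φ : PerTest L) :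
    HasSum (fun n => fc φ n * (L * D.coeff (-n))) (D.1 φ) := by
  obtain ⟨C, N, hC⟩ := D.2
  have hC' : ∀ φ : PerTest L, ∀ M : ℝ, (∀ k ≤ N, ∀ x : ℝ, ‖iteratedDeriv k φ.1 x‖ ≤ M) →
      ‖D.1 φ‖ ≤ |C| * M := fun φ M hM => by
    have hM0 : 0 ≤ M := (norm_nonneg _).trans (hM 0 (Nat.zero_le _) 0)
    exact (hC φ M hM).trans (mul_le_mul_of_nonneg_right (le_abs_self C) hM0)
  rw [HasSum, Metric.tendsto_nhds]
  intro ε hε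
  set δ := ε / (|C| + 1) / 2 with hδ
  have hCpos : 0 < |C| + 1 := by positivity
  have hδpos : 0 < δ := by positivity
  -- The Fourier series of φ converges uniformly together with its derivatives up to the order N
  -- that controls the distribution.
  have h1 : ∀ k ∈ Finset.range (N + 1), ∀ᶠ S : Finset ℤ in (SummationFilter.unconditional ℤ).filter,
      ∀ x : ℝ, ‖iteratedDeriv k (φ - ∑ n ∈ S, fc φ n • exp L n).1 x‖ ≤ δ := by
    intro k _
    have h2 := hasSum_fourier_series_of_summable (summable_fc ((PerTest.deriv L)^[k] φ))
    rw [HasSum, Metric.tendsto_nhds] at h2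
    filter_upwards [h2 δ hδpos] with S hS x
    rw [iteratedDeriv_eq, iterate_deriv_sub, iterate_deriv_sum]
    rw [dist_comm, dist_eq_norm] at hS
    refine le_trans (le_of_eq ?_) ((ContinuousMap.norm_coe_le_norm _ (x : AddCircle L)).trans hS.le)
    congr 1
    rw [ContinuousMap.sub_apply, toCircle_coe, ContinuousMap.sum_apply]
    simp only [AddSubgroupClass.coe_sub, AddSubmonoidClass.coe_finsetSum, Pi.sub_apply,
      Finset.sum_apply, SetLike.val_smul, Pi.smul_apply, ContinuousMap.smul_apply, exp_coe]
    congr 1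
    refine Finset.sum_congr rfl fun n _ => ?_
    rw [← fc_iterate_deriv]
    rfl
  rw [← Filter.eventually_all_finset] at h1
  filter_upwards [h1] with S hS
  have h3 := hC' (φ - ∑ n ∈ S, fc φ n • exp L n) δ fun k hk => hS k (by simpa using by omega)
  rw [map_sub, map_sum] at h3
  simp only [map_smul, smul_eq_mul, eval_exp] at h3
  rw [dist_comm, dist_eq_norm]
  refine h3.trans_lt ?_
  have : |C| * δ ≤ (|C| + 1) * δ := by gcongr; linarith
  refine this.trans_lt ?_
  rw [hδ]
  field_simp
  linarith

theorem ext_coeff {D E : PerDist L} (h : ∀ n, D.coeff n = E.coeff n) : D = E := by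
  refine Subtype.ext (LinearMap.ext fun φ => (D.hasSum_coeff φ).unique ?_)
  simp only [h]
  exact E.hasSum_coeff φ

theorem coeff_add (D E : PerDist L) (n : ℤ) : (D + E).coeff n = D.coeff n + E.coeff n :=
  mul_add _ _ _

theorem coeff_sub (D E : PerDist L) (n : ℤ) : (D - E).coeff n = D.coeff n - E.coeff n :=
  mul_sub _ _ _

theorem coeff_smul (c : ℂ) (D : PerDist L) (n : ℤ) : (c • D).coeff n = c * D.coeff n :=
  mul_left_comm _ _ _

theorem coeff_dx (D : PerDist L) (n : ℤ) : D.dx.coeff n = waveNumber L n * D.coeff n := by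
  have h : D.dx.1 (exp L (-n)) = -D.1 (PerTest.deriv L (exp L (-n))) := rfl
  rw [coeff, h, deriv_expFun, map_smul, coeff]
  rw [waveNumber_neg, smul_eq_mul]
  ring

/-- A distribution is real-valued if and only if its coefficients are conjugate symmetric. -/
theorem isReal_iff (D : PerDist L) :
    D.IsReal ↔ ∀ n, D.coeff (-n) = (starRingEnd ℂ) (D.coeff n) := by
  have hexp : ∀ (n : ℤ) (x : ℝ), (exp L (-n)).1 x = (starRingEnd ℂ) ((exp L n).1 x) :=
    fun n x => by rw [exp_coe, exp_coe, fourier_neg]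
  have hLc : (L : ℂ) ≠ 0 := by exact_mod_cast hL.out.ne'
  constructor
  · intro h n
    -- The real test functions e_n + e_{-n} and i(e_n - e_{-n}) give the imaginary and real parts of
    -- the symmetry relation.
    have h1 := h (exp L n + exp L (-n)) fun x => by
      change ((exp L n).1 x + (exp L (-n)).1 x).im = 0
      rw [hexp]; simp
    have h2 := h (I • (exp L n - exp L (-n))) fun x => by
      change (I * ((exp L n).1 x - (exp L (-n)).1 x)).im = 0
      rw [hexp]; simp
    rw [map_add, eval_exp, eval_exp, neg_neg] at h1
    rw [map_smul, map_sub, eval_exp, eval_exp, neg_neg] at h2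
    simp only [smul_eq_mul, mul_im, I_re, I_im, sub_re, sub_im, ofReal_re, ofReal_im, add_im,
      mul_re, zero_mul, one_mul, zero_add, add_zero, sub_zero] at h1 h2
    have hL0 := hL.out.ne'
    apply Complex.ext
    · rw [conj_re]
      have : L * ((D.coeff (-n)).re - (D.coeff n).re) = 0 := by linarith
      linarith [(mul_eq_zero.1 this).resolve_left hL0]
    · rw [conj_im]
      have : L * ((D.coeff (-n)).im + (D.coeff n).im) = 0 := by linarith
      linarith [(mul_eq_zero.1 this).resolve_left hL0]
  · intro h φ hφ
    have hfc : ∀ n, fc φ (-n) = (starRingEnd ℂ) (fc φ n) := fun n => by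
      rw [fc, fc, fourierCoeff, fourierCoeff, ← integral_conj]
      congr 1
      funext x
      induction x using QuotientAddGroup.induction_on with | H x => ?_
      change fourier (- -n) (x : AddCircle L) • toCircle φ x = _
      rw [smul_eq_mul, smul_eq_mul, map_mul]
      change _ = _ * (starRingEnd ℂ) (toCircle φ x)
      rw [toCircle_coe, Complex.conj_eq_iff_im.2 (hφ x), ← fourier_neg]
    have h1 := D.hasSum_coeff φ
    have h2 := h1.map (starRingEnd ℂ) Complex.continuous_conj
    rw [← Complex.conj_eq_iff_im]
    refine HasSum.unique ?_ h1
    rw [← (Equiv.neg ℤ).hasSum_iff]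
    refine h2.congr_fun fun n => ?_
    simp only [Function.comp_apply, Equiv.neg_apply, neg_neg, map_mul, Complex.conj_ofReal, hfc,
      h n, Complex.conj_conj]

end PerDist

end PeriodicDistributions

/-! ### Coefficientwise time derivatives -/

section TimeDerivative

variable {L : ℝ} [hL : Fact (0 < L)] {T : ℝ}

open PerTest

theorem HasTimeDeriv.coeff {w w' : ℝ → PerDist L} (h : HasTimeDeriv T w w') {t : ℝ}
    (ht : t ∈ Icc 0 T) (n : ℤ) :
    HasDerivWithinAt (fun r => (w r).coeff n) ((w' t).coeff n) (Icc 0 T) t :=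
  (h t ht (exp L (-n))).const_mul (1 / L : ℂ)

/-- Time derivatives in the sense of periodic distributions can be computed coefficientwise as long
as the coefficients of the derivative grow at most polynomially, uniformly in time. -/
theorem HasTimeDeriv.of_coeff {w w' : ℝ → PerDist L} {C : ℝ} {N : ℕ}
    (h : ∀ t ∈ Icc 0 T, ∀ n,
      HasDerivWithinAt (fun r => (w r).coeff n) ((w' t).coeff n) (Icc 0 T) t)
    (hC : ∀ t ∈ Icc 0 T, ∀ n, ‖(w' t).coeff n‖ ≤ C * (1 + |(n : ℝ)|) ^ N) :
    HasTimeDeriv T w w' := by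
  intro t ht φ
  rw [hasDerivWithinAt_iff_tendsto_slope]
  have e1 : ∀ r, slope (fun r => (w r).1 φ) t r
      = ∑' n, fc φ n * (L * slope (fun r => (w r).coeff (-n)) t r) := by
    intro r
    have h1 := (((w r).hasSum_coeff φ).sub ((w t).hasSum_coeff φ)).mul_left ((r - t : ℂ)⁻¹)
    rw [slope_def_module, real_smul]
    push_cast
    rw [← h1.tsum_eq]
    refine tsum_congr fun n => ?_
    rw [slope_def_module, real_smul]
    push_cast
    ring
  refine Tendsto.congr (fun r => (e1 r).symm) ?_
  rw [← ((w' t).hasSum_coeff φ).tsum_eq]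
  refine tendsto_tsum_of_dominated_convergence
    (bound := fun n => L * C * ((1 + |(n : ℝ)|) ^ N * ‖fc φ n‖))
    ((summable_pow_mul_fc φ N).mul_left _) (fun n => ?_) ?_
  · exact ((hasDerivWithinAt_iff_tendsto_slope.1 (h t ht (-n))).const_mul _).const_mul _
  · filter_upwards [self_mem_nhdsWithin] with r hr n
    -- The mean value inequality bounds the difference quotients by the same power of ⟨n⟩ as the
    -- derivative. The rapid decay of the coefficients of φ then gives a summable majorant.
    have h1 := (convex_Icc 0 T).norm_image_sub_le_of_norm_hasDerivWithin_le
      (fun x hx => h x hx (-n)) (fun x hx => hC x hx (-n)) ht hr.1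
    have hrt : 0 < ‖r - t‖ := norm_pos_iff.2 (sub_ne_zero.2 hr.2)
    have h2 : ‖slope (fun r => (w r).coeff (-n)) t r‖ ≤ C * (1 + |(n : ℝ)|) ^ N := by
      rw [slope_def_module, norm_smul, norm_inv, inv_mul_le_iff₀ hrt]
      simpa [mul_comm] using h1
    rw [norm_mul, norm_mul, Complex.norm_real, Real.norm_of_nonneg hL.out.le]
    calc _ ≤ ‖fc φ n‖ * (L * (C * (1 + |(n : ℝ)|) ^ N)) := by
          have := hL.out.le
          gcongr
      _ = _ := by ring

end TimeDerivative

/-! ### Fourier coefficients of functions and products -/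

namespace L2Per

variable {L : ℝ} [hL : Fact (0 < L)]

theorem coeff_ofFun (g : AddCircle L → ℂ) (hg : Integrable g AddCircle.haarAddCircle) (n : ℤ) :
    (PerDist.ofFun g hg).coeff n = fourierCoeff g n := by
  rw [fourierCoeff_eq_intervalIntegral g n 0, zero_add, real_smul, PerDist.coeff]
  push_cast
  congr 1
  refine intervalIntegral.integral_congr fun x _ => ?_
  simp only [smul_eq_mul, PerTest.exp_coe, mul_comm]

theorem coeff_toDist (f : L2Per L) (n : ℤ) : f.toDist.coeff n = fourierBasis.repr f n := by
  rw [toDist, coeff_ofFun, fourierBasis_repr]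

/-- The function with prescribed square-summable Fourier coefficients. -/
def ofSeq (a : SeqL2) : L2Per L := fourierBasis.repr.symm a

theorem coeff_ofSeq (a : SeqL2) (n : ℤ) : (ofSeq a : L2Per L).toDist.coeff n = a n := by
  rw [coeff_toDist, ofSeq, LinearIsometryEquiv.apply_symm_apply]

theorem ext_coeff {f g : L2Per L} (h : ∀ n, f.toDist.coeff n = g.toDist.coeff n) : f = g := by
  apply fourierBasis.repr.injective
  ext n
  rw [← coeff_toDist, ← coeff_toDist, h]

theorem coeff_toDist_sub (f g : L2Per L) (n : ℤ) :
    (f - g).toDist.coeff n = f.toDist.coeff n - g.toDist.coeff n := by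
  simp only [coeff_toDist, map_sub, lp.coeFn_sub, Pi.sub_apply]

theorem toDist_sub (f g : L2Per L) : (f - g).toDist = f.toDist - g.toDist :=
  PerDist.ext_coeff fun n => by rw [coeff_toDist_sub, PerDist.coeff_sub]

theorem inner_eq_tsum (f g : L2Per L) : HasSum (fun j => (starRingEnd ℂ) (f.toDist.coeff j) *
    g.toDist.coeff j) (inner ℂ f g) := by
  rw [← fourierBasis.repr.inner_map_map f g]
  simpa only [coeff_toDist, RCLike.inner_apply, mul_comm] using
    lp.hasSum_inner (𝕜 := ℂ) (fourierBasis.repr f) (fourierBasis.repr g)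

theorem coeff_mul_fourier (f : L2Per L) (n j : ℤ) :
    fourierCoeff (fun x => fourier n x * f x) j = f.toDist.coeff (j - n) := by
  rw [toDist, coeff_ofFun, fourierCoeff, fourierCoeff]
  congr 1
  funext x
  rw [smul_eq_mul, smul_eq_mul, ← mul_assoc, ← fourier_add]
  congr 2
  ring_nf

theorem coeff_conj (f : L2Per L) (j : ℤ) :
    fourierCoeff (fun x => (starRingEnd ℂ) (f x)) j = (starRingEnd ℂ) (f.toDist.coeff (-j)) := by
  rw [toDist, coeff_ofFun, fourierCoeff, fourierCoeff, ← integral_conj]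
  congr 1
  funext x
  rw [smul_eq_mul, smul_eq_mul, map_mul, neg_neg, fourier_neg]

theorem memLp_conj (f : L2Per L) :
    MemLp (fun x => (starRingEnd ℂ) (f x)) 2 (AddCircle.haarAddCircle : Measure (AddCircle L)) :=
  (Lp.memLp f).star

theorem memLp_fourier_mul (f : L2Per L) (n : ℤ) : MemLp (fun x => fourier n x * f x) 2
    (AddCircle.haarAddCircle : Measure (AddCircle L)) := by
  refine (Lp.memLp f).of_le (((fourier n).continuous.aestronglyMeasurable).mul
    (Lp.aestronglyMeasurable f)) (Eventually.of_forall fun x => ?_)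
  rw [norm_mul, fourier_apply, Circle.norm_coe, one_mul]

theorem coeff_toLp {g : AddCircle L → ℂ} (hg : MemLp g 2 AddCircle.haarAddCircle) (n : ℤ) :
    (toDist (hg.toLp g)).coeff n = fourierCoeff g n := by
  rw [toDist, coeff_ofFun]
  exact congrFun (fourierCoeff_congr_ae hg.coeFn_toLp) n

/-- The coefficients of a product are the convolution of the coefficients. -/
theorem hasSum_coeff_mulDist (f g : L2Per L) (n : ℤ) :
    HasSum (fun j => f.toDist.coeff j * g.toDist.coeff (n - j)) ((mulDist f g).coeff n) := by
  -- The n-th coefficient of fg is the inner product of conj(e_{-n} f) with g, so Parseval's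
  -- identity produces the convolution.
  have h := inner_eq_tsum ((memLp_conj (((memLp_fourier_mul f (-n))).toLp _)).toLp _) g
  have e : (mulDist f g).coeff n
      = inner ℂ ((memLp_conj (((memLp_fourier_mul f (-n))).toLp _)).toLp _) g := by
    rw [mulDist, coeff_ofFun, fourierCoeff, L2.inner_def]
    refine integral_congr_ae ?_
    filter_upwards [(memLp_conj (((memLp_fourier_mul f (-n))).toLp _)).coeFn_toLp,
      (memLp_fourier_mul f (-n)).coeFn_toLp] with x h1 h2
    rw [RCLike.inner_apply, h1, h2, Complex.conj_conj, smul_eq_mul]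
    ring
  rw [e]
  rw [← (Equiv.subLeft n).hasSum_iff] at h
  refine h.congr_fun fun j => ?_
  simp only [Function.comp_apply, Equiv.subLeft_apply, coeff_toLp, coeff_conj, Complex.conj_conj,
    coeff_mul_fourier]
  congr 2
  ring

/-- The coefficients of `|f|²` are the correlation of the coefficients of `f`. -/
theorem hasSum_coeff_absSqDist (f : L2Per L) (n : ℤ) :
    HasSum (fun j => f.toDist.coeff j * (starRingEnd ℂ) (f.toDist.coeff (j - n)))
      ((absSqDist f).coeff n) := by
  have h := hasSum_coeff_mulDist f ((memLp_conj f).toLp _) n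
  have e : (absSqDist f).coeff n = (mulDist f ((memLp_conj f).toLp _)).coeff n := by
    rw [absSqDist, mulDist, coeff_ofFun, coeff_ofFun]
    refine congrFun (fourierCoeff_congr_ae ?_) n
    filter_upwards [(memLp_conj f).coeFn_toLp] with x h1
    rw [h1, Complex.mul_conj, Complex.normSq_eq_norm_sq]
  rw [e]
  refine h.congr_fun fun j => ?_
  rw [coeff_toLp, coeff_conj, neg_sub]

end L2Per

/-! ### Sobolev spaces as weighted sequences -/

section Sobolev

variable {L : ℝ} [hL : Fact (0 < L)] {s : ℝ}

namespace PerDist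

/-- The weighted Fourier coefficients of a periodic distribution. -/
def hsSeq (s : ℝ) (D : PerDist L) : SeqL2 := SeqL2.ofFun fun n => bracket s n * D.coeff n

theorem norm_bracket_mul (n : ℤ) (c : ℂ) : ‖(bracket s n : ℂ) * c‖ = (1 + |(n : ℝ)|) ^ s * ‖c‖ := by
  rw [norm_mul, Complex.norm_real, Real.norm_of_nonneg (bracket_pos s n).le, bracket]

theorem memHs_iff (D : PerDist L) :
    D.MemHs s ↔ ∑' n, ‖(bracket s n : ℂ) * D.coeff n‖ₑ ^ 2 ≠ ⊤ := by
  rw [← SeqL2.summable_iff_enorm]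
  simp only [norm_bracket_mul, MemHs]

theorem MemHs.hsSeq_apply {D : PerDist L} (h : D.MemHs s) (n : ℤ) :
    hsSeq s D n = bracket s n * D.coeff n := SeqL2.ofFun_apply (D.memHs_iff.1 h) n

theorem hsNorm_eq {D : PerDist L} {A : SeqL2} (h : ∀ n, bracket s n * D.coeff n = A n) :
    D.hsNorm s = ‖A‖ := by
  rw [hsNorm, ← Real.sqrt_sq (norm_nonneg A), ← (SeqL2.hasSum_norm_sq A).tsum_eq]
  simp only [← h, norm_bracket_mul]

theorem memHs_of {D : PerDist L} {A : SeqL2} (h : ∀ n, bracket s n * D.coeff n = A n) :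
    D.MemHs s := by
  rw [memHs_iff]
  simp only [h]
  rw [← SeqL2.enorm_sq_eq]
  finiteness

theorem MemHs.norm_hsSeq {D : PerDist L} (h : D.MemHs s) : ‖hsSeq s D‖ = D.hsNorm s :=
  (hsNorm_eq fun n => (h.hsSeq_apply n).symm).symm

theorem hsNorm_nonneg (D : PerDist L) : 0 ≤ D.hsNorm s := Real.sqrt_nonneg _

theorem MemHs.sub {D E : PerDist L} (hD : D.MemHs s) (hE : E.MemHs s) : (D - E).MemHs s :=
  memHs_of (A := hsSeq s D - hsSeq s E) fun n => by
    rw [lp.coeFn_sub, Pi.sub_apply, hD.hsSeq_apply, hE.hsSeq_apply, coeff_sub, mul_sub]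

theorem MemHs.hsSeq_sub {D E : PerDist L} (hD : D.MemHs s) (hE : E.MemHs s) :
    hsSeq s (D - E) = hsSeq s D - hsSeq s E := by
  ext n
  rw [lp.coeFn_sub, Pi.sub_apply, hD.hsSeq_apply, hE.hsSeq_apply, (hD.sub hE).hsSeq_apply,
    coeff_sub, mul_sub]

end PerDist

/-- `w ∈ C([0,T]; H^s)` has continuous weighted Fourier coefficients. -/
theorem ContinuousInHs.continuousOn {T : ℝ} {w : ℝ → L2Per L} (h : ContinuousInHs s T w) :
    ContinuousOn (fun t => PerDist.hsSeq s (w t).toDist) (Icc 0 T) := by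
  intro t₀ ht₀
  rw [ContinuousWithinAt, tendsto_iff_norm_sub_tendsto_zero]
  refine (h.2 t₀ ht₀).congr' ?_
  filter_upwards [self_mem_nhdsWithin] with t ht
  rw [← (h.1 t ht).hsSeq_sub (h.1 t₀ ht₀), L2Per.toDist_sub,
    ((h.1 t ht).sub (h.1 t₀ ht₀)).norm_hsSeq]

theorem ContinuousInHs.of_continuousOn {T : ℝ} {w : ℝ → L2Per L} {A : ℝ → SeqL2}
    (hA : ContinuousOn A (Icc 0 T))
    (h : ∀ t ∈ Icc 0 T, ∀ n, bracket s n * (w t).toDist.coeff n = A t n) :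
    ContinuousInHs s T w := by
  refine ⟨fun t ht => PerDist.memHs_of (h t ht), fun t₀ ht₀ => ?_⟩
  have h1 := tendsto_iff_norm_sub_tendsto_zero.1 (hA t₀ ht₀)
  refine h1.congr' ?_
  filter_upwards [self_mem_nhdsWithin] with t ht
  refine (PerDist.hsNorm_eq fun n => ?_).symm
  rw [L2Per.coeff_toDist_sub, mul_sub, h t ht, h t₀ ht₀, lp.coeFn_sub, Pi.sub_apply]

end Sobolev

/-! ### The free Schrödinger group on sequences -/

section Rotation

variable {θ : ℝ}

/-- The phase `e^{iθn²t}`. -/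
def phase (θ : ℝ) (n : ℤ) (t : ℝ) : ℂ := Complex.exp (I * ((t * (θ * (n : ℝ) ^ 2) : ℝ) : ℂ))

theorem norm_phase (n : ℤ) (t : ℝ) : ‖phase θ n t‖ = 1 := by
  rw [phase, mul_comm, Complex.norm_exp_ofReal_mul_I]

theorem phase_ne_zero (n : ℤ) (t : ℝ) : phase θ n t ≠ 0 := Complex.exp_ne_zero _

theorem phase_neg (n : ℤ) (t : ℝ) : phase θ (-n) t = phase θ n t := by simp [phase]

theorem phase_time_zero (n : ℤ) : phase θ n 0 = 1 := by simp [phase]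

theorem conj_phase (n : ℤ) (t : ℝ) : (starRingEnd ℂ) (phase θ n t) = (phase θ n t)⁻¹ := by
  rw [Complex.inv_def, Complex.normSq_eq_norm_sq, norm_phase]
  simp

theorem continuous_phase (n : ℤ) : Continuous (phase θ n) := by
  unfold phase
  fun_prop

theorem hasDerivAt_phase (n : ℤ) (t : ℝ) :
    HasDerivAt (phase θ n) (I * θ * n ^ 2 * phase θ n t) t := by
  have h1 : HasDerivAt (fun t : ℝ => I * ((t * (θ * (n : ℝ) ^ 2) : ℝ) : ℂ)) (I * θ * n ^ 2) t := by
    have := ((hasDerivAt_id t).mul_const (θ * (n : ℝ) ^ 2)).ofReal_comp.const_mul I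
    refine this.congr_deriv ?_
    push_cast
    ring
  rw [mul_comm]
  exact h1.cexp

/-- The free Schrödinger evolution `e^{-iθn²t}` on sequences. -/
def rot (θ t : ℝ) : SeqL2 →ₗᵢ[ℂ] SeqL2 where
  toFun a := ⟨fun n => (phase θ n t)⁻¹ * a n, by
    refine SeqL2.memℓp_iff_summable.2 ?_
    simpa [norm_phase] using (SeqL2.hasSum_norm_sq a).summable⟩
  map_add' a b := by
    ext n
    exact mul_add _ _ _
  map_smul' c a := by
    ext n
    exact mul_left_comm _ _ _
  norm_map' a := by
    refine SeqL2.norm_eq_of_sq (tsum_congr fun n => ?_)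
    change ‖(phase θ n t)⁻¹ * a n‖ₑ ^ 2 = _
    rw [← ofReal_norm, norm_mul, norm_inv, norm_phase, inv_one, one_mul, ofReal_norm]

theorem rot_apply (t : ℝ) (a : SeqL2) (n : ℤ) : rot θ t a n = (phase θ n t)⁻¹ * a n := rfl

/-- The group is only strongly continuous: each coordinate is continuous in time, and dominated
convergence with majorant (2|a_n|)² handles the sum. -/
theorem continuous_rot (a : SeqL2) : Continuous fun t => rot θ t a := by
  rw [continuous_iff_continuousAt]
  intro t₀
  rw [ContinuousAt, tendsto_iff_norm_sub_tendsto_zero]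
  have h1 : Tendsto (fun t => ∑' n, ‖(rot θ t a - rot θ t₀ a) n‖ ^ 2) (𝓝 t₀)
      (𝓝 (∑' _ : ℤ, 0)) := by
    refine tendsto_tsum_of_dominated_convergence (bound := fun n => (2 * ‖a n‖) ^ 2) ?_
      (fun n => ?_) (Eventually.of_forall fun t n => ?_)
    · simpa [mul_pow] using (SeqL2.hasSum_norm_sq a).summable.mul_left (2 ^ 2)
    · have hc : Continuous fun t => ‖(rot θ t a - rot θ t₀ a) n‖ ^ 2 := by
        simp only [lp.coeFn_sub, Pi.sub_apply, rot_apply]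
        exact (((((continuous_phase n).inv₀ (phase_ne_zero n)).mul_const _).sub
          continuous_const).norm).pow 2
      simpa using hc.tendsto t₀
    · rw [norm_pow, norm_norm]
      refine pow_le_pow_left₀ (norm_nonneg _) ?_ 2
      refine (norm_sub_le _ _).trans (le_of_eq ?_)
      simp only [rot_apply, norm_mul, norm_inv, norm_phase]
      ring
  rw [tsum_zero] at h1
  simp only [fun t => (SeqL2.hasSum_norm_sq (rot θ t a - rot θ t₀ a)).tsum_eq] at h1
  have := h1.sqrt
  simpa using this

theorem continuous_rot_comp {x : ℝ → SeqL2} (hx : Continuous x) :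
    Continuous fun t => rot θ t (x t) := by
  rw [continuous_iff_continuousAt]
  intro t₀
  have h1 : Tendsto (fun t => rot θ t (x t - x t₀)) (𝓝 t₀) (𝓝 0) := by
    rw [tendsto_zero_iff_norm_tendsto_zero]
    simp only [LinearIsometry.norm_map]
    exact tendsto_iff_norm_sub_tendsto_zero.1 hx.continuousAt
  have h2 := h1.add (continuous_rot (θ := θ) (x t₀)).continuousAt
  simpa [ContinuousAt] using h2

end Rotation

/-! ### States described by profiles -/

section Profile

variable {L : ℝ} [hL : Fact (0 < L)] {s θ α β t : ℝ} {x y : Profile} {U V U' V' : L2Per L}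

/-- The profile `x` describes the state `(U, V)` at time `t`: its first component is `U`, its second
component the part of `V` which evolves like a solution of the Schrödinger equation. -/
structure IsProfile (s θ t : ℝ) (x : Profile) (U V : L2Per L) : Prop where
  fst : ∀ n, bracket s n * U.toDist.coeff n = rot θ t x.1 n
  snd : ∀ n, bracket s n * V.toDist.coeff n = (rot θ t x.2 + SeqL2.conjL (rot θ t x.2)) n

/-- The coefficients of the Schrödinger part of `V`. -/
def halfWave (s θ t : ℝ) (x : Profile) (n : ℤ) : ℂ := (bracket s n : ℂ)⁻¹ * rot θ t x.2 n

theorem bracket_ne_zero (n : ℤ) : (bracket s n : ℂ) ≠ 0 := by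
  exact_mod_cast (bracket_pos s n).ne'

namespace IsProfile

theorem coeff_fst (h : IsProfile s θ t x U V) (n : ℤ) :
    U.toDist.coeff n = (bracket s n : ℂ)⁻¹ * rot θ t x.1 n := by
  rw [← h.fst, inv_mul_cancel_left₀ (bracket_ne_zero n)]

theorem coeff_snd (h : IsProfile s θ t x U V) (n : ℤ) :
    V.toDist.coeff n = halfWave s θ t x n + (starRingEnd ℂ) (halfWave s θ t x (-n)) := by
  rw [eq_comm, ← mul_right_inj' (bracket_ne_zero (s := s) n), h.snd, halfWave, halfWave, map_mul,
    map_inv₀, Complex.conj_ofReal, bracket_neg, ← mul_add,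
    mul_inv_cancel_left₀ (bracket_ne_zero n)]
  rfl

theorem hsNorm_sub_le (h : IsProfile s θ t x U V) (h' : IsProfile s θ t y U' V') :
    (U - U').toDist.hsNorm s + (V - V').toDist.hsNorm s ≤ 3 * ‖x - y‖ := by
  have h1 : (U - U').toDist.hsNorm s = ‖rot θ t (x - y).1‖ := PerDist.hsNorm_eq fun n => by
    rw [L2Per.coeff_toDist_sub, mul_sub, h.fst, h'.fst, Prod.fst_sub, map_sub]; rfl
  have h2 : (V - V').toDist.hsNorm s = ‖rot θ t (x - y).2 + SeqL2.conjL (rot θ t (x - y).2)‖ :=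
    PerDist.hsNorm_eq fun n => by
      rw [L2Per.coeff_toDist_sub, mul_sub, h.snd, h'.snd, Prod.snd_sub, map_sub, map_sub]
      simp only [lp.coeFn_add, lp.coeFn_sub, Pi.add_apply, Pi.sub_apply]
      ring
  have h3 := norm_add_le (rot θ t (x - y).2) (SeqL2.conjL (rot θ t (x - y).2))
  rw [(SeqL2.conjL).norm_map, (rot θ t).norm_map] at h3
  rw [h1, h2, LinearIsometry.norm_map]
  linarith [norm_fst_le (x - y), norm_snd_le (x - y)]

theorem unique (h : IsProfile s θ t x U V) (h' : IsProfile s θ t x U' V') : U = U' ∧ V = V' :=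
  ⟨L2Per.ext_coeff fun n => by rw [h.coeff_fst, h'.coeff_fst],
    L2Per.ext_coeff fun n => by rw [h.coeff_snd, h'.coeff_snd]⟩

/-- The frequency n² - j² - (n-j)² splits into one phase for the output and the inverse phases of
the two factors. The summand is thus a product of actual Fourier coefficients, up to the weight and
phase of the output mode. -/
theorem bilTerm_pos_eq (n j : ℤ) (a b : SeqL2) : bilTerm s θ 1 n t a b j
    = (bracket s n * phase θ n t) * (((bracket s j : ℂ)⁻¹ * rot θ t a j) *
      ((bracket s (n - j) : ℂ)⁻¹ * rot θ t b (n - j))) := by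
  have h1 : Complex.exp (I * ((t * (θ * ((n ^ 2 - j ^ 2 - 1 * (n - j) ^ 2 : ℤ) : ℝ)) : ℝ) : ℂ))
      = phase θ n t * ((phase θ j t)⁻¹ * (phase θ (n - j) t)⁻¹) := by
    simp only [phase, ← Complex.exp_neg, ← Complex.exp_add]
    congr 1
    push_cast
    ring
  rw [bilTerm, h1, rot_apply, rot_apply]
  push_cast
  rw [div_eq_mul_inv, mul_inv]
  ring

/-- Conjugation reverses the phase of the second factor and reflects its mode to j - n; this is the
origin of the sign ε = -1. -/
theorem bilTerm_neg_eq (n j : ℤ) (a b : SeqL2) : bilTerm s θ (-1) n t a (SeqL2.conjL b) j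
    = (bracket s n * phase θ n t) * (((bracket s j : ℂ)⁻¹ * rot θ t a j) *
      (starRingEnd ℂ) ((bracket s (j - n) : ℂ)⁻¹ * rot θ t b (j - n))) := by
  have h1 : Complex.exp (I * ((t * (θ * ((n ^ 2 - j ^ 2 - -1 * (n - j) ^ 2 : ℤ) : ℝ)) : ℝ) : ℂ))
      = phase θ n t * ((phase θ j t)⁻¹ * phase θ (j - n) t) := by
    simp only [phase, ← Complex.exp_neg, ← Complex.exp_add]
    congr 1
    push_cast
    ring
  rw [bilTerm, h1, rot_apply, rot_apply, SeqL2.conjL_apply, map_mul, map_mul, map_inv₀, map_inv₀,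
    Complex.conj_ofReal, conj_phase, inv_inv, neg_sub, ← neg_sub j n, bracket_neg]
  push_cast
  rw [div_eq_mul_inv, mul_inv]
  ring

theorem coeff_mulDist (hs : 0 ≤ s) (h : IsProfile s θ t x U V) (n : ℤ) :
    (bracket s n * phase θ n t) * (L2Per.mulDist V U).coeff n
      = bil s θ 1 n t x.1 x.2 + bil s θ (-1) n t x.1 (SeqL2.conjL x.2) := by
  have h1 := (summable_bilTerm (θ := θ) (ε := 1) hs n t x.1 x.2).hasSum.add
    (summable_bilTerm (θ := θ) (ε := -1) hs n t x.1 (SeqL2.conjL x.2)).hasSum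
  have h2 := (L2Per.hasSum_coeff_mulDist V U n).mul_left ((bracket s n : ℂ) * phase θ n t)
  rw [← (Equiv.subLeft n).hasSum_iff] at h2
  refine h2.unique (h1.congr_fun fun j => ?_)
  rw [bilTerm_pos_eq, bilTerm_neg_eq]
  simp only [Function.comp_apply, Equiv.subLeft_apply, sub_sub_cancel]
  rw [h.coeff_fst, h.coeff_snd, neg_sub, halfWave, halfWave]
  ring

theorem coeff_absSqDist (hs : 0 ≤ s) (h : IsProfile s θ t x U V) (n : ℤ) :
    (bracket s n * phase θ n t) * (L2Per.absSqDist U).coeff n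
      = bil s θ (-1) n t x.1 (SeqL2.conjL x.1) := by
  have h1 := (summable_bilTerm (θ := θ) (ε := -1) hs n t x.1 (SeqL2.conjL x.1)).hasSum
  have h2 := (L2Per.hasSum_coeff_absSqDist U n).mul_left ((bracket s n : ℂ) * phase θ n t)
  refine h2.unique (h1.congr_fun fun j => ?_)
  rw [bilTerm_neg_eq, h.coeff_fst, h.coeff_fst]

theorem fieldU_eq (hs : 0 ≤ s) (h : IsProfile s θ t x U V) (n : ℤ) : fieldU s θ α n t x
    = -(I * α) * ((bracket s n * phase θ n t) * (L2Per.mulDist V U).coeff n) := by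
  rw [h.coeff_mulDist hs, fieldU]

/-- In the interaction picture conj z carries the doubled phase e^{2iθn²t}; together with the z term
it reassembles v, the contribution of v_xx kept as a perturbation. -/
theorem fieldZ_eq (hs : 0 ≤ s) (h : IsProfile s θ t x U V) (n : ℤ) : fieldZ s θ β n t x
    = if n = 0 then 0 else -(I / 2) * ((bracket s n * phase θ n t) *
      (β * (L2Per.absSqDist U).coeff n + V.toDist.coeff n)) := by
  rw [fieldZ]
  congr 2
  have h1 : Complex.exp (I * ((2 * (t * (θ * (n : ℝ) ^ 2)) : ℝ) : ℂ))
      = phase θ n t * phase θ n t := by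
    rw [phase, ← Complex.exp_add]
    congr 1
    push_cast
    ring
  have h2 := h.snd n
  rw [lp.coeFn_add, Pi.add_apply, SeqL2.conjL_apply, rot_apply, rot_apply, phase_neg, map_mul,
    map_inv₀, conj_phase, inv_inv] at h2
  rw [h1, ← h.coeff_absSqDist hs, SeqL2.conjL_apply]
  have h3 := mul_inv_cancel₀ (phase_ne_zero (θ := θ) n t)
  linear_combination -phase θ n t * h2 - x.2 n * h3

end IsProfile

end Profile

/-! ### Coordinates of curves -/

section Coordinates

/-- The evaluation of a sequence as a real-linear map. -/
def SeqL2.eval (n : ℤ) : SeqL2 →L[ℝ] ℂ := (lp.evalCLM ℂ (fun _ : ℤ => ℂ) 2 n).restrictScalars ℝ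

theorem SeqL2.eval_apply (n : ℤ) (a : SeqL2) : SeqL2.eval n a = a n := rfl

theorem SeqL2.norm_apply_le (a : SeqL2) (n : ℤ) : ‖a n‖ ≤ ‖a‖ :=
  lp.norm_apply_le_norm two_ne_zero a n

theorem pathOf_clm_of_integrable {X Y : Type*} [NormedAddCommGroup X] [NormedSpace ℝ X]
    [CompleteSpace X] [NormedAddCommGroup Y] [NormedSpace ℝ Y] [CompleteSpace Y] (Λ : X →L[ℝ] Y)
    {a : X} {f : ℝ → X} (hf : Integrable f) (t : ℝ) :
    Λ (pathOf a f t) = pathOf (Λ a) (fun σ => Λ (f σ)) t := by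
  rw [pathOf, pathOf, map_add, Λ.intervalIntegral_comp_comm hf.intervalIntegrable]

variable {T : ℝ}

theorem pathOf_apply_eq {a : SeqL2} {f : ℝ → SeqL2} (hf : Integrable f)
    (hf0 : ∀ t ∉ Ioc 0 T, f t = 0) {n : ℤ} {g : ℝ → ℂ}
    (hfg : ∀ᵐ t ∂volume.restrict (Ioc 0 T), f t n = g t) (t : ℝ) :
    pathOf a f t n = pathOf (a n) ((Ioc 0 T).indicator g) t := by
  have h1 := pathOf_clm_of_integrable (SeqL2.eval n) (a := a) hf t
  simp only [SeqL2.eval_apply] at h1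
  rw [h1, pathOf, pathOf]
  congr 1
  refine intervalIntegral.integral_congr_ae ?_
  rw [ae_restrict_iff' measurableSet_Ioc] at hfg
  filter_upwards [hfg] with σ hσ _
  by_cases hm : σ ∈ Ioc 0 T
  · rw [hσ hm, indicator_of_mem hm]
  · rw [hf0 σ hm, indicator_of_notMem hm]; rfl

theorem pathOf_indicator {a : ℂ} {g : ℝ → ℂ} {t : ℝ} (ht : t ∈ Icc 0 T) :
    pathOf a ((Ioc 0 T).indicator g) t = pathOf a g t := by
  rw [pathOf, pathOf, intervalIntegral.integral_of_le ht.1, intervalIntegral.integral_of_le ht.1]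
  congr 1
  refine setIntegral_congr_fun measurableSet_Ioc fun σ hσ => ?_
  exact indicator_of_mem (Ioc_subset_Ioc_right ht.2 hσ) g

theorem hasDerivWithinAt_pathOf_apply {a : SeqL2} {f : ℝ → SeqL2} (hf : Integrable f)
    (hf0 : ∀ t ∉ Ioc 0 T, f t = 0) {n : ℤ} {g : ℝ → ℂ} (hg : Continuous g)
    (hfg : ∀ᵐ t ∂volume.restrict (Ioc 0 T), f t n = g t) {t : ℝ} (ht : t ∈ Icc 0 T) :
    HasDerivWithinAt (fun r => pathOf a f r n) (g t) (Icc 0 T) t := by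
  have h1 : HasDerivAt (pathOf (a n) g) (g t) t :=
    (intervalIntegral.integral_hasDerivAt_right (hg.intervalIntegrable _ _)
      hg.stronglyMeasurable.stronglyMeasurableAtFilter hg.continuousAt).const_add _
  refine h1.hasDerivWithinAt.congr_of_mem (fun r hr => ?_) ht
  rw [pathOf_apply_eq hf hf0 hfg, pathOf_indicator hr]

theorem hasDerivWithinAt_rot {θ : ℝ} {c : ℝ → SeqL2} {n : ℤ} {c' : ℂ} {S : Set ℝ} {t : ℝ}
    (h : HasDerivWithinAt (fun r => c r n) c' S t) :
    HasDerivWithinAt (fun r => rot θ r (c r) n)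
      (-(I * θ * n ^ 2) * rot θ t (c t) n + (phase θ n t)⁻¹ * c') S t := by
  have h1 := ((hasDerivAt_phase (θ := θ) n t).inv (phase_ne_zero n t)).hasDerivWithinAt (s := S)
  refine (h1.mul h).congr_deriv ?_
  rw [rot_apply]
  have := phase_ne_zero (θ := θ) n t
  simp only [Pi.inv_apply]
  field_simp

end Coordinates

/-! ### Initial profiles and bounds for the coefficients -/

section Construction

variable {L s θ α β T : ℝ}

open PerTest

theorem waveNumber_sq (hθ : θ = (2 * Real.pi / L) ^ 2) (n : ℤ) :
    waveNumber L n ^ 2 = -(θ * n ^ 2) := by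
  rw [hθ, waveNumber]
  push_cast
  linear_combination (2 * Real.pi * n / L : ℂ) ^ 2 * I_sq

variable [hL : Fact (0 < L)]

theorem L2Per.exists_coeff (hs : 0 ≤ s) (A : SeqL2) :
    ∃ U : L2Per L, ∀ n, bracket s n * U.toDist.coeff n = A n := by
  have h : ∑' n, ‖(bracket s n : ℂ)⁻¹ * A n‖ₑ ^ 2 ≠ ⊤ := by
    refine ne_top_of_le_ne_top ?_ (ENNReal.tsum_le_tsum (g := fun n => ‖A n‖ₑ ^ 2) fun n => ?_)
    · rw [← SeqL2.enorm_sq_eq]; finiteness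
    · refine pow_le_pow_left' ?_ 2
      rw [enorm_le_iff_norm_le, norm_mul, norm_inv, Complex.norm_real,
        Real.norm_of_nonneg (bracket_pos s n).le]
      exact mul_le_of_le_one_left (norm_nonneg _) (inv_le_one_of_one_le₀ (one_le_bracket hs n))
  refine ⟨L2Per.ofSeq (SeqL2.ofFun fun n => (bracket s n : ℂ)⁻¹ * A n), fun n => ?_⟩
  rw [L2Per.coeff_ofSeq, SeqL2.ofFun_apply h, mul_inv_cancel_left₀ (bracket_ne_zero n)]

theorem exists_isProfile (hs : 0 ≤ s) (t : ℝ) (x : Profile) :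
    ∃ U V : L2Per L, IsProfile s θ t x U V := by
  obtain ⟨U, hU⟩ := L2Per.exists_coeff (L := L) hs (rot θ t x.1)
  obtain ⟨V, hV⟩ := L2Per.exists_coeff (L := L) hs (rot θ t x.2 + SeqL2.conjL (rot θ t x.2))
  exact ⟨U, V, hU, hV⟩

/-- The state described by a profile has coefficients bounded by the norm of the profile. -/
theorem IsProfile.coeff_bounds (hs : 0 ≤ s) {t R : ℝ} {x : Profile} {U V : L2Per L}
    (h : IsProfile s θ t x U V) (hx : ‖x‖ ≤ R) (n : ℤ) :
    ‖U.toDist.coeff n‖ ≤ R ∧ ‖halfWave s θ t x n‖ ≤ R ∧ ‖V.toDist.coeff n‖ ≤ 2 * R ∧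
      ‖(L2Per.mulDist V U).coeff n‖ ≤ 2 * R ^ 2 ∧ ‖(L2Per.absSqDist U).coeff n‖ ≤ R ^ 2 := by
  have hR : 0 ≤ R := (norm_nonneg _).trans hx
  have hw : ∀ n, ‖(bracket s n : ℂ)⁻¹‖ ≤ 1 := fun n => by
    rw [norm_inv, Complex.norm_real, Real.norm_of_nonneg (bracket_pos s n).le]
    exact inv_le_one_of_one_le₀ (one_le_bracket hs n)
  have hw' : ∀ c : ℂ, ‖c‖ ≤ ‖bracket s n * phase θ n t * c‖ := fun c => by
    rw [norm_mul, norm_mul, norm_phase, Complex.norm_real,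
      Real.norm_of_nonneg (bracket_pos s n).le, mul_one]
    exact le_mul_of_one_le_left (norm_nonneg _) (one_le_bracket hs n)
  have h1 : ‖x.1‖ ≤ R := (norm_fst_le x).trans hx
  have h2 : ‖x.2‖ ≤ R := (norm_snd_le x).trans hx
  have hz : ∀ n, ‖halfWave s θ t x n‖ ≤ R := fun n => by
    rw [halfWave, norm_mul]
    refine (mul_le_of_le_one_left (norm_nonneg _) (hw n)).trans ?_
    exact (SeqL2.norm_apply_le _ n).trans ((rot θ t).norm_map _ |>.le.trans h2)
  refine ⟨?_, hz n, ?_, ?_, ?_⟩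
  · rw [h.coeff_fst, norm_mul]
    refine (mul_le_of_le_one_left (norm_nonneg _) (hw n)).trans ?_
    exact (SeqL2.norm_apply_le _ n).trans ((rot θ t).norm_map _ |>.le.trans h1)
  · rw [h.coeff_snd]
    refine (norm_add_le _ _).trans ?_
    rw [RCLike.norm_conj]
    linarith [hz n, hz (-n)]
  · refine (hw' _).trans ?_
    rw [h.coeff_mulDist hs]
    refine (norm_add_le _ _).trans ?_
    have b1 := norm_bil_le (θ := θ) (ε := 1) hs n t x.1 x.2
    have b2 := norm_bil_le (θ := θ) (ε := -1) hs n t x.1 (SeqL2.conjL x.2)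
    rw [SeqL2.conjL.norm_map] at b2
    have : ‖x.1‖ * ‖x.2‖ ≤ R * R := by gcongr
    linarith
  · refine (hw' _).trans ?_
    rw [h.coeff_absSqDist hs]
    have b2 := norm_bil_le (θ := θ) (ε := -1) hs n t x.1 (SeqL2.conjL x.1)
    rw [SeqL2.conjL.norm_map] at b2
    have : ‖x.1‖ * ‖x.1‖ ≤ R * R := by gcongr
    linarith

theorem L2Per.conj_coeff_absSqDist (U : L2Per L) (n : ℤ) :
    (starRingEnd ℂ) (U.absSqDist.coeff (-n)) = U.absSqDist.coeff n := by
  have h1 := (L2Per.hasSum_coeff_absSqDist U (-n)).map (starRingEnd ℂ) Complex.continuous_conj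
  rw [← (Equiv.subRight n).hasSum_iff] at h1
  refine h1.unique ((L2Per.hasSum_coeff_absSqDist U n).congr_fun fun j => ?_)
  simp only [Function.comp_apply, Equiv.subRight_apply, map_mul, Complex.conj_conj]
  rw [sub_neg_eq_add, sub_add_cancel, mul_comm]

theorem IsProfile.isReal {t : ℝ} {x : Profile} {U V : L2Per L} (h : IsProfile s θ t x U V) :
    V.toDist.IsReal := by
  rw [PerDist.isReal_iff]
  intro n
  rw [h.coeff_snd, h.coeff_snd, neg_neg, map_add, Complex.conj_conj, add_comm]

/-- The profile of the initial data. -/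
def dataProfile (s : ℝ) (u₀ v₀ v₁ : PerDist L) : Profile :=
  (PerDist.hsSeq s u₀, SeqL2.ofFun fun n =>
    bracket s n * ((v₀.coeff n - I * (waveNumber L n)⁻¹ * v₁.coeff n) / 2))

/-- Dividing by the wave number gains one derivative, which matches v₁ ∈ H^{s-1}. The constant L/π
comes from 1 + |n| ≤ 2|n| for n ≠ 0; at n = 0 the inverse of zero is zero by convention. -/
theorem norm_waveNumber_inv_mul_le (D : PerDist L) (n : ℤ) :
    ‖(bracket s n : ℂ) * ((waveNumber L n)⁻¹ * D.coeff n)‖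
      ≤ L / Real.pi * ‖(bracket (s - 1) n : ℂ) * D.coeff n‖ := by
  have hLp := hL.out
  have hpi := Real.pi_pos
  rcases eq_or_ne n 0 with rfl | hn
  · have : waveNumber L 0 = 0 := by simp [waveNumber]
    rw [this]
    simp only [inv_zero, zero_mul, mul_zero, norm_zero]
    positivity
  have hn1 : (1 : ℝ) ≤ |(n : ℝ)| := by exact_mod_cast Int.one_le_abs hn
  have hb : bracket s n = (1 + |(n : ℝ)|) * bracket (s - 1) n := by
    rw [bracket, bracket, Real.rpow_sub_one (by positivity)]
    field_simp
  rw [norm_mul, norm_mul, norm_mul, norm_inv, norm_waveNumber, Complex.norm_real,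
    Complex.norm_real, Real.norm_of_nonneg (bracket_pos s n).le,
    Real.norm_of_nonneg (bracket_pos (s - 1) n).le, hb]
  have h1 : (1 + |(n : ℝ)|) * (2 * Real.pi / L * |(n : ℝ)|)⁻¹ ≤ L / Real.pi := by
    rw [← div_eq_mul_inv, div_le_iff₀ (by positivity)]
    field_simp
    linarith
  have h2 := bracket_pos (s - 1) n
  calc _ = (1 + |(n : ℝ)|) * (2 * Real.pi / L * |(n : ℝ)|)⁻¹ *
        (bracket (s - 1) n * ‖D.coeff n‖) := by ring
    _ ≤ _ := by gcongr

/-- The square-summability of the second component of the initial profile. -/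
theorem tsum_dataProfile_le (v₀ v₁ : PerDist L) :
    ∑' n, ‖(bracket s n : ℂ) * ((v₀.coeff n - I * (waveNumber L n)⁻¹ * v₁.coeff n) / 2)‖ₑ ^ 2
      ≤ ∑' n, ‖(bracket s n : ℂ) * v₀.coeff n‖ₑ ^ 2 + ENNReal.ofReal ((L / Real.pi) ^ 2) *
        ∑' n, ‖(bracket (s - 1) n : ℂ) * v₁.coeff n‖ₑ ^ 2 := by
  rw [← ENNReal.tsum_mul_left, ← ENNReal.tsum_add]
  refine ENNReal.tsum_le_tsum fun n => ?_
  have h1 := norm_waveNumber_inv_mul_le (s := s) v₁ n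
  set A := (bracket s n : ℂ) * v₀.coeff n
  set B := (bracket s n : ℂ) * ((waveNumber L n)⁻¹ * v₁.coeff n)
  set D := (bracket (s - 1) n : ℂ) * v₁.coeff n
  have e : (bracket s n : ℂ) * ((v₀.coeff n - I * (waveNumber L n)⁻¹ * v₁.coeff n) / 2)
      = (A - I * B) / 2 := by simp only [A, B]; ring
  rw [e]
  have h2 : ‖(A - I * B) / 2‖ ^ 2 ≤ ‖A‖ ^ 2 + (L / Real.pi) ^ 2 * ‖D‖ ^ 2 := by
    rw [norm_div, RCLike.norm_ofNat]
    have h3 : ‖A - I * B‖ ≤ ‖A‖ + ‖B‖ := by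
      refine (norm_sub_le _ _).trans ?_
      rw [norm_mul I B, norm_I, one_mul]
    have h4 : ‖B‖ ^ 2 ≤ (L / Real.pi * ‖D‖) ^ 2 := pow_le_pow_left₀ (norm_nonneg _) h1 2
    have h5 : ‖A - I * B‖ ^ 2 ≤ (‖A‖ + ‖B‖) ^ 2 := pow_le_pow_left₀ (norm_nonneg _) h3 2
    nlinarith [sq_nonneg (‖A‖ - ‖B‖)]
  have h3 := ENNReal.ofReal_le_ofReal h2
  rw [ENNReal.ofReal_add (by positivity) (by positivity), ENNReal.ofReal_mul (by positivity),
    ENNReal.ofReal_pow (norm_nonneg _), ENNReal.ofReal_pow (norm_nonneg _),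
    ENNReal.ofReal_pow (norm_nonneg _)] at h3
  simpa only [ofReal_norm] using h3

theorem IsData.dataProfile_fst {u₀ v₀ v₁ : PerDist L} (h : IsData s u₀ v₀ v₁) (n : ℤ) :
    (dataProfile s u₀ v₀ v₁).1 n = bracket s n * u₀.coeff n := h.1.hsSeq_apply n

theorem IsData.dataProfile_snd {u₀ v₀ v₁ : PerDist L} (h : IsData s u₀ v₀ v₁) (n : ℤ) :
    (dataProfile s u₀ v₀ v₁).2 n
      = bracket s n * ((v₀.coeff n - I * (waveNumber L n)⁻¹ * v₁.coeff n) / 2) := by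
  refine SeqL2.ofFun_apply (ne_top_of_le_ne_top ?_ (tsum_dataProfile_le v₀ v₁)) n
  have h1 := v₀.memHs_iff.1 h.2.1
  have h2 := v₁.memHs_iff.1 h.2.2.1
  finiteness

end Construction

/-! ### From profiles to distributional solutions -/

section Construction

variable {L : ℝ} [hL : Fact (0 < L)] {s θ α β T : ℝ} {a : Profile} {f : ℝ → Profile}
  {U V : ℝ → L2Per L}

open PerTest

namespace IsMildSol

theorem continuous_path (h : IsMildSol s θ α β T a f) : Continuous (pathOf a f) :=
  continuous_pathOf fun _ _ => h.integrable.intervalIntegrable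

theorem pathOf_fst (h : IsMildSol s θ α β T a f) (t : ℝ) :
    (pathOf a f t).1 = pathOf a.1 (fun σ => (f σ).1) t :=
  pathOf_clm_of_integrable (ContinuousLinearMap.fst ℝ SeqL2 SeqL2) h.integrable t

theorem pathOf_snd (h : IsMildSol s θ α β T a f) (t : ℝ) :
    (pathOf a f t).2 = pathOf a.2 (fun σ => (f σ).2) t :=
  pathOf_clm_of_integrable (ContinuousLinearMap.snd ℝ SeqL2 SeqL2) h.integrable t

theorem hasDerivWithinAt_fst (hs : 0 ≤ s) (h : IsMildSol s θ α β T a f)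
    (h0 : ∀ t ∉ Ioc 0 T, f t = 0) {t : ℝ} (ht : t ∈ Icc 0 T) (n : ℤ) :
    HasDerivWithinAt (fun r => (pathOf a f r).1 n) (fieldU s θ α n t (pathOf a f t))
      (Icc 0 T) t := by
  simp only [h.pathOf_fst]
  refine hasDerivWithinAt_pathOf_apply (g := fun r => fieldU s θ α n r (pathOf a f r))
    h.integrable.fst
    (fun t ht => by rw [h0 t ht]; rfl) (continuous_fieldU hs n h.continuous_path) ?_ ht
  filter_upwards [h.ae_eq] with r hr using (hr n).1

theorem hasDerivWithinAt_snd (hs : 0 ≤ s) (h : IsMildSol s θ α β T a f)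
    (h0 : ∀ t ∉ Ioc 0 T, f t = 0) {t : ℝ} (ht : t ∈ Icc 0 T) (n : ℤ) :
    HasDerivWithinAt (fun r => (pathOf a f r).2 n) (fieldZ s θ β n t (pathOf a f t))
      (Icc 0 T) t := by
  simp only [h.pathOf_snd]
  refine hasDerivWithinAt_pathOf_apply (g := fun r => fieldZ s θ β n r (pathOf a f r))
    h.integrable.snd
    (fun t ht => by rw [h0 t ht]; rfl) (continuous_fieldZ hs n h.continuous_path) ?_ ht
  filter_upwards [h.ae_eq] with r hr using (hr n).2

theorem continuousInHs (h : IsMildSol s θ α β T a f)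
    (hUV : ∀ t ∈ Icc 0 T, IsProfile s θ t (pathOf a f t) (U t) (V t)) :
    ContinuousInHs s T U ∧ ContinuousInHs s T V := by
  have c1 := continuous_rot_comp (θ := θ) h.continuous_path.fst
  have c2 := continuous_rot_comp (θ := θ) h.continuous_path.snd
  exact ⟨.of_continuousOn c1.continuousOn fun t ht n => (hUV t ht).fst n,
    .of_continuousOn (c2.add (SeqL2.conjL.continuous.comp c2)).continuousOn
      fun t ht n => (hUV t ht).snd n⟩

theorem hasDerivWithinAt_coeff_fst (hs : 0 ≤ s) (hθ : θ = (2 * Real.pi / L) ^ 2)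
    (h : IsMildSol s θ α β T a f) (h0 : ∀ t ∉ Ioc 0 T, f t = 0)
    (hUV : ∀ t ∈ Icc 0 T, IsProfile s θ t (pathOf a f t) (U t) (V t))
    {t : ℝ} (ht : t ∈ Icc 0 T) (n : ℤ) :
    HasDerivWithinAt (fun r => (U r).toDist.coeff n) (-(I * (α * (L2Per.mulDist (V t) (U t)).coeff n
      - waveNumber L n ^ 2 * (U t).toDist.coeff n))) (Icc 0 T) t := by
  have h1 := (hasDerivWithinAt_rot (θ := θ) (h.hasDerivWithinAt_fst hs h0 ht n)).const_mul
    (bracket s n : ℂ)⁻¹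
  refine (h1.congr_of_mem (fun r hr => (hUV r hr).coeff_fst n) ht).congr_deriv ?_
  rw [waveNumber_sq hθ, (hUV t ht).fieldU_eq hs, (hUV t ht).coeff_fst]
  have := bracket_ne_zero (s := s) n
  have := phase_ne_zero (θ := θ) n t
  field_simp
  ring

theorem hasDerivWithinAt_halfWave (hs : 0 ≤ s) (hθ : θ = (2 * Real.pi / L) ^ 2)
    (h : IsMildSol s θ α β T a f) (h0 : ∀ t ∉ Ioc 0 T, f t = 0)
    (hUV : ∀ t ∈ Icc 0 T, IsProfile s θ t (pathOf a f t) (U t) (V t))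
    {t : ℝ} (ht : t ∈ Icc 0 T) (n : ℤ) :
    HasDerivWithinAt (fun r => halfWave s θ r (pathOf a f r) n)
      (I * waveNumber L n ^ 2 * halfWave s θ t (pathOf a f t) n +
        if n = 0 then 0 else -(I / 2) *
          (β * (L2Per.absSqDist (U t)).coeff n + (V t).toDist.coeff n)) (Icc 0 T) t := by
  have h1 := (hasDerivWithinAt_rot (θ := θ) (h.hasDerivWithinAt_snd hs h0 ht n)).const_mul
    (bracket s n : ℂ)⁻¹
  refine h1.congr_deriv ?_
  rw [waveNumber_sq hθ, (hUV t ht).fieldZ_eq hs, halfWave]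
  have := bracket_ne_zero (s := s) n
  have := phase_ne_zero (θ := θ) n t
  split_ifs
  · ring
  · field_simp

/-- Since V and |U|² are real, conjugating the half-wave equation only changes the sign of its
source, so the sources cancel in the sum z + conj z. -/
theorem hasDerivWithinAt_conj_halfWave (hs : 0 ≤ s) (hθ : θ = (2 * Real.pi / L) ^ 2)
    (h : IsMildSol s θ α β T a f) (h0 : ∀ t ∉ Ioc 0 T, f t = 0)
    (hUV : ∀ t ∈ Icc 0 T, IsProfile s θ t (pathOf a f t) (U t) (V t))
    {t : ℝ} (ht : t ∈ Icc 0 T) (n : ℤ) :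
    HasDerivWithinAt (fun r => (starRingEnd ℂ) (halfWave s θ r (pathOf a f r) (-n)))
      (-(I * waveNumber L n ^ 2 * (starRingEnd ℂ) (halfWave s θ t (pathOf a f t) (-n))) +
        if n = 0 then 0 else (I / 2) *
          (β * (L2Per.absSqDist (U t)).coeff n + (V t).toDist.coeff n)) (Icc 0 T) t := by
  have h1 := h.hasDerivWithinAt_halfWave hs hθ h0 hUV ht (-n)
  have h2 := Complex.conjCLE.hasFDerivAt.comp_hasDerivWithinAt t h1
  have hV := ((V t).toDist.isReal_iff.1 (hUV t ht).isReal) n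
  have hW : (starRingEnd ℂ) (waveNumber L n ^ 2) = waveNumber L n ^ 2 := by
    rw [waveNumber_sq hθ]; simp
  refine h2.congr_deriv ?_
  simp only [waveNumber_neg, neg_eq_zero, neg_sq, hV]
  change (starRingEnd ℂ) _ = _
  rw [map_add, map_mul, map_mul, hW, conj_I]
  congr 1
  · ring
  · split_ifs
    · simp
    · rw [map_mul, map_add, Complex.conj_conj, map_mul, Complex.conj_ofReal,
        L2Per.conj_coeff_absSqDist]
      congr 1
      rw [map_neg, map_div₀, conj_I, Complex.conj_ofNat, neg_div, neg_neg]

/-- A solution of the system in the interaction picture yields a solution of the Schrödinger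
equation and of the Boussinesq equation in the sense of distributions. -/
theorem solvesSB (hs : 0 ≤ s) (hT : 0 ≤ T) (hθ : θ = (2 * Real.pi / L) ^ 2)
    {u₀ v₀ v₁ : PerDist L} (hdata : IsData s u₀ v₀ v₁)
    (h : IsMildSol s θ α β T (dataProfile s u₀ v₀ v₁) f) (h0 : ∀ t ∉ Ioc 0 T, f t = 0)
    (hUV : ∀ t ∈ Icc 0 T, IsProfile s θ t (pathOf (dataProfile s u₀ v₀ v₁) f t) (U t) (V t)) :
    SolvesSB α β T u₀ v₀ v₁ U V := by
  set x := pathOf (dataProfile s u₀ v₀ v₁) f with hx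
  have hx0 : x 0 = dataProfile s u₀ v₀ v₁ := by simp [hx, pathOf]
  have h0T : (0 : ℝ) ∈ Icc 0 T := ⟨le_rfl, hT⟩
  obtain ⟨R, hR⟩ : ∃ R, ∀ t ∈ Icc 0 T, ‖x t‖ ≤ R :=
    isCompact_Icc.exists_bound_of_continuousOn h.continuous_path.continuousOn
  have hb := fun t ht n => (hUV t ht).coeff_bounds hs (hR t ht) n
  have hR0 : 0 ≤ R := (norm_nonneg _).trans (hR 0 h0T)
  -- Y represents z - conj z. As the sources cancel in z_t + conj(z)_t, the derivative v_t equals i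
  -- W² (z - conj z), that is `I • Y.dx.dx`; in its own derivative the sources add up and restore
  -- v_xx + β(|u|²)_xx.
  choose Y hY using fun t => L2Per.exists_coeff (L := L) hs
    (rot θ t (x t).2 - SeqL2.conjL (rot θ t (x t).2))
  have hY' : ∀ t n, (Y t).toDist.coeff n = halfWave s θ t (x t) n
      - (starRingEnd ℂ) (halfWave s θ t (x t) (-n)) := fun t n => by
    rw [← mul_right_inj' (bracket_ne_zero (s := s) n), hY, halfWave, halfWave, map_mul,
      map_inv₀, Complex.conj_ofReal, bracket_neg, ← mul_sub,
      mul_inv_cancel_left₀ (bracket_ne_zero n)]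
    rfl
  set κ := 2 * Real.pi / L with hκ
  have hκ0 : 0 ≤ κ := by have := hL.out; positivity
  have hw : ∀ n : ℤ, ‖waveNumber L n‖ ≤ κ * (1 + |(n : ℝ)|) := fun n => by
    rw [norm_waveNumber]
    gcongr
    linarith
  have hm : ∀ n : ℤ, 1 ≤ 1 + |(n : ℝ)| := fun n => by linarith [abs_nonneg (n : ℝ)]
  have dd : ∀ (D : PerDist L) n, D.dx.dx.coeff n = waveNumber L n ^ 2 * D.coeff n := fun D n => by
    rw [PerDist.coeff_dx, PerDist.coeff_dx]; ring
  refine ⟨fun t ht => (hUV t ht).isReal,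
    fun t => -(I • ((α : ℂ) • L2Per.mulDist (V t) (U t) - (U t).toDist.dx.dx)),
    fun t => I • (Y t).toDist.dx.dx,
    fun t => (V t).toDist.dx.dx - (V t).toDist.dx.dx.dx.dx +
      (β : ℂ) • (L2Per.absSqDist (U t)).dx.dx, ?_, ?_, ?_, ?_, ?_, ?_, ?_, ?_⟩
  · have hc : ∀ t n, (-(I • ((α : ℂ) • L2Per.mulDist (V t) (U t) - (U t).toDist.dx.dx))).coeff n
        = -(I * (α * (L2Per.mulDist (V t) (U t)).coeff n
          - waveNumber L n ^ 2 * (U t).toDist.coeff n)) := fun t n => by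
      rw [← neg_one_smul ℂ, PerDist.coeff_smul, PerDist.coeff_smul, PerDist.coeff_sub,
        PerDist.coeff_smul, dd]
      ring
    refine HasTimeDeriv.of_coeff (C := |α| * (2 * R ^ 2) + κ ^ 2 * R) (N := 2) (fun t ht n => ?_)
      fun t ht n => ?_
    · rw [hc]
      exact h.hasDerivWithinAt_coeff_fst hs hθ h0 hUV ht n
    · obtain ⟨b1, -, -, b4, -⟩ := hb t ht n
      rw [hc, norm_neg, norm_mul, norm_I, one_mul]
      refine (norm_sub_le _ _).trans ?_
      rw [norm_mul, norm_mul, norm_pow, Complex.norm_real, Real.norm_eq_abs, add_mul]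
      gcongr ?_ + ?_
      · calc _ ≤ |α| * (2 * R ^ 2) * 1 := by rw [mul_one]; gcongr
          _ ≤ _ := by gcongr; exact one_le_pow₀ (hm n)
      · calc _ ≤ (κ * (1 + |(n : ℝ)|)) ^ 2 * R := by gcongr; exact hw n
          _ = _ := by ring
  · refine HasTimeDeriv.of_coeff (C := κ ^ 2 * (2 * R)) (N := 2) (fun t ht n => ?_)
      fun t ht n => ?_
    · have h1 := (h.hasDerivWithinAt_halfWave hs hθ h0 hUV ht n).add
        (h.hasDerivWithinAt_conj_halfWave hs hθ h0 hUV ht n)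
      refine (h1.congr_of_mem (fun r hr => (hUV r hr).coeff_snd n) ht).congr_deriv ?_
      rw [PerDist.coeff_smul, dd, hY']
      split_ifs <;> ring
    · have b := (hb t ht n).2.1
      have b' := (hb t ht (-n)).2.1
      rw [PerDist.coeff_smul, dd, hY', norm_mul, norm_mul, norm_I, one_mul, norm_pow]
      have := norm_sub_le (halfWave s θ t (x t) n) ((starRingEnd ℂ) (halfWave s θ t (x t) (-n)))
      rw [RCLike.norm_conj] at this
      calc _ ≤ (κ * (1 + |(n : ℝ)|)) ^ 2 * (2 * R) := by
            gcongr
            · exact hw n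
            · linarith
        _ = _ := by ring
  · have hc : ∀ t n, ((V t).toDist.dx.dx - (V t).toDist.dx.dx.dx.dx +
        (β : ℂ) • (L2Per.absSqDist (U t)).dx.dx).coeff n
        = waveNumber L n ^ 2 * (V t).toDist.coeff n - waveNumber L n ^ 4 * (V t).toDist.coeff n
          + β * (waveNumber L n ^ 2 * (L2Per.absSqDist (U t)).coeff n) := fun t n => by
      rw [PerDist.coeff_add, PerDist.coeff_sub, PerDist.coeff_smul, dd, dd, dd, dd]
      ring
    refine HasTimeDeriv.of_coeff (C := κ ^ 2 * (2 * R) + κ ^ 4 * (2 * R) + |β| * (κ ^ 2 * R ^ 2))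
      (N := 4) (fun t ht n => ?_) fun t ht n => ?_
    · have h1 := ((h.hasDerivWithinAt_halfWave hs hθ h0 hUV ht n).sub
        (h.hasDerivWithinAt_conj_halfWave hs hθ h0 hUV ht n)).const_mul (I * waveNumber L n ^ 2)
      refine (h1.congr_of_mem (fun r hr => ?_) ht).congr_deriv ?_
      · rw [PerDist.coeff_smul, dd, hY']
        simp only [Pi.sub_apply]
        ring
      · rw [hc, (hUV t ht).coeff_snd]
        by_cases hn : n = 0
        · have : waveNumber L n = 0 := by simp [waveNumber, hn]
          rw [this]
          simp
        · rw [if_neg hn, if_neg hn]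
          linear_combination (waveNumber L n ^ 4 * (halfWave s θ t (x t) n
            + (starRingEnd ℂ) (halfWave s θ t (x t) (-n))) - waveNumber L n ^ 2 *
            (β * (L2Per.absSqDist (U t)).coeff n + (halfWave s θ t (x t) n
            + (starRingEnd ℂ) (halfWave s θ t (x t) (-n))))) * I_sq
    · obtain ⟨-, -, b3, -, b5⟩ := hb t ht n
      rw [hc]
      have e2 : ‖waveNumber L n ^ 2‖ ≤ κ ^ 2 * (1 + |(n : ℝ)|) ^ 4 := by
        rw [norm_pow]
        calc _ ≤ (κ * (1 + |(n : ℝ)|)) ^ 2 := by gcongr; exact hw n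
          _ = κ ^ 2 * (1 + |(n : ℝ)|) ^ 2 := by ring
          _ ≤ _ := by gcongr <;> [exact hm n; norm_num]
      have e4 : ‖waveNumber L n ^ 4‖ ≤ κ ^ 4 * (1 + |(n : ℝ)|) ^ 4 := by
        rw [norm_pow]
        calc _ ≤ (κ * (1 + |(n : ℝ)|)) ^ 4 := by gcongr; exact hw n
          _ = _ := by ring
      refine (norm_add_le _ _).trans ((add_le_add_left (norm_sub_le _ _) _).trans ?_)
      simp only [norm_mul, Complex.norm_real, Real.norm_eq_abs]
      calc _ ≤ κ ^ 2 * (1 + |(n : ℝ)|) ^ 4 * (2 * R) + κ ^ 4 * (1 + |(n : ℝ)|) ^ 4 * (2 * R) +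
            |β| * (κ ^ 2 * (1 + |(n : ℝ)|) ^ 4 * R ^ 2) := by gcongr
        _ = _ := by ring
  · intro t _
    rw [smul_neg, smul_smul, I_mul_I, neg_one_smul, neg_neg, sub_add_cancel]
  · intro t _
    rw [add_sub_right_comm, sub_sub_cancel_left, neg_add_eq_sub, sub_add_cancel]
  · refine PerDist.ext_coeff fun n => ?_
    have h1 := (hUV 0 h0T).coeff_fst n
    rw [hx0] at h1
    rw [h1, rot_apply, phase_time_zero, hdata.dataProfile_fst, inv_one, one_mul,
      inv_mul_cancel_left₀ (bracket_ne_zero n)]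
  all_goals
    -- Half-wave at time 0: v_t(0) has coefficient W v₁, so W⁻² v_t becomes W⁻¹ v₁. Reality of v₀
    -- and v₁ gives the conjugate with the opposite sign, so v₀ and (v₁)_x are recovered from sum
    -- and difference.
    have hz : ∀ n, halfWave s θ 0 (x 0) n
        = (v₀.coeff n - I * (waveNumber L n)⁻¹ * v₁.coeff n) / 2 := fun n => by
      rw [hx0, halfWave, rot_apply, phase_time_zero, hdata.dataProfile_snd, inv_one, one_mul,
        inv_mul_cancel_left₀ (bracket_ne_zero n)]
    have hW : ∀ n, (starRingEnd ℂ) (waveNumber L n) = -waveNumber L n := fun n => by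
      simp only [waveNumber, map_div₀, map_mul, Complex.conj_ofReal, conj_I, Complex.conj_ofNat,
        map_intCast]
      ring
    have hv0 := (v₀.isReal_iff.1 hdata.2.2.2.1)
    have hv1 := (v₁.isReal_iff.1 hdata.2.2.2.2)
    have hz' : ∀ n, (starRingEnd ℂ) (halfWave s θ 0 (x 0) (-n))
        = (v₀.coeff n + I * (waveNumber L n)⁻¹ * v₁.coeff n) / 2 := fun n => by
      rw [hz, hv0, hv1, waveNumber_neg, inv_neg, map_div₀, map_sub, map_mul, map_mul, map_neg,
        map_inv₀, hW, conj_I, Complex.conj_conj, Complex.conj_conj, Complex.conj_ofNat, inv_neg]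
      ring
  · refine PerDist.ext_coeff fun n => ?_
    rw [(hUV 0 h0T).coeff_snd n, hz, hz']
    ring
  · refine PerDist.ext_coeff fun n => ?_
    rw [PerDist.coeff_smul, dd, hY', hz, hz', PerDist.coeff_dx]
    by_cases hn : waveNumber L n = 0
    · rw [hn]; simp
    · field_simp
      linear_combination (-2 * v₁.coeff n) * I_sq

end IsMildSol

end Construction

/-! ### Finite Bourgain norms of the constructed solutions -/

section BourgainNorms

variable {L s θ α β T : ℝ}

/-- From n² ≤ √(n²+n⁴) ≤ n²+1 the frequency γ_L(n) is within θ of θn², and ||τ| - θn²| ≤ |τ + θn²|.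
A function localized near the Schrödinger parabola therefore has small Boussinesq modulation. -/
theorem abs_boussinesqSymbol_le (hθ : θ = (2 * Real.pi / L) ^ 2) (n : ℤ) (τ : ℝ) :
    1 + |boussinesqSymbol L n τ| ≤ (1 + θ) * (1 + |τ + θ * n ^ 2|) := by
  have hθ0 : 0 ≤ θ := by rw [hθ]; positivity
  rw [boussinesqSymbol, ← hθ]
  set r := Real.sqrt ((n : ℝ) ^ 2 + (n : ℝ) ^ 4) with hr
  have h1 : (n : ℝ) ^ 2 ≤ r := Real.le_sqrt_of_sq_le (by nlinarith [sq_nonneg (n : ℝ)])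
  have h2 : r ≤ (n : ℝ) ^ 2 + 1 := by
    rw [hr, Real.sqrt_le_left (by positivity)]
    nlinarith [sq_nonneg (n : ℝ)]
  have h3 : |θ * r - θ * n ^ 2| ≤ θ := by
    rw [← mul_sub, abs_mul, abs_of_nonneg hθ0, abs_of_nonneg (by linarith)]
    exact mul_le_of_le_one_right hθ0 (by linarith)
  have h4 : |(|τ| - θ * n ^ 2)| ≤ |τ + θ * n ^ 2| := by
    have := abs_abs_sub_abs_le τ (-(θ * n ^ 2))
    rwa [abs_neg, abs_of_nonneg (by positivity : 0 ≤ θ * (n : ℝ) ^ 2), sub_neg_eq_add] at this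
  have h5 : |(|τ| - θ * r)| ≤ |(|τ| - θ * n ^ 2)| + |θ * r - θ * n ^ 2| := by
    have := abs_sub (|τ| - θ * n ^ 2) (θ * r - θ * n ^ 2)
    rwa [sub_sub_sub_cancel_right] at this
  nlinarith [abs_nonneg (τ + θ * n ^ 2)]

variable [hL : Fact (0 < L)]

/-- A curve of sequences with square-integrable derivative on `[0, T]` extends to a curve whose time
Fourier transform has a finite weighted norm. -/
theorem exists_fourier_seq (hT : 0 < T) {a : SeqL2} {f : ℝ → SeqL2} (hf : Integrable f)
    (hf0 : ∀ t ∉ Ioc 0 T, f t = 0) (hf2 : expNormSq 0 T f ≠ ⊤) {g : ℤ → ℝ → ℂ}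
    (hg : ∀ n, Continuous (g n))
    (hfg : ∀ᵐ t ∂volume.restrict (Ioc 0 T), ∀ n, f t n = g n t) :
    ∃ η : ℝ → ℝ, (∀ t ∈ Icc 0 T, η t = 1) ∧ ∃ F : ℤ → ℝ → ℂ, (∀ n, Integrable (F n) ∧
      ∀ t : ℝ, η t * pathOf a f t n
        = (1 / (2 * Real.pi) : ℂ) * ∫ τ : ℝ, F n τ * Complex.exp (I * t * τ)) ∧
      ∑' n, ∫⁻ τ, (ENNReal.ofReal (1 + |τ|) * ‖F n τ‖ₑ) ^ 2 ≠ ⊤ := by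
  obtain ⟨η, hη, C, hC, hF⟩ := exists_fourier_extension hT
  choose F hFi hFeq hFle using fun n => hF (a n) (g n) (hg n)
  have hco : ∀ n t, pathOf (a n) ((Ioc 0 T).indicator (g n)) t = pathOf a f t n := fun n t =>
    (pathOf_apply_eq hf hf0 (by filter_upwards [hfg] with t ht using ht n) t).symm
  have hpc : Continuous (pathOf a f) := continuous_pathOf fun _ _ => hf.intervalIntegrable
  have hcn : ∀ n, Continuous fun t => pathOf a f t n := fun n =>
    (SeqL2.eval n).continuous.comp hpc
  simp only [hco] at hFeq hFle
  refine ⟨η, hη, F, fun n => ⟨hFi n, hFeq n⟩, ?_⟩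
  refine ne_top_of_le_ne_top ?_ (ENNReal.tsum_le_tsum hFle)
  -- The constant of the extension is the same for all modes, so the sum over modes moves inside the
  -- time integrals and becomes the ℓ² norms of the curve and of its derivative.
  rw [ENNReal.tsum_mul_left, ENNReal.tsum_add,
    ← lintegral_tsum fun n => ((hcn n).measurable.enorm.pow_const 2).aemeasurable,
    ← lintegral_tsum fun n => ((hg n).measurable.enorm.pow_const 2).aemeasurable]
  simp only [← SeqL2.enorm_sq_eq]
  refine ENNReal.mul_ne_top hC (ENNReal.add_ne_top.2 ⟨?_, ?_⟩)
  · obtain ⟨R, hR⟩ := (isCompact_Icc (a := -2) (b := T + 2)).exists_bound_of_continuousOn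
      hpc.continuousOn
    have h1 : ∫⁻ t in Ioo (-2) (T + 2), ‖pathOf a f t‖ₑ ^ 2
        ≤ ∫⁻ _ in Ioo (-2) (T + 2), ENNReal.ofReal R ^ 2 := by
      refine setLIntegral_mono' measurableSet_Ioo fun t ht => pow_le_pow_left' ?_ 2
      rw [← ofReal_norm]
      exact ENNReal.ofReal_le_ofReal (hR t (Ioo_subset_Icc_self ht))
    refine ne_top_of_le_ne_top ?_ h1
    rw [setLIntegral_const, Real.volume_Ioo]
    finiteness
  · rw [expNormSq_zero_eq] at hf2
    convert hf2 using 1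
    refine lintegral_congr_ae ?_
    filter_upwards [hfg] with t ht
    rw [SeqL2.enorm_sq_eq]
    simp only [ht]

/-- `exists_fourier_seq` for the free evolution of the curve. -/
theorem exists_fourier_rot (s θ : ℝ) (hT : 0 < T) {a : SeqL2} {f : ℝ → SeqL2} (hf : Integrable f)
    (hf0 : ∀ t ∉ Ioc 0 T, f t = 0) (hf2 : expNormSq 0 T f ≠ ⊤) {g : ℤ → ℝ → ℂ}
    (hg : ∀ n, Continuous (g n))
    (hfg : ∀ᵐ t ∂volume.restrict (Ioc 0 T), ∀ n, f t n = g n t) :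
    ∃ η : ℝ → ℝ, (∀ t ∈ Icc 0 T, η t = 1) ∧ ∃ F : ℤ → ℝ → ℂ, (∀ n, Integrable (F n) ∧
      ∀ t : ℝ, (bracket s n : ℂ)⁻¹ * (η t * rot θ t (pathOf a f t) n)
        = (1 / (2 * Real.pi) : ℂ) * ∫ τ : ℝ, F n τ * Complex.exp (I * t * τ)) ∧
      ∑' n : ℤ, ∫⁻ τ, (ENNReal.ofReal ((1 + |τ + θ * n ^ 2|) * bracket s n) * ‖F n τ‖ₑ) ^ 2
        ≠ ⊤ := by
  obtain ⟨η, hη, F, hF, hFt⟩ := exists_fourier_seq hT (a := a) hf hf0 hf2 hg hfg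
  -- The free evolution translates the time frequency of mode n by θn², so the weight 1 + |τ|
  -- becomes the Schrödinger modulation.
  refine ⟨η, hη, fun n τ => (bracket s n : ℂ)⁻¹ * F n (τ + θ * n ^ 2), fun n =>
    ⟨((hF n).1.comp_add_right _).const_mul _, fun t => ?_⟩, ?_⟩
  · have h1 : ∀ τ : ℝ, (bracket s n : ℂ)⁻¹ * F n (τ + θ * n ^ 2) * Complex.exp (I * t * τ)
        = ((bracket s n : ℂ)⁻¹ * (phase θ n t)⁻¹) *
          (F n (τ + θ * n ^ 2) * Complex.exp (I * t * (τ + θ * n ^ 2 : ℝ))) := fun τ => by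
      have : Complex.exp (I * t * (τ + θ * n ^ 2 : ℝ))
          = phase θ n t * Complex.exp (I * t * τ) := by
        rw [phase, ← Complex.exp_add]
        congr 1
        push_cast
        ring
      rw [this]
      have := phase_ne_zero (θ := θ) n t
      field_simp
    simp only [h1]
    rw [integral_const_mul,
      integral_add_right_eq_self (fun τ : ℝ => F n τ * Complex.exp (I * t * τ)) (θ * n ^ 2),
      rot_apply]
    linear_combination ((bracket s n : ℂ)⁻¹ * (phase θ n t)⁻¹) * (hF n).2 t
  · convert hFt using 1
    refine tsum_congr fun n => ?_
    rw [← lintegral_add_right_eq_self (fun τ => (ENNReal.ofReal (1 + |τ|) * ‖F n τ‖ₑ) ^ 2)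
      (θ * n ^ 2)]
    refine lintegral_congr fun τ => ?_
    congr 1
    have hb := bracket_pos s n
    rw [enorm_mul, ← ofReal_norm ((bracket s n : ℂ)⁻¹), norm_inv, Complex.norm_real,
      Real.norm_of_nonneg hb.le, ← mul_assoc, ← ENNReal.ofReal_mul (by positivity),
      mul_inv_cancel_right₀ hb.ne']

theorem weightedNorm_lt_top_iff {σ : ℤ → ℝ → ℝ} {F : ℤ → ℝ → ℂ} :
    weightedNorm σ s 1 F < ⊤ ↔
      ∑' n : ℤ, ∫⁻ τ, (ENNReal.ofReal ((1 + |σ n τ|) * bracket s n) * ‖F n τ‖ₑ) ^ 2 ≠ ⊤ := by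
  rw [weightedNorm, ENNReal.rpow_lt_top_iff_of_pos (by norm_num), lt_top_iff_ne_top]
  simp only [Real.rpow_one, bracket]

theorem bourgainNormOn_lt_top_iff {σ : ℤ → ℝ → ℝ} {b : ℝ} {J : Set ℝ} {u : ℝ → L2Per L} :
    bourgainNormOn σ s b J u < ⊤ ↔ ∃ w : ℝ → L2Per L, (∀ t ∈ J, w t = u t) ∧
      ∃ F, IsSpaceTimeFourier w F ∧ weightedNorm σ s b F < ⊤ := by
  simp only [bourgainNormOn, bourgainNorm, iInf_lt_iff, exists_prop]

theorem IsMildSol.schrodinger_norm_lt_top (hs : 0 ≤ s) (hT : 0 < T)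
    (hθ : θ = (2 * Real.pi / L) ^ 2) {a : Profile} {f : ℝ → Profile}
    (h : IsMildSol s θ α β T a f) (h0 : ∀ t ∉ Ioc 0 T, f t = 0) {U V : ℝ → L2Per L}
    (hUV : ∀ t ∈ Icc 0 T, IsProfile s θ t (pathOf a f t) (U t) (V t)) :
    bourgainNormOn (schrodingerSymbol L) s 1 (Icc 0 T) U < ⊤ := by
  have h2 : expNormSq 0 T (fun t => (f t).1) ≠ ⊤ := by
    refine ne_top_of_le_ne_top h.expNormSq_ne_top (lintegral_mono fun t => ?_)
    gcongr
    exact enorm_le_iff_norm_le.2 (norm_fst_le _)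
  obtain ⟨η, hη, F, hF, hFt⟩ := exists_fourier_rot s θ hT (a := a.1) (f := fun t => (f t).1)
    (g := fun n t => fieldU s θ α n t (pathOf a f t)) h.integrable.fst
    (fun t ht => by rw [h0 t ht]; rfl) h2 (fun n => continuous_fieldU hs n h.continuous_path)
    (by filter_upwards [h.ae_eq] with t ht n using (ht n).1)
  choose w hw using fun t => L2Per.exists_coeff (L := L) hs
    ((η t : ℂ) • rot θ t (pathOf a f t).1)
  have hw' : ∀ t n, (w t).toDist.coeff n
      = (bracket s n : ℂ)⁻¹ * (η t * rot θ t (pathOf a f t).1 n) := fun t n => by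
    rw [eq_inv_mul_iff_mul_eq₀ (bracket_ne_zero n), hw]
    rfl
  refine bourgainNormOn_lt_top_iff.2 ⟨w, fun t ht => L2Per.ext_coeff fun n => ?_, F,
    fun n => ⟨(hF n).1, fun t => ?_⟩, weightedNorm_lt_top_iff.2 ?_⟩
  · rw [hw', hη t ht, (hUV t ht).coeff_fst, Complex.ofReal_one, one_mul]
  · rw [hw', h.pathOf_fst, (hF n).2 t]
  · convert hFt using 8 with n τ
    rw [schrodingerSymbol, hθ]
    ring_nf

/-- The transform of conj z is conj F(-n,-τ), concentrated near τ = θn² instead of τ = -θn². The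
Boussinesq symbol is even in n and in τ, so both halves of v are controlled by the one bound for z.
-/
theorem IsMildSol.boussinesq_norm_lt_top (hs : 0 ≤ s) (hT : 0 < T)
    (hθ : θ = (2 * Real.pi / L) ^ 2) {a : Profile} {f : ℝ → Profile}
    (h : IsMildSol s θ α β T a f) (h0 : ∀ t ∉ Ioc 0 T, f t = 0) {U V : ℝ → L2Per L}
    (hUV : ∀ t ∈ Icc 0 T, IsProfile s θ t (pathOf a f t) (U t) (V t)) :
    bourgainNormOn (boussinesqSymbol L) s 1 (Icc 0 T) V < ⊤ := by
  have h2 : expNormSq 0 T (fun t => (f t).2) ≠ ⊤ := by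
    refine ne_top_of_le_ne_top h.expNormSq_ne_top (lintegral_mono fun t => ?_)
    gcongr
    exact enorm_le_iff_norm_le.2 (norm_snd_le _)
  obtain ⟨η, hη, F, hF, hFt⟩ := exists_fourier_rot s θ hT (a := a.2) (f := fun t => (f t).2)
    (g := fun n t => fieldZ s θ β n t (pathOf a f t)) h.integrable.snd
    (fun t ht => by rw [h0 t ht]; rfl) h2 (fun n => continuous_fieldZ hs n h.continuous_path)
    (by filter_upwards [h.ae_eq] with t ht n using (ht n).2)
  choose w hw using fun t => L2Per.exists_coeff (L := L) hs
    ((η t : ℂ) • rot θ t (pathOf a f t).2 + SeqL2.conjL ((η t : ℂ) • rot θ t (pathOf a f t).2))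
  have hw' : ∀ t n, (w t).toDist.coeff n = (bracket s n : ℂ)⁻¹ * (η t * rot θ t (pathOf a f t).2 n)
      + (starRingEnd ℂ) ((bracket s (-n) : ℂ)⁻¹ * (η t * rot θ t (pathOf a f t).2 (-n))) :=
    fun t n => by
      rw [map_mul, map_inv₀, Complex.conj_ofReal, bracket_neg, ← mul_add,
        eq_inv_mul_iff_mul_eq₀ (bracket_ne_zero n), hw]
      rfl
  have hcj : ∀ n, Integrable fun τ => (starRingEnd ℂ) (F n (-τ)) := fun n =>
    (Complex.conjCLE.integrable_comp_iff).2 (hF n).1.comp_neg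
  refine bourgainNormOn_lt_top_iff.2 ⟨w, fun t ht => L2Per.ext_coeff fun n => ?_,
    fun n τ => F n τ + (starRingEnd ℂ) (F (-n) (-τ)),
    fun n => ⟨(hF n).1.add (hcj (-n)), fun t => ?_⟩, weightedNorm_lt_top_iff.2 ?_⟩
  · rw [hw', hη t ht, (hUV t ht).coeff_snd, Complex.ofReal_one, one_mul, one_mul]
    rfl
  · rw [hw', h.pathOf_snd, (hF n).2 t, (hF (-n)).2 t, map_mul, ← integral_conj]
    have e1 : ∫ τ, (starRingEnd ℂ) (F (-n) τ * Complex.exp (I * t * τ))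
        = ∫ τ : ℝ, (starRingEnd ℂ) (F (-n) (-τ)) * Complex.exp (I * t * τ) := by
      rw [← integral_neg_eq_self]
      congr 1
      funext τ
      rw [map_mul, ← Complex.exp_conj, map_mul, map_mul, conj_I, Complex.conj_ofReal,
        Complex.conj_ofReal]
      push_cast
      ring_nf
    have e2 : (starRingEnd ℂ) (1 / (2 * Real.pi) : ℂ) = 1 / (2 * Real.pi) := by
      simp [Complex.conj_ofNat]
    rw [e1, e2, ← mul_add, ← integral_add (integrable_mul_exp (hF n).1 t)
      (integrable_mul_exp (hcj (-n)) t)]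
    simp only [add_mul]
  · set W : ℤ → ℝ → ℝ≥0∞ := fun n τ =>
      (ENNReal.ofReal ((1 + |τ + θ * n ^ 2|) * bracket s n) * ‖F n τ‖ₑ) ^ 2 with hW
    have hθ0 : 0 ≤ θ := by rw [hθ]; positivity
    have key : ∀ n τ, (ENNReal.ofReal ((1 + |boussinesqSymbol L n τ|) * bracket s n) *
        ‖F n τ + (starRingEnd ℂ) (F (-n) (-τ))‖ₑ) ^ 2
        ≤ 2 * ENNReal.ofReal (1 + θ) ^ 2 * W n τ
          + 2 * ENNReal.ofReal (1 + θ) ^ 2 * W (-n) (-τ) := by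
      intro n τ
      have hb := bracket_pos s n
      have b1 : ENNReal.ofReal ((1 + |boussinesqSymbol L n τ|) * bracket s n)
          ≤ ENNReal.ofReal (1 + θ) * ENNReal.ofReal ((1 + |τ + θ * n ^ 2|) * bracket s n) := by
        rw [← ENNReal.ofReal_mul (by positivity), ← mul_assoc]
        gcongr
        exact abs_boussinesqSymbol_le hθ n τ
      have b2 : ENNReal.ofReal ((1 + |boussinesqSymbol L n τ|) * bracket s n)
          ≤ ENNReal.ofReal (1 + θ) *
            ENNReal.ofReal ((1 + |-τ + θ * (-n : ℤ) ^ 2|) * bracket s (-n)) := by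
        rw [← ENNReal.ofReal_mul (by positivity), ← mul_assoc, bracket_neg]
        gcongr
        have := abs_boussinesqSymbol_le hθ (-n) (-τ)
        have e : boussinesqSymbol L (-n) (-τ) = boussinesqSymbol L n τ := by
          simp [boussinesqSymbol, Even.neg_pow (by decide : Even 4)]
        rwa [e] at this
      calc _ ≤ (ENNReal.ofReal ((1 + |boussinesqSymbol L n τ|) * bracket s n) * ‖F n τ‖ₑ +
            ENNReal.ofReal ((1 + |boussinesqSymbol L n τ|) * bracket s n) *
              ‖F (-n) (-τ)‖ₑ) ^ 2 := by
            rw [← mul_add]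
            refine pow_le_pow_left' (mul_le_mul' le_rfl ((enorm_add_le _ _).trans_eq ?_)) 2
            rw [← ofReal_norm ((starRingEnd ℂ) _), RCLike.norm_conj, ofReal_norm]
        _ ≤ (ENNReal.ofReal (1 + θ) * (ENNReal.ofReal ((1 + |τ + θ * n ^ 2|) * bracket s n) *
              ‖F n τ‖ₑ) + ENNReal.ofReal (1 + θ) *
              (ENNReal.ofReal ((1 + |-τ + θ * (-n : ℤ) ^ 2|) * bracket s (-n)) *
              ‖F (-n) (-τ)‖ₑ)) ^ 2 := by
            rw [← mul_assoc, ← mul_assoc]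
            exact pow_le_pow_left' (add_le_add (mul_le_mul' b1 le_rfl) (mul_le_mul' b2 le_rfl)) 2
        _ ≤ _ := by
            refine (ENNReal.add_sq_le _ _).trans (le_of_eq ?_)
            rw [mul_pow (ENNReal.ofReal (1 + θ)), mul_pow (ENNReal.ofReal (1 + θ)), ← mul_assoc,
              ← mul_assoc]
    have hWm : ∀ n, AEMeasurable (W n) := fun n => by
      have := (hF n).1.aestronglyMeasurable.enorm
      fun_prop
    refine ne_top_of_le_ne_top ?_ (ENNReal.tsum_le_tsum fun n => lintegral_mono fun τ => key n τ)
    have hc : 2 * ENNReal.ofReal (1 + θ) ^ 2 ≠ ⊤ := by finiteness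
    have e3 : ∀ n, ∫⁻ τ, (2 * ENNReal.ofReal (1 + θ) ^ 2 * W n τ
        + 2 * ENNReal.ofReal (1 + θ) ^ 2 * W (-n) (-τ))
        = 2 * ENNReal.ofReal (1 + θ) ^ 2 * (∫⁻ τ, W n τ)
          + 2 * ENNReal.ofReal (1 + θ) ^ 2 * ∫⁻ τ, W (-n) τ := fun n => by
      rw [lintegral_add_left' ((hWm n).const_mul _), lintegral_const_mul' _ _ hc,
        lintegral_const_mul' _ _ hc, lintegral_neg_eq_self (W (-n))]
    simp only [e3]
    have e4 : ∑' n, ∫⁻ τ, W (-n) τ = ∑' n, ∫⁻ τ, W n τ :=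
      (Equiv.neg ℤ).tsum_eq fun n => ∫⁻ τ, W n τ
    rw [ENNReal.tsum_add, ENNReal.tsum_mul_left, ENNReal.tsum_mul_left, e4]
    finiteness

end BourgainNorms

/-! ### Curves recovered from their coordinates -/

section Reconstruction

/-- A family of differentiable coordinates with square-summable initial values and derivatives in
`L²([0, T]; ℓ²)` is a curve in `ℓ²` given by an integral. -/
theorem exists_pathOf_eq {T : ℝ} (a : SeqL2) {c c' : ℤ → ℝ → ℂ}
    (h : ∀ n, ∀ t ∈ Icc 0 T, HasDerivWithinAt (c n) (c' n t) (Icc 0 T) t)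
    (h0 : ∀ n, c n 0 = a n) (h2 : ∫⁻ t in Ioc 0 T, ∑' n, ‖c' n t‖ₑ ^ 2 ≠ ⊤) :
    ∃ f : ℝ → SeqL2, StronglyMeasurable f ∧ Integrable f ∧ expNormSq 0 T f ≠ ⊤ ∧
      (∀ᵐ t ∂volume.restrict (Ioc 0 T), ∀ n, f t n = c' n t) ∧
      ∀ t ∈ Icc 0 T, ∀ n, pathOf a f t n = c n t := by
  set μ := volume.restrict (Ioc 0 T) with hμ
  -- No measurability in time is assumed of `c'`; `deriv` is measurable for every function and
  -- agrees with `c'` on the open interval.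
  set d : ℤ → ℝ → ℂ := fun n => deriv (c n) with hd
  have hdm : ∀ n, Measurable (d n) := fun n => measurable_deriv (c n)
  have hda : ∀ n, ∀ t ∈ Ioo 0 T, HasDerivAt (c n) (c' n t) t := fun n t ht =>
    (h n t (Ioo_subset_Icc_self ht)).hasDerivAt (Icc_mem_nhds ht.1 ht.2)
  have hdc : ∀ᵐ t ∂μ, ∀ n, d n t = c' n t := by
    rw [hμ, ae_restrict_iff' measurableSet_Ioc]
    filter_upwards [compl_mem_ae_iff.2 (measure_singleton (μ := volume) T)] with t ht ht' n
    exact (hda n t ⟨ht'.1, lt_of_le_of_ne ht'.2 ht⟩).deriv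
  have hd2 : ∫⁻ t, ∑' n, ‖d n t‖ₑ ^ 2 ∂μ ≠ ⊤ := by
    refine ne_of_eq_of_ne (lintegral_congr_ae ?_) h2
    filter_upwards [hdc] with t ht
    simp only [ht]
  have hfin : ∀ᵐ t ∂μ, ∑' n, ‖d n t‖ₑ ^ 2 ≠ ⊤ := by
    have hm : Measurable fun t => ∑' n, ‖d n t‖ₑ ^ 2 :=
      Measurable.tsum fun n => (hdm n).enorm.pow_const 2
    filter_upwards [ae_lt_top hm hd2] with t ht using ht.ne
  have hsm : AEStronglyMeasurable (fun t => SeqL2.ofFun fun n => d n t) μ :=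
    SeqL2.aestronglyMeasurable_ofFun hdm hfin
  set f₀ := hsm.mk _ with hf₀
  have hf₀c : ∀ᵐ t ∂μ, ∀ n, f₀ t n = c' n t := by
    filter_upwards [hsm.ae_eq_mk, hfin, hdc] with t h1 h2 h3 n
    rw [hf₀, ← h1, SeqL2.ofFun_apply h2, h3]
  set f := (Ioc 0 T).indicator f₀ with hf
  have hff : ∀ᵐ t ∂μ, f t = f₀ t := by
    rw [hμ, ae_restrict_iff' measurableSet_Ioc]
    exact Eventually.of_forall fun t ht => indicator_of_mem ht _
  have hfc : ∀ᵐ t ∂μ, ∀ n, f t n = c' n t := by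
    filter_upwards [hff, hf₀c] with t h1 h2 n
    rw [h1, h2]
  have hint2 : ∫⁻ t, ‖f₀ t‖ₑ ^ 2 ∂μ ≠ ⊤ := by
    refine ne_of_eq_of_ne (lintegral_congr_ae ?_) h2
    filter_upwards [hf₀c] with t ht
    rw [SeqL2.enorm_sq_eq]
    simp only [ht]
  have hfi : Integrable f := by
    rw [hf, integrable_indicator_iff measurableSet_Ioc]
    have : MemLp f₀ 2 μ := by
      refine ⟨hsm.stronglyMeasurable_mk.aestronglyMeasurable, ?_⟩
      have h3 : eLpNorm f₀ 2 μ ^ 2 < ⊤ := by rw [eLpNorm_two_sq]; exact hint2.lt_top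
      exact (ENNReal.pow_lt_top_iff.1 h3).resolve_right (by norm_num)
    exact this.integrable (by norm_num)
  refine ⟨f, hsm.stronglyMeasurable_mk.indicator measurableSet_Ioc, hfi, ?_, hfc,
    fun t ht n => ?_⟩
  · rw [expNormSq_zero_eq]
    refine ne_of_eq_of_ne (lintegral_congr_ae ?_) hint2
    filter_upwards [hff] with t ht
    rw [ht]
  · have h1 := pathOf_clm_of_integrable (SeqL2.eval n) (a := a) hfi t
    simp only [SeqL2.eval_apply] at h1
    rw [h1, pathOf, ← h0]
    have hfn : Integrable fun σ => f σ n := (SeqL2.eval n).integrable_comp hfi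
    have hcd : ∀ᵐ σ ∂volume, σ ∈ uIoc 0 t → f σ n = d n σ := by
      have h3 := hfc.and hdc
      rw [hμ, ae_restrict_iff' measurableSet_Ioc] at h3
      filter_upwards [h3] with σ hσ hm
      rw [uIoc_of_le ht.1] at hm
      obtain ⟨h4, h5⟩ := hσ (Ioc_subset_Ioc_right ht.2 hm)
      rw [h4, h5]
    rw [intervalIntegral.integral_congr_ae hcd,
      intervalIntegral.integral_eq_sub_of_hasDerivAt_of_le ht.1 (f := c n)]
    · ring
    · exact fun r hr => ((h n r ⟨hr.1, hr.2.trans ht.2⟩).continuousWithinAt).mono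
        (Icc_subset_Icc_right ht.2)
    · intro r hr
      have hr' : r ∈ Ioo 0 T := ⟨hr.1, hr.2.trans_le ht.2⟩
      exact (hda n r hr').differentiableAt.hasDerivAt
    · exact (hfn.intervalIntegrable (a := 0) (b := t)).congr_ae
        ((ae_restrict_iff' measurableSet_uIoc).2 hcd)

end Reconstruction

/-! ### From solutions in the class back to profiles -/

section Uniqueness

variable {L : ℝ} [hL : Fact (0 < L)] {s θ P α β T : ℝ}

open PerTest

theorem hasDerivWithinAt_bracket_phase {c : ℝ → ℂ} {c' : ℂ} {n : ℤ} {S : Set ℝ} {t : ℝ}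
    (h : HasDerivWithinAt c c' S t) :
    HasDerivWithinAt (fun r => bracket s n * phase θ n r * c r)
      (bracket s n * phase θ n t * (c' + I * θ * n ^ 2 * c t)) S t := by
  have h1 := (((hasDerivAt_phase (θ := θ) n t).hasDerivWithinAt (s := S)).const_mul
    (bracket s n : ℂ)).mul h
  refine h1.congr_deriv ?_
  ring

/-- A curve with finite Schrödinger–Bourgain norm has an interaction profile with derivative in
`L²([0, T]; ℓ²)`. -/
theorem lintegral_tsum_deriv_ne_top (hθ : θ = (2 * Real.pi / L) ^ 2) {u : ℝ → L2Per L}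
    (hu : bourgainNormOn (schrodingerSymbol L) s 1 (Icc 0 T) u < ⊤) {p' : ℤ → ℝ → ℂ}
    (hd : ∀ n, ∀ t ∈ Icc 0 T, HasDerivWithinAt
      (fun r => bracket s n * phase θ n r * (u r).toDist.coeff n) (p' n t) (Icc 0 T) t) :
    ∫⁻ t in Ioc 0 T, ∑' n, ‖p' n t‖ₑ ^ 2 ≠ ⊤ := by
  obtain ⟨w, hw, F, hF, hFt⟩ := bourgainNormOn_lt_top_iff.1 hu
  rw [weightedNorm_lt_top_iff] at hFt
  have hda : ∀ n, ∀ t ∈ Ioo 0 T, HasDerivAt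
      (fun r => bracket s n * phase θ n r * (u r).toDist.coeff n) (p' n t) t := fun n t ht =>
    (hd n t (Ioo_subset_Icc_self ht)).hasDerivAt (Icc_mem_nhds ht.1 ht.2)
  have hm : ∀ n, AEMeasurable (fun t => ‖p' n t‖ₑ ^ 2) (volume.restrict (Ioc 0 T)) := by
    intro n
    refine AEMeasurable.congr (f := fun t => ‖deriv
      (fun r => bracket s n * phase θ n r * (u r).toDist.coeff n) t‖ₑ ^ 2)
      ((measurable_deriv _).enorm.pow_const 2).aemeasurable ?_
    rw [EventuallyEq, ae_restrict_iff' measurableSet_Ioc]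
    filter_upwards [compl_mem_ae_iff.2 (measure_singleton (μ := volume) T)] with t ht ht'
    rw [(hda n t ⟨ht'.1, lt_of_le_of_ne ht'.2 ht⟩).deriv]
  rw [lintegral_tsum hm]
  refine ne_top_of_le_ne_top hFt (ENNReal.tsum_le_tsum fun n => ?_)
  -- Multiplication by the phase shifts frequencies by c = θn², so the weight |τ + c| is at most 1
  -- plus the Schrödinger modulation.
  have h1 := lintegral_deriv_sq_le (F := fun τ => bracket s n * F n τ) ((hF n).1.const_mul _)
    (θ * n ^ 2) T (p := fun r => bracket s n * phase θ n r * (u r).toDist.coeff n) (p' := p' n)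
    (fun t ht => ?_) (hda n)
  · refine h1.trans (lintegral_mono fun τ => pow_le_pow_left' ?_ 2)
    have hb := bracket_pos s n
    rw [enorm_mul, ← ofReal_norm (bracket s n : ℂ), Complex.norm_real, Real.norm_of_nonneg hb.le,
      ← mul_assoc, ← ENNReal.ofReal_mul (abs_nonneg _)]
    gcongr
    have : schrodingerSymbol L n τ = τ + θ * n ^ 2 := by rw [schrodingerSymbol, hθ]; ring
    rw [this]
    linarith
  · rw [← hw t ht, (hF n).2 t]
    simp only [mul_assoc (bracket s n : ℂ)]
    rw [integral_const_mul, phase]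
    have : Complex.exp (I * t * ((θ * n ^ 2 : ℝ) : ℂ))
        = Complex.exp (I * ((t * (θ * (n : ℝ) ^ 2) : ℝ) : ℂ)) := by
      congr 1
      push_cast
      ring
    rw [this]
    ring

/-- Every solution in the class is described by a solution of the system in the interaction
picture. -/
theorem IsSolutionInClass.exists_isMildSol (hs : 0 ≤ s) (hP : 0 ≤ P) (hθP : θ * P = 2 * Real.pi)
    (hθ : θ = (2 * Real.pi / L) ^ 2) (hT : 0 < T) (hTP : T ≤ P) {u₀ v₀ v₁ : PerDist L}
    (hdata : IsData s u₀ v₀ v₁) {u v : ℝ → L2Per L}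
    (h : IsSolutionInClass α β s 1 T u₀ v₀ v₁ u v) :
    ∃ f : ℝ → Profile, IsMildSol s θ α β T (dataProfile s u₀ v₀ v₁) f ∧
      ∀ t ∈ Icc 0 T, IsProfile s θ t (pathOf (dataProfile s u₀ v₀ v₁) f t) (u t) (v t) := by
  obtain ⟨⟨hreal, ut, vt, vtt, hut, hvt, hvtt, heq1, heq2, hu0, hv0, hv1⟩, hcu, hXu, hcv, -⟩ := h
  have h0T : (0 : ℝ) ∈ Icc 0 T := ⟨le_rfl, hT.le⟩
  set a := dataProfile s u₀ v₀ v₁ with ha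
  have dd : ∀ (D : PerDist L) n, D.dx.dx.coeff n = waveNumber L n ^ 2 * D.coeff n := fun D n => by
    rw [PerDist.coeff_dx, PerDist.coeff_dx]; ring
  have hutc : ∀ t ∈ Icc 0 T, ∀ n, (ut t).coeff n = -(I * (α * (L2Per.mulDist (v t) (u t)).coeff n
      - waveNumber L n ^ 2 * (u t).toDist.coeff n)) := fun t ht n => by
    have := congrArg (fun D => PerDist.coeff D n) (heq1 t ht)
    simp only [PerDist.coeff_add, PerDist.coeff_smul, dd] at this
    linear_combination (-I) * this + (ut t).coeff n * I_sq
  have hvttc : ∀ t ∈ Icc 0 T, ∀ n, (vtt t).coeff n = waveNumber L n ^ 2 * (v t).toDist.coeff n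
      - waveNumber L n ^ 4 * (v t).toDist.coeff n
      + β * (waveNumber L n ^ 2 * (L2Per.absSqDist (u t)).coeff n) := fun t ht n => by
    have := congrArg (fun D => PerDist.coeff D n) (heq2 t ht)
    simp only [PerDist.coeff_add, PerDist.coeff_sub, PerDist.coeff_smul, dd] at this
    linear_combination this
  set p' : ℤ → ℝ → ℂ := fun n t =>
    -(I * α) * ((bracket s n * phase θ n t) * (L2Per.mulDist (v t) (u t)).coeff n) with hp'
  have hdp : ∀ n, ∀ t ∈ Icc 0 T, HasDerivWithinAt
      (fun r => bracket s n * phase θ n r * (u r).toDist.coeff n) (p' n t) (Icc 0 T) t := by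
    intro n t ht
    refine (hasDerivWithinAt_bracket_phase (hut.coeff ht n)).congr_deriv ?_
    rw [hutc t ht, waveNumber_sq hθ]
    simp only [hp']
    ring
  have hp2 := lintegral_tsum_deriv_ne_top hθ hXu hdp
  obtain ⟨fp, hfpm, hfpi, hfp2, hfpe, hfpp⟩ := exists_pathOf_eq a.1 hdp (fun n => by
    rw [hu0, phase_time_zero, mul_one, ha, hdata.dataProfile_fst]) hp2
  set z : ℤ → ℝ → ℂ := fun n t =>
    ((v t).toDist.coeff n - I * (waveNumber L n ^ 2)⁻¹ * (vt t).coeff n) / 2 with hz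
  set q' : ℤ → ℝ → ℂ := fun n t => if n = 0 then 0 else -(I / 2) * ((bracket s n * phase θ n t) *
      (β * (L2Per.absSqDist (u t)).coeff n + (v t).toDist.coeff n)) with hq'
  -- For n = 0 the inverse wave number is zero, so z keeps only v/2. The zero mode of v_t starts at
  -- 0, since it comes from an x-derivative, and stays 0, which matches the vanishing field at n =
  -- 0.
  have hvt0 : ∀ t ∈ Icc 0 T, (vt t).coeff 0 = 0 := by
    intro t ht
    have hW : waveNumber L 0 = 0 := by simp [waveNumber]
    have h1 := (convex_Icc 0 T).norm_image_sub_le_of_norm_hasDerivWithin_le (C := 0)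
      (fun x hx => hvtt.coeff hx 0) (fun x hx => by rw [hvttc x hx, hW]; simp) h0T ht
    rw [zero_mul, hv1, PerDist.coeff_dx, hW, zero_mul, sub_zero] at h1
    exact norm_le_zero_iff.1 h1
  have hdq : ∀ n, ∀ t ∈ Icc 0 T, HasDerivWithinAt
      (fun r => bracket s n * phase θ n r * z n r) (q' n t) (Icc 0 T) t := by
    intro n t ht
    have h1 : HasDerivWithinAt (z n) (((vt t).coeff n
        - I * (waveNumber L n ^ 2)⁻¹ * (vtt t).coeff n) / 2) (Icc 0 T) t :=
      ((hvt.coeff ht n).sub ((hvtt.coeff ht n).const_mul _)).div_const 2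
    refine (hasDerivWithinAt_bracket_phase h1).congr_deriv ?_
    have hθn : I * θ * n ^ 2 = -(I * waveNumber L n ^ 2) := by rw [waveNumber_sq hθ]; ring
    rw [hθn, hvttc t ht]
    by_cases hn : n = 0
    · subst hn
      have hW : waveNumber L 0 = 0 := by simp [waveNumber]
      simp [hq', hW, hvt0 t ht]
    · have hW : waveNumber L n ≠ 0 := by
        rw [← norm_ne_zero_iff, norm_waveNumber]
        have := hL.out
        have : |(n : ℝ)| ≠ 0 := abs_ne_zero.2 (by exact_mod_cast hn)
        positivity
      simp only [hq', hz, if_neg hn]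
      field_simp
      linear_combination bracket s n * phase θ n t * (vt t).coeff n * I_sq
  have hq0 : ∀ n, bracket s n * phase θ n 0 * z n 0 = a.2 n := fun n => by
    rw [phase_time_zero, mul_one, ha, hdata.dataProfile_snd]
    simp only [hz]
    rw [hv0, hv1, PerDist.coeff_dx]
    by_cases hW : waveNumber L n = 0
    · rw [hW]; simp
    · field_simp
  -- The derivative of the half-wave profile is square-integrable: |u|² by the bilinear estimate
  -- along the profile of u just reconstructed, and v because it is bounded in H^s.
  have hq2 : ∫⁻ t in Ioc 0 T, ∑' n, ‖q' n t‖ₑ ^ 2 ≠ ⊤ := by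
    obtain ⟨R, hR⟩ := isCompact_Icc.exists_bound_of_continuousOn hcv.continuousOn
    have hpt : ∀ t ∈ Ioc 0 T, ∑' n, ‖q' n t‖ₑ ^ 2 ≤ ENNReal.ofReal (β ^ 2) *
        bilSq s θ (-1) t (pathOf a.1 fp t : SeqL2) (SeqL2.conjL (pathOf a.1 fp t))
        + ENNReal.ofReal R ^ 2 := by
      intro t ht
      have ht' := Ioc_subset_Icc_self ht
      -- An auxiliary state with vanishing second component; only the formula for |u|², which
      -- ignores that component, is needed.
      obtain ⟨V, hV⟩ := L2Per.exists_coeff (L := L) hs (rot θ t 0 + SeqL2.conjL (rot θ t 0))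
      have hprof : IsProfile s θ t (pathOf a.1 fp t, 0) (u t) V := by
        refine ⟨fun n => ?_, hV⟩
        rw [rot_apply, hfpp t ht' n, eq_inv_mul_iff_mul_eq₀ (phase_ne_zero n t)]
        ring
      have h1 : ENNReal.ofReal R ^ 2 ≥ ∑' n, ‖(bracket s n : ℂ) * (v t).toDist.coeff n‖ₑ ^ 2 := by
        have h2 : ‖PerDist.hsSeq s (v t).toDist‖ₑ ^ 2 ≤ ENNReal.ofReal R ^ 2 := by
          refine pow_le_pow_left' ?_ 2
          rw [← ofReal_norm]
          exact ENNReal.ofReal_le_ofReal (hR t ht')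
        rw [SeqL2.enorm_sq_eq] at h2
        simpa only [(hcv.1 t ht').hsSeq_apply] using h2
      refine le_trans ?_ (add_le_add_right h1 _)
      rw [bilSq, ← ENNReal.tsum_mul_left, ← ENNReal.tsum_add]
      refine ENNReal.tsum_le_tsum fun n => ?_
      rw [← hprof.coeff_absSqDist hs]
      set A := bracket s n * phase θ n t * (L2Per.absSqDist (u t)).coeff n
      set B := (bracket s n : ℂ) * (v t).toDist.coeff n
      have h3 : ‖q' n t‖ ^ 2 ≤ β ^ 2 * ‖A‖ ^ 2 + ‖B‖ ^ 2 := by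
        simp only [hq']
        split_ifs
        · rw [norm_zero, zero_pow two_ne_zero]; positivity
        · have e : (bracket s n * phase θ n t) * (β * (L2Per.absSqDist (u t)).coeff n
              + (v t).toDist.coeff n) = β * A + phase θ n t * B := by simp only [A, B]; ring
          rw [e, norm_mul, norm_neg, norm_div, norm_I, RCLike.norm_ofNat]
          have h4 : ‖β * A + phase θ n t * B‖ ≤ |β| * ‖A‖ + ‖B‖ := by
            refine (norm_add_le _ _).trans (le_of_eq ?_)
            rw [norm_mul _ A, norm_mul _ B, norm_phase, one_mul, Complex.norm_real,
              Real.norm_eq_abs]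
          have h5 : ‖β * A + phase θ n t * B‖ ^ 2 ≤ (|β| * ‖A‖ + ‖B‖) ^ 2 :=
            pow_le_pow_left₀ (norm_nonneg _) h4 2
          rw [← sq_abs β]
          nlinarith [sq_nonneg (|β| * ‖A‖ - ‖B‖), sq_nonneg (|β| * ‖A‖ + ‖B‖)]
      have h6 := ENNReal.ofReal_le_ofReal h3
      rw [ENNReal.ofReal_add (by positivity) (by positivity), ENNReal.ofReal_mul (by positivity),
        ENNReal.ofReal_pow (norm_nonneg _), ENNReal.ofReal_pow (norm_nonneg _),
        ENNReal.ofReal_pow (norm_nonneg _)] at h6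
      simpa only [ofReal_norm] using h6
    refine ne_top_of_le_ne_top ?_ (setLIntegral_mono' measurableSet_Ioc hpt)
    rw [lintegral_add_right _ measurable_const, lintegral_const_mul' _ _ ENNReal.ofReal_ne_top]
    have hb := lintegral_bilSq_clm_le (ε := -1) hs hP hθP (Or.inr rfl) hTP le_rfl le_rfl
      (expKernelBound_zero T) (expKernelBound_zero T) (a₁ := a.1) (a₂ := a.1) (f₁ := fp) (f₂ := fp)
      (Λ₁ := ContinuousLinearMap.id ℝ SeqL2) (Λ₂ := SeqL2.conjL.toContinuousLinearMap)
      (fun x => le_rfl) (fun x => (enorm_le_iff_norm_le.2 (SeqL2.conjL.norm_map x).le))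
      hfpm hfpi.integrableOn hfpm hfpi.integrableOn
    simp only [add_zero, neg_zero, zero_mul, Real.exp_zero, ENNReal.ofReal_one, one_mul] at hb
    refine ENNReal.add_ne_top.2 ⟨ENNReal.mul_ne_top ENNReal.ofReal_ne_top
      (ne_top_of_le_ne_top ?_ hb), ?_⟩
    · unfold pathNormSq
      finiteness
    · rw [setLIntegral_const, Real.volume_Ioc]
      finiteness
  obtain ⟨fq, hfqm, hfqi, hfq2, hfqe, hfqp⟩ := exists_pathOf_eq a.2 hdq hq0 hq2
  have hfi : Integrable fun t => (fp t, fq t) := hfpi.prodMk hfqi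
  have hp1 : ∀ t, (pathOf a (fun t => (fp t, fq t)) t).1 = pathOf a.1 fp t := fun t =>
    pathOf_clm_of_integrable (ContinuousLinearMap.fst ℝ SeqL2 SeqL2) hfi t
  have hq1 : ∀ t, (pathOf a (fun t => (fp t, fq t)) t).2 = pathOf a.2 fq t := fun t =>
    pathOf_clm_of_integrable (ContinuousLinearMap.snd ℝ SeqL2 SeqL2) hfi t
  have hprof : ∀ t ∈ Icc 0 T, IsProfile s θ t (pathOf a (fun t => (fp t, fq t)) t) (u t) (v t) := by
    intro t ht
    constructor
    · intro n
      rw [hp1, rot_apply, hfpp t ht n, eq_inv_mul_iff_mul_eq₀ (phase_ne_zero n t)]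
      ring
    · intro n
      have hrot : ∀ n, rot θ t (pathOf a.2 fq t) n = bracket s n * z n t := fun n => by
        rw [rot_apply, hfqp t ht n, eq_comm, eq_inv_mul_iff_mul_eq₀ (phase_ne_zero n t)]
        ring
      have hVr := fun t ht => (v t).toDist.isReal_iff.1 (hreal t ht)
      -- Reality of v_t is not part of the definition of a solution; it follows by differentiating
      -- the symmetry of the coefficients of v and uniqueness of the derivative.
      have hvtr : (starRingEnd ℂ) ((vt t).coeff (-n)) = (vt t).coeff n := by
        have d1 := Complex.conjCLE.hasFDerivAt.comp_hasDerivWithinAt t (hvt.coeff ht (-n))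
        have d2 : HasDerivWithinAt (fun r => (v r).toDist.coeff n)
            ((starRingEnd ℂ) ((vt t).coeff (-n))) (Icc 0 T) t :=
          d1.congr_of_mem (fun r hr => by
            have := hVr r hr n
            simp [this]) ht
        exact (uniqueDiffOn_Icc hT t ht).eq_deriv _ d2 (hvt.coeff ht n)
      have hW : (starRingEnd ℂ) (waveNumber L n ^ 2) = waveNumber L n ^ 2 := by
        rw [waveNumber_sq hθ]; simp
      rw [hq1, lp.coeFn_add, Pi.add_apply, SeqL2.conjL_apply, hrot, hrot, bracket_neg, map_mul,
        Complex.conj_ofReal, ← mul_add]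
      congr 1
      simp only [hz]
      rw [waveNumber_neg, neg_sq, hVr t ht, map_div₀, map_sub, map_mul, map_mul, conj_I, map_inv₀,
        hW, hvtr, Complex.conj_conj, Complex.conj_ofNat]
      ring
  refine ⟨fun t => (fp t, fq t), ⟨hfpm.prodMk hfqm, hfi, ?_, ?_⟩, hprof⟩
  · rw [expNormSq_zero_eq] at hfp2 hfq2 ⊢
    refine ne_top_of_le_ne_top (ENNReal.add_ne_top.2 ⟨hfp2, hfq2⟩) ?_
    rw [← lintegral_add_left (hfpm.enorm.pow_const 2)]
    exact lintegral_mono fun t => Profile.enorm_sq_le _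
  · filter_upwards [hfpe, hfqe, ae_restrict_mem measurableSet_Ioc] with t h1 h2 ht n
    have h3 := hprof t (Ioc_subset_Icc_self ht)
    exact ⟨(h1 n).trans (h3.fieldU_eq hs n).symm, (h2 n).trans (h3.fieldZ_eq hs n).symm⟩

end Uniqueness

/-! ### Well-posedness -/

section Wellposedness

variable {L s θ P α β T : ℝ}

theorem PerDist.IsReal.sub {D E : PerDist L} (hD : D.IsReal) (hE : E.IsReal) : (D - E).IsReal := by
  intro φ hφ
  change (D.1 φ - E.1 φ).im = 0
  rw [Complex.sub_im, hD φ hφ, hE φ hφ, sub_zero]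

variable [hL : Fact (0 < L)]

theorem IsData.sub {u₀ v₀ v₁ u₀' v₀' v₁' : PerDist L} (h : IsData s u₀ v₀ v₁)
    (h' : IsData s u₀' v₀' v₁') : IsData s (u₀ - u₀') (v₀ - v₀') (v₁ - v₁') :=
  ⟨h.1.sub h'.1, h.2.1.sub h'.2.1, h.2.2.1.sub h'.2.2.1, h.2.2.2.1.sub h'.2.2.2.1,
    h.2.2.2.2.sub h'.2.2.2.2⟩

theorem IsData.dataProfile_sub {u₀ v₀ v₁ u₀' v₀' v₁' : PerDist L} (h : IsData s u₀ v₀ v₁)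
    (h' : IsData s u₀' v₀' v₁') : dataProfile s (u₀ - u₀') (v₀ - v₀') (v₁ - v₁')
      = dataProfile s u₀ v₀ v₁ - dataProfile s u₀' v₀' v₁' := by
  refine Prod.ext ?_ ?_
  · ext n
    rw [(h.sub h').dataProfile_fst, Prod.fst_sub, lp.coeFn_sub, Pi.sub_apply, h.dataProfile_fst,
      h'.dataProfile_fst, PerDist.coeff_sub, mul_sub]
  · ext n
    rw [(h.sub h').dataProfile_snd, Prod.snd_sub, lp.coeFn_sub, Pi.sub_apply, h.dataProfile_snd,
      h'.dataProfile_snd, PerDist.coeff_sub, PerDist.coeff_sub]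
    ring

theorem IsData.norm_dataProfile_le {u₀ v₀ v₁ : PerDist L} (h : IsData s u₀ v₀ v₁) :
    ‖dataProfile s u₀ v₀ v₁‖
      ≤ (1 + L / Real.pi) * (u₀.hsNorm s + v₀.hsNorm s + v₁.hsNorm (s - 1)) := by
  have hc : 0 ≤ L / Real.pi := div_nonneg hL.out.le Real.pi_pos.le
  have n0 := u₀.hsNorm_nonneg (s := s)
  have n1 := v₀.hsNorm_nonneg (s := s)
  have n2 := v₁.hsNorm_nonneg (s := s - 1)
  have h1 : ‖(dataProfile s u₀ v₀ v₁).1‖ = u₀.hsNorm s := h.1.norm_hsSeq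
  have h2 : ‖(dataProfile s u₀ v₀ v₁).2‖ ≤ v₀.hsNorm s + L / Real.pi * v₁.hsNorm (s - 1) := by
    have h3 := tsum_dataProfile_le (s := s) v₀ v₁
    simp only [← h.dataProfile_snd, ← h.2.1.hsSeq_apply, ← h.2.2.1.hsSeq_apply] at h3
    rw [← SeqL2.enorm_sq_eq, ← SeqL2.enorm_sq_eq, ← SeqL2.enorm_sq_eq, ← ofReal_norm,
      ← ofReal_norm, ← ofReal_norm, h.2.1.norm_hsSeq, h.2.2.1.norm_hsSeq,
      ← ENNReal.ofReal_pow (norm_nonneg _), ← ENNReal.ofReal_pow n1, ← ENNReal.ofReal_pow n2,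
      ← ENNReal.ofReal_mul (by positivity), ← ENNReal.ofReal_add (by positivity) (by positivity),
      ENNReal.ofReal_le_ofReal_iff (by positivity)] at h3
    refine le_of_sq_le_sq (h3.trans ?_) (by positivity)
    nlinarith [mul_nonneg n1 (mul_nonneg hc n2)]
  rw [Prod.norm_def, h1]
  have h4 : 0 ≤ L / Real.pi * v₁.hsNorm (s - 1) := by positivity
  have h5 : 0 ≤ L / Real.pi * v₀.hsNorm s := by positivity
  have h6 : 0 ≤ L / Real.pi * u₀.hsNorm s := by positivity
  exact max_le (by linarith) (by linarith)

/-- Data whose interaction picture is solvable admit exactly one solution, and every solution is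
described by the given solution curve. -/
theorem IsMildSol.uniquelySolvable (hs : 0 ≤ s) (hP : 0 ≤ P) (hθP : θ * P = 2 * Real.pi)
    (hθ : θ = (2 * Real.pi / L) ^ 2) (hT : 0 < T) (hTP : T ≤ P) {u₀ v₀ v₁ : PerDist L}
    (hdata : IsData s u₀ v₀ v₁) {f : ℝ → Profile}
    (h : IsMildSol s θ α β T (dataProfile s u₀ v₀ v₁) f) (h0 : ∀ t ∉ Ioc 0 T, f t = 0) :
    UniquelySolvable α β s 1 T u₀ v₀ v₁ ∧ ∀ u v : ℝ → L2Per L,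
      IsSolutionInClass α β s 1 T u₀ v₀ v₁ u v → ∀ t ∈ Icc 0 T,
        IsProfile s θ t (pathOf (dataProfile s u₀ v₀ v₁) f t) (u t) (v t) := by
  have key : ∀ u v : ℝ → L2Per L,
      IsSolutionInClass α β s 1 T u₀ v₀ v₁ u v → ∀ t ∈ Icc 0 T,
        IsProfile s θ t (pathOf (dataProfile s u₀ v₀ v₁) f t) (u t) (v t) := by
    intro u v huv t ht
    obtain ⟨g, hg, hgp⟩ := huv.exists_isMildSol hs hP hθP hθ hT hTP hdata
    have hfin : ∀ g, IsMildSol s θ α β T (dataProfile s u₀ v₀ v₁) g →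
        pathNormSq 0 T (ENNReal.ofReal T) (dataProfile s u₀ v₀ v₁) g ≠ ⊤ := fun g hg => by
      have := hg.expNormSq_ne_top
      unfold pathNormSq
      finiteness
    -- Uniqueness is the Lipschitz estimate for equal initial profiles. No smallness enters: the sum
    -- of the two finite sizes serves as the common bound.
    obtain ⟨K, -, hK⟩ := IsMildSol.exists_lipschitz (s := s) (α := α) (β := β) hs hP hθP hTP
      (ENNReal.add_ne_top.2 ⟨hfin f h, hfin g hg⟩)
    have h1 := hK _ _ f g h hg le_self_add le_add_self t ht
    rw [sub_self, enorm_zero, mul_zero, nonpos_iff_eq_zero, enorm_eq_zero, sub_eq_zero] at h1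
    rw [h1]
    exact hgp t ht
  refine ⟨?_, key⟩
  choose U V hUV using fun t => exists_isProfile (L := L) (θ := θ) hs t
    (pathOf (dataProfile s u₀ v₀ v₁) f t)
  have hsol : IsSolutionInClass α β s 1 T u₀ v₀ v₁ U V :=
    ⟨h.solvesSB hs hT.le hθ hdata h0 fun t _ => hUV t, (h.continuousInHs fun t _ => hUV t).1,
      h.schrodinger_norm_lt_top hs hT hθ h0 fun t _ => hUV t,
      (h.continuousInHs fun t _ => hUV t).2,
      h.boussinesq_norm_lt_top hs hT hθ h0 fun t _ => hUV t⟩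
  exact ⟨U, V, hsol, fun u v huv t ht => (key u v huv t ht).unique (hUV t)⟩

end Wellposedness

theorem theorem1p2 (L : ℝ) [Fact (0 < L)] (α β s : ℝ) (hs : 0 ≤ s) :
    ∃ b : ℝ, 1 / 2 < b ∧ ∃ T : ℝ → ℝ → ℝ → ℝ, (∀ x y z, 0 < T x y z) ∧
      ∀ u₀ v₀ v₁ : PerDist L, IsData s u₀ v₀ v₁ →
        ∀ T₀ : ℝ, T₀ = T (u₀.hsNorm s) (v₀.hsNorm s) (v₁.hsNorm (s - 1)) →
          UniquelySolvable α β s b T₀ u₀ v₀ v₁ ∧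
          ∃ r K : ℝ, 0 < r ∧
            (∀ f₀ g₀ g₁ : PerDist L, IsData s f₀ g₀ g₁ →
              dataDist s f₀ g₀ g₁ u₀ v₀ v₁ < r → UniquelySolvable α β s b T₀ f₀ g₀ g₁) ∧
            (∀ f₀ g₀ g₁ f₀' g₀' g₁' : PerDist L,
              IsData s f₀ g₀ g₁ → IsData s f₀' g₀' g₁' →
              dataDist s f₀ g₀ g₁ u₀ v₀ v₁ < r → dataDist s f₀' g₀' g₁' u₀ v₀ v₁ < r →
              ∀ u v u' v' : ℝ → L2Per L,
                IsSolutionInClass α β s b T₀ f₀ g₀ g₁ u v →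
                IsSolutionInClass α β s b T₀ f₀' g₀' g₁' u' v' →
                ∀ t ∈ Set.Icc 0 T₀,
                  (u t - u' t).toDist.hsNorm s + (v t - v' t).toDist.hsNorm s ≤
                    K * dataDist s f₀ g₀ g₁ f₀' g₀' g₁') := by
  have hL : 0 < L := Fact.out
  set θ : ℝ := (2 * Real.pi / L) ^ 2 with hθ
  set P : ℝ := L ^ 2 / (2 * Real.pi) with hP
  have hP0 : 0 < P := by positivity
  have hθP : θ * P = 2 * Real.pi := by
    rw [hθ, hP]
    field_simp
  have hsol := fun R : ℝ => exists_isMildSol (α := α) (β := β) hs hP0 hθP (sq_nonneg R)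
  choose T hT0 hTP M hM hsol using hsol
  set C : ℝ := 1 + L / Real.pi with hC
  have hC0 : 0 < C := by positivity
  -- Here b = 1. The absolute values make the argument of `T` nonnegative for all real triples, and
  -- the summand 1 enlarges the radius by C, so that the same time serves all data at distance less
  -- than r = 1.
  refine ⟨1, by norm_num, fun x y z => T (C * (|x| + |y| + |z| + 1)), fun x y z => hT0 _, ?_⟩
  intro u₀ v₀ v₁ hdata T₀ hT₀
  simp only [abs_of_nonneg (PerDist.hsNorm_nonneg _)] at hT₀
  set R : ℝ := C * (u₀.hsNorm s + v₀.hsNorm s + v₁.hsNorm (s - 1) + 1) with hR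
  subst hT₀
  have hmild : ∀ f₀ g₀ g₁ : PerDist L, ‖dataProfile s f₀ g₀ g₁‖ ≤ R →
      ∃ f : ℝ → Profile, IsMildSol s θ α β (T R) (dataProfile s f₀ g₀ g₁) f ∧
        pathNormSq 0 (T R) (ENNReal.ofReal (T R)) (dataProfile s f₀ g₀ g₁) f ≤ M R ∧
        ∀ t ∉ Ioc 0 (T R), f t = 0 := fun f₀ g₀ g₁ h => by
    refine hsol R _ ?_
    rw [← ofReal_norm, ← ENNReal.ofReal_pow (norm_nonneg _)]
    exact ENNReal.ofReal_le_ofReal (pow_le_pow_left₀ (norm_nonneg _) h 2)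
  have hbase : ‖dataProfile s u₀ v₀ v₁‖ ≤ R - C :=
    hdata.norm_dataProfile_le.trans (by rw [hR]; linarith)
  have hnear : ∀ f₀ g₀ g₁ : PerDist L, IsData s f₀ g₀ g₁ → dataDist s f₀ g₀ g₁ u₀ v₀ v₁ < 1 →
      ‖dataProfile s f₀ g₀ g₁‖ ≤ R := fun f₀ g₀ g₁ h hd => by
    have h1 := (h.sub hdata).norm_dataProfile_le
    rw [h.dataProfile_sub hdata] at h1
    have h2 := norm_sub_norm_le (dataProfile s f₀ g₀ g₁) (dataProfile s u₀ v₀ v₁)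
    have h3 : C * dataDist s f₀ g₀ g₁ u₀ v₀ v₁ ≤ C * 1 := by gcongr
    rw [dataDist] at h3
    linarith
  have huniq : ∀ f₀ g₀ g₁ : PerDist L, IsData s f₀ g₀ g₁ → ‖dataProfile s f₀ g₀ g₁‖ ≤ R →
      UniquelySolvable α β s 1 (T R) f₀ g₀ g₁ := fun f₀ g₀ g₁ h hn => by
    obtain ⟨f, hf, -, hf0⟩ := hmild f₀ g₀ g₁ hn
    exact (hf.uniquelySolvable hs hP0.le hθP hθ (hT0 R) (hTP R) h hf0).1
  -- All profile curves produced on this interval have size at most `M R`, so one K serves all pairs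
  -- of nearby data. The factors C and 3 in the final constant come from passing from data to
  -- profiles and from profiles to states.
  obtain ⟨K, hK, hlip⟩ := IsMildSol.exists_lipschitz (s := s) (α := α) (β := β) hs hP0.le hθP
    (hTP R) (hM R)
  refine ⟨huniq _ _ _ hdata (by linarith), 1, 3 * (K.toReal * C), one_pos,
    fun f₀ g₀ g₁ h hd => huniq _ _ _ h (hnear _ _ _ h hd), ?_⟩
  intro f₀ g₀ g₁ f₀' g₀' g₁' h h' hd hd' u v u' v' huv huv' t ht
  obtain ⟨f, hf, hfM, hf0⟩ := hmild f₀ g₀ g₁ (hnear _ _ _ h hd)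
  obtain ⟨f', hf', hfM', hf0'⟩ := hmild f₀' g₀' g₁' (hnear _ _ _ h' hd')
  have p := (hf.uniquelySolvable hs hP0.le hθP hθ (hT0 R) (hTP R) h hf0).2 u v huv t ht
  have p' := (hf'.uniquelySolvable hs hP0.le hθP hθ (hT0 R) (hTP R) h' hf0').2 u' v' huv' t ht
  refine (p.hsNorm_sub_le p').trans ?_
  have h1 := hlip _ _ f f' hf hf' hfM hfM' t ht
  rw [← ENNReal.ofReal_toReal hK, ← ofReal_norm, ← ofReal_norm,
    ← ENNReal.ofReal_mul ENNReal.toReal_nonneg, ENNReal.ofReal_le_ofReal_iff (by positivity)] at h1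
  have h2 := (h.sub h').norm_dataProfile_le
  rw [h.dataProfile_sub h'] at h2
  rw [mul_assoc, mul_assoc]
  refine mul_le_mul_of_nonneg_left (h1.trans ?_) (by norm_num)
  exact mul_le_mul_of_nonneg_left h2 ENNReal.toReal_nonneg

end
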